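/- **Setting.** Let $V$ be a non-empty set of $n$ vertices with integer capacities $b_v\ge 1$, and let $G$ be a multigraph on $V$ without self-loops, with $m$ edges (counted with multiplicity) whose weights are integers in $\{1,\dots,W\}$, $W\ge 1$. Any number of parallel edges is allowed; in particular there may be more than $\min(b_u,b_v)$ edges between $u$ and $v$. A $b$-matching is a multiset $M$ of edges in which every $v$ has at most $b_v$ incident edges; $w(M)$ is its total weight, $|M|$ its number of edges, and $M_G$ denotes an arbitrary maximum weight $b$-matching included in $G$. For a multiset $H$ of edges, $\mathrm{wdeg}_H(v)$ is the total weight of the edges of $H$ incident to $v$, and $H_{uv}$ is the multiset of edges of $H$ between $u$ and $v$. An edge $e=(u,v,w)$ is *irrelevant* for $H$ if $|H_{uv}|=\min(b_u,b_v)$ and $w\le\min_{f\in H_{uv}}w(f)$; *swapping $e$ into* $H$ means removing a lightest edge of $H_{uv}$ if $|H_{uv}|=\min(b_u,b_v)$, and then adding $e$. The edge $e$ is *accepted* by $H$ if $\frac{\mathrm{wdeg}_H(u)}{b_u}+\frac{\mathrm{wdeg}_H(v)}{b_v}<\beta^- w$ and $e$ is not irrelevant for $H$. **Algorithm** (parameters: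 a real $\varepsilon_0>0$ and integers $\beta>\beta^-\geq 0$; it knows $n$, $m$, $W$ and $b$, and reads the edges once). Put $N_i=2^{i+2}\beta^2W^2+1$ and $\alpha_i=\left\lfloor\frac{\varepsilon_0 m}{N_i\log_2 m}\right\rfloor$ (with $\alpha_i=0$ if $m\le 1$). 1. *First phase.* Start with $H=\emptyset$. For $i=0,1,\dots,\lfloor\log_2 m\rfloor$, perform up to $N_i$ epochs; an epoch reads the next $\alpha_i$ edges of the stream. Each edge read that is accepted by $H$ is swapped into $H$, and then, as long as some $(u',v',w')\in H$ has $\frac{\mathrm{wdeg}_H(u')}{b_{u'}}+\frac{\mathrm{wdeg}_H(v')}{b_{v'}}>\beta w'$, such an edge is removed from $H$. The first phase ends as soon as an epoch ends (possibly after $\alpha_i=0$ edges) in which no edge was accepted, or when all levels $i$ are exhausted. 2. *Second phase.* Start with $X=\emptyset$; add to $X$ each remaining edge of the stream that is accepted by $H$ (which no longer changes). 3. *In parallel, during the whole stream*, maintain the relevant edges seen so far: start with $R=\emptyset$, ignore an edge that is irrelevant for $R$, and swap every other edge into $R$. If after some edge $|R|\ge 2n\cdot\frac{3W^2}{2\varepsilon_0^2}\ln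 m$, stop this procedure and discard $R$. 4. *Output* a maximum weight $b$-matching of $R$ if $R$ was not discarded, and of $H\cup X$ otherwise. The choices left open (which lightest edge, which edge violating the degree bound, which maximum weight $b$-matching) are made by an arbitrary fixed deterministic rule depending only on the set of candidates or on the multiset at hand. Memory is counted in words: three words per stored edge (in $H$, $X$, $R$) and for the edge being read, two words per vertex, and $16$ words for parameters, counters and flags. **Theorem.** There are polynomials $P$ (in three variables) and $Q$ (in two variables) such that the following holds. For every real $\varepsilon>0$ and every integer $W\ge 1$ there are parameters $\varepsilon_0,\beta,\beta^-$, depending only on $\varepsilon$ and $W$, with $0<\varepsilon_0<\frac12$, $\beta\ge\beta^-+2$, and, for $\lambda=\frac{\varepsilon_0}{100W}$, $$\frac{\beta+8W}{\ln(\beta+8W)}\ge 2W^2\lambda^{-2},\qquad \beta^--6W\ge(1-\lambda)(\beta+8W),\qquad \beta\le Q(W,1/\varepsilon),$$ such that for all $V$, $b$, $G$ as above, every rule for the open choices and every maximum weight $b$-matching $M_G$ of $G$: if the $m$ edges of $G$ are presented in a uniformly random order, then with probability at least $1-2m^{-3}$ both of the following hold: * the output $M$ is a $b$-matching included in $G$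 with $\left(2-\frac1{2W}+\varepsilon\right)w(M)\ge w(M_G)$; * after every prefix of the stream the algorithm uses at most $\max(|M_G|,n)\cdot P(\ln m,W,1/\varepsilon)$ words of memory. (If $m=0$, the probability bound reads $1$ and $\ln m$ is read as $0$.) -/

import Mathlib

noncomputable section

namespace BMatch

/-! ### Weighted multigraphs and `b`-matchings -/

/-- A weighted edge between `src` and `dst`. A multigraph is a multiset of such edges; edges are
undirected, the order of the two ends is only a way of writing the edge down. -/
structure Edge (V : Type*) where
  src : V
  dst : V
  wt : ℕ

variable {V : Type*}

/-- `v` is an end of `e`. -/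
def Edge.Inc (e : Edge V) (v : V) : Prop := e.src = v ∨ e.dst = v

/-- No self-loop, and a weight in `{1, …, W}`. -/
def Edge.Valid (W : ℕ) (e : Edge V) : Prop := e.src ≠ e.dst ∧ 1 ≤ e.wt ∧ e.wt ≤ W

open Classical in
/-- `δ_H(v)`: the multiset of edges of `H` incident to `v`. -/
def star (H : Multiset (Edge V)) (v : V) : Multiset (Edge V) := H.filter (fun e => e.Inc v)

/-- The total weight of a multiset of edges. -/
def weight (H : Multiset (Edge V)) : ℕ := (H.map Edge.wt).sum

/-- The weighted degree of `v` in `H`. -/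
def wdeg (H : Multiset (Edge V)) (v : V) : ℕ := weight (star H v)

open Classical in
/-- `δ_H(u) ∩ δ_H(v)`: the edges of `H` linking `u` and `v` (for `u ≠ v`). -/
def between (H : Multiset (Edge V)) (u v : V) : Multiset (Edge V) :=
  H.filter (fun e => e.Inc u ∧ e.Inc v)

/-- `M` is a `b`-matching. -/
def IsBMatching (b : V → ℕ) (M : Multiset (Edge V)) : Prop := ∀ v, (star M v).card ≤ b v

/-- `M` is a maximum weight `b`-matching included in `G`. -/
def IsMaxWeightBMatching (b : V → ℕ) (G M : Multiset (Edge V)) : Prop :=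
  M ≤ G ∧ IsBMatching b M ∧ ∀ N ≤ G, IsBMatching b N → weight N ≤ weight M

/-- `wdeg_H(u) / b_u + wdeg_H(v) / b_v` for an edge `e` between `u` and `v`. -/
def load (b : V → ℕ) (H : Multiset (Edge V)) (e : Edge V) : ℝ :=
  (wdeg H e.src : ℝ) / b e.src + (wdeg H e.dst : ℝ) / b e.dst

/-- `H` already holds `min (b_u, b_v)` edges between the two ends of `e`. -/
def Full (b : V → ℕ) (H : Multiset (Edge V)) (e : Edge V) : Prop :=
  (between H e.src e.dst).card = min (b e.src) (b e.dst)

/-- `e` is irrelevant with respect to `H`: `H` already holds `min (b_u, b_v)` edges between its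
ends, and none of them is lighter than `e`. -/
def Irrelevant (b : V → ℕ) (H : Multiset (Edge V)) (e : Edge V) : Prop :=
  Full b H e ∧ ∀ f ∈ between H e.src e.dst, e.wt ≤ f.wt

/-- The multigraph whose edges are `e 0, …, e (m - 1)`. -/
def graph {m : ℕ} (e : Fin m → Edge V) : Multiset (Edge V) := (List.ofFn e : List (Edge V))

/-- The stream presenting these edges in the order given by the permutation `π`. -/
def stream {m : ℕ} (e : Fin m → Edge V) (π : Equiv.Perm (Fin m)) : List (Edge V) :=
  List.ofFn fun i => e (π i)

/-! ### The streaming algorithm -/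

/-- The numerical parameters of the algorithm (`βm` stands for `β⁻`). -/
structure Params where
  eps : ℝ
  β : ℕ
  βm : ℕ

/-- The conditions imposed on the parameters, with `λ = eps / (100 W)`. -/
def Params.Admissible (p : Params) (W : ℕ) : Prop :=
  0 < p.eps ∧ p.eps < 1 / 2 ∧ p.βm + 2 ≤ p.β ∧
  2 * (W : ℝ) ^ 2 * ((p.eps / (100 * W)) ^ 2)⁻¹ ≤
    ((p.β : ℝ) + 8 * W) / Real.log ((p.β : ℝ) + 8 * W) ∧
  (1 - p.eps / (100 * W)) * ((p.β : ℝ) + 8 * W) ≤ (p.βm : ℝ) - 6 * W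

/-- A rule for the choices that the pseudo-code leaves open: which one of the smallest edges
linking two vertices is removed, which edge violating the degree bound is removed next, and which
maximum weight `b`-matching is returned. -/
structure Choices (b : V → ℕ) (p : Params) where
  lightest : Multiset (Edge V) → Edge V
  lightest_spec : ∀ S, S ≠ 0 → lightest S ∈ S ∧ ∀ f ∈ S, (lightest S).wt ≤ f.wt
  excess : Multiset (Edge V) → Edge V
  excess_spec : ∀ H, (∃ e ∈ H, (p.β : ℝ) * e.wt < load b H e) →
    excess H ∈ H ∧ (p.β : ℝ) * (excess H).wt < load b H (excess H)
  best : Multiset (Edge V) → Multiset (Edge V)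
  best_spec : ∀ S, IsMaxWeightBMatching b S (best S)

/-- Every multigraph has a maximum weight `b`-matching. -/
theorem exists_isMaxWeightBMatching (b : V → ℕ) (S : Multiset (Edge V)) :
    ∃ M, IsMaxWeightBMatching b S M := by
  classical
  obtain ⟨M, hM, hmax⟩ := Finset.exists_max_image
    (S.powerset.toFinset.filter (fun N => IsBMatching b N)) weight
    ⟨0, Finset.mem_filter.2 ⟨by simp, fun v => by simp [star]⟩⟩
  simp only [Finset.mem_filter, Multiset.mem_toFinset, Multiset.mem_powerset] at hM hmax
  exact ⟨M, hM.1, hM.2, fun N h1 h2 => hmax N ⟨h1, h2⟩⟩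

/-- The open choices can always be made. -/
instance [Nonempty V] (b : V → ℕ) (p : Params) : Nonempty (Choices b p) := by
  classical
  let d : Edge V := ⟨Classical.arbitrary V, Classical.arbitrary V, 0⟩
  have h1 : ∀ S : Multiset (Edge V), ∃ e, S ≠ 0 → e ∈ S ∧ ∀ f ∈ S, e.wt ≤ f.wt := by
    intro S
    by_cases hS : S = 0
    · exact ⟨d, fun h => absurd hS h⟩
    · obtain ⟨e, he, hmin⟩ := Finset.exists_min_image S.toFinset Edge.wt
        (by simpa [Finset.nonempty_iff_ne_empty] using hS)
      exact ⟨e, fun _ => ⟨by simpa using he, fun f hf => hmin f (by simpa using hf)⟩⟩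
  have h2 : ∀ H : Multiset (Edge V), ∃ e, (∃ e ∈ H, (p.β : ℝ) * e.wt < load b H e) →
      e ∈ H ∧ (p.β : ℝ) * e.wt < load b H e := by
    intro H
    by_cases h : ∃ e ∈ H, (p.β : ℝ) * e.wt < load b H e
    · obtain ⟨e, he⟩ := h
      exact ⟨e, fun _ => he⟩
    · exact ⟨d, fun h' => absurd h' h⟩
  choose f hf using h1
  choose g hg using h2
  choose k hk using exists_isMaxWeightBMatching b
  exact ⟨⟨f, hf, g, hg, k, hk⟩⟩

section Algorithm

variable {b : V → ℕ} {p : Params}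

open Classical in
/-- Add `e` to `H`, after removing the smallest edge linking its ends if `H` already holds
`min (b_u, b_v)` of them. -/
def swapIn (c : Choices b p) (H : Multiset (Edge V)) (e : Edge V) : Multiset (Edge V) :=
  e ::ₘ (if Full b H e then H.erase (c.lightest (between H e.src e.dst)) else H)

open Classical in
/-- The loop `while some edge (u, v, w) of H has wdeg_H(u) / b_u + wdeg_H(v) / b_v > β w, remove it
from H`. -/
def prune (c : Choices b p) (H : Multiset (Edge V)) : Multiset (Edge V) :=
  if h : ∃ e ∈ H, (p.β : ℝ) * e.wt < load b H e then prune c (H.erase (c.excess H)) else H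
termination_by H.card
decreasing_by exact Multiset.card_erase_lt_of_mem (c.excess_spec H h).1

/-- The test deciding whether an arriving edge is used: `wdeg_H(u) / b_u + wdeg_H(v) / b_v < β⁻ w`
and the edge is not irrelevant. -/
def Accepts (b : V → ℕ) (p : Params) (H : Multiset (Edge V)) (e : Edge V) : Prop :=
  load b H e < (p.βm : ℝ) * e.wt ∧ ¬ Irrelevant b H e

/-- Where the algorithm stands. In the first phase: the level `i`, the number `j` of epochs of that
level that are over, the number `k` of edges read in the current epoch, and the flag
`FoundUnderfull`. -/
inductive Phase where
  | early (i j k : ℕ) (found : Bool)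
  | late

/-- The length `α_i` of an epoch of level `i`, for a stream of `m` edges. -/
def epochLength (p : Params) (W m i : ℕ) : ℕ :=
  ⌊p.eps * m / (Real.logb 2 m * ((2 : ℝ) ^ (i + 2) * (p.β : ℝ) ^ 2 * (W : ℝ) ^ 2 + 1))⌋₊

/-- The number of epochs of level `i`. -/
def epochCount (p : Params) (W i : ℕ) : ℕ := 2 ^ (i + 2) * p.β ^ 2 * W ^ 2 + 1

open Classical in
/-- Begin epoch `j` of level `i`. If there is no level `i` left then the first phase is over, and so
it is if `α_i = 0`, since an epoch without edges ends without an underfull edge. -/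
def startEpoch (p : Params) (W m i j : ℕ) : Phase :=
  if i ≤ Nat.log 2 m ∧ 0 < epochLength p W m i then .early i j 0 false else .late

open Classical in
/-- Update the position after an edge was read; `hit` tells whether it was inserted in `H`. An epoch
that ends without an insertion ends the first phase. -/
def Phase.advance (p : Params) (W m : ℕ) (hit : Bool) : Phase → Phase
  | .late => .late
  | .early i j k found =>
    if k + 1 < epochLength p W m i then .early i j (k + 1) (found || hit)
    else if (found || hit) = false then .late
    else if j + 1 < epochCount p W i then startEpoch p W m i (j + 1)
    else startEpoch p W m (i + 1) 0

/-- The contents of the memory: the subgraph `H` of the first phase, the set `X` of the underfull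
edges of the second phase, the relevant edges `R` seen so far, kept by an auxiliary procedure that
runs in parallel (`none` once that procedure has been stopped), and the position. -/
structure State (V : Type*) where
  H : Multiset (Edge V)
  X : Multiset (Edge V)
  R : Option (Multiset (Edge V))
  phase : Phase

/-- The state before the first edge. -/
def initState (V : Type*) (p : Params) (W m : ℕ) : State V where
  H := 0
  X := 0
  R := some 0
  phase := startEpoch p W m 0 0

/-- The number of edges at which the auxiliary procedure is stopped, for a stream of `m` edges on
`n` vertices. -/
def auxLimit (p : Params) (W n m : ℕ) : ℝ :=
  2 * n * (3 * (W : ℝ) ^ 2 / (2 * p.eps ^ 2)) * Real.log m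

open Classical in
/-- One step of the auxiliary procedure: maintain the relevant edges seen so far, and stop (giving
up everything stored) if their number reaches the limit. -/
def auxStep (c : Choices b p) (W n m : ℕ) (R : Multiset (Edge V)) (e : Edge V) :
    Option (Multiset (Edge V)) :=
  let R' := if Irrelevant b R e then R else swapIn c R e
  if (R'.card : ℝ) < auxLimit p W n m then some R' else none

open Classical in
/-- Process the next edge of the stream. -/
def step (c : Choices b p) (W n m : ℕ) (s : State V) (e : Edge V) : State V where
  H := match s.phase with
    | .early _ _ _ _ => if Accepts b p s.H e then prune c (swapIn c s.H e) else s.H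
    | .late => s.H
  X := match s.phase with
    | .early _ _ _ _ => s.X
    | .late => if Accepts b p s.H e then e ::ₘ s.X else s.X
  R := s.R.bind fun R => auxStep c W n m R e
  phase := s.phase.advance p W m (decide (Accepts b p s.H e))

/-- The state after a single pass over the list `l` of edges. -/
def run (c : Choices b p) (W n m : ℕ) (l : List (Edge V)) : State V :=
  l.foldl (step c W n m) (initState V p W m)

/-- The result: a maximum weight `b`-matching of the relevant edges if the auxiliary procedure was
not stopped, and of `H ∪ X` otherwise. -/
def output (c : Choices b p) (s : State V) : Multiset (Edge V) :=
  match s.R with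
  | some R => c.best R
  | none => c.best (s.H + s.X)

end Algorithm

/-- The number of memory words in use: three for each stored edge and for the edge being read, two
for each of the `n` vertices (its capacity and its weighted degree in `H`), and sixteen for the
parameters, the counters and the flags. -/
def State.words (n : ℕ) (s : State V) : ℕ :=
  3 * (s.H.card + s.X.card + (s.R.getD 0).card + 1) + 2 * n + 16

end BMatch

end

noncomputable section

namespace BMatch

open scoped Classical BigOperators

section

variable {V : Type*}

/-! ### Basic facts on multisets of edges -/

/-! The core is a deterministic duality bound. Suppose every edge of `H` has load at most `β` times
its weight, and a `b`-matching is split as `N + O`, where the edges of `O` have load at least `(1 -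
l) * β` times their weight. Then `H + N` contains a `b`-matching of at least about `1 / (2 -
1/(2W))` of its weight (`exists_heavy_isBMatching`).

To see this, replace each vertex `v` by `b v` copies and attach the given `b`-matching to distinct
copies. Put the two ends of each of its edges on opposite random sides, send each end of each edge
of `H` to a random copy, and keep the crossing edges. Egerváry's theorem (`exists_perm_dual`) gives
a matching and an integral dual `y` of no larger total value, covering `N` and the crossing part of
`H`. Only edges of `O` can be uncovered, each with an integer deficit of at least 1. Now every copy
hands out about `y` in total to its neighbours. By convexity (`tangent_le`), `1 - 1/(2W)` times what
the two ends of an uncovered edge receive pays for its deficit, so the weight is at most about `(1 +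
1 - 1/(2W)) * ∑ y` (`sum_weight_le_of_dual`). The errors are controlled by second moments of the
crossing degrees. These are linear in the load, hence small against the square of a slack
proportional to `β`. This uses that `H` has few parallel edges.

For the algorithm, the edges of an optimum that arrive in the second phase are accepted (so in `X`),
or heavily loaded, or irrelevant. The irrelevant ones are exchanged for edges of `H`
(`exists_replacement`), and duality applies to the rest. The first phase reads at most `2 * eps * m`
edges, so in a random order few edges of a large optimum come early. If the optimum is small, the
relevant edges `R` were never discarded, and `R` contains an optimum outright.

For the memory, each insertion raises a potential by 2, and the potential is at most a multiple of
the number of edges of `H`, hence of the optimum. This bounds the last level `i`. An epoch without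
acceptances shows, with high probability, that few of the remaining edges would be accepted by the
same `H` (`card_missing_le`), and this bounds `X`. -/

@[simp] theorem star_zero (v : V) : star (0 : Multiset (Edge V)) v = 0 := by simp [star]

@[simp] theorem weight_zero : weight (0 : Multiset (Edge V)) = 0 := by simp [weight]

@[simp] theorem weight_cons (e : Edge V) (H : Multiset (Edge V)) :
    weight (e ::ₘ H) = e.wt + weight H := by simp [weight]

@[simp] theorem weight_add (H K : Multiset (Edge V)) : weight (H + K) = weight H + weight K := by
  simp [weight]

@[simp] theorem star_add (H K : Multiset (Edge V)) (v : V) :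
    star (H + K) v = star H v + star K v := by simp [star]

theorem star_cons (e : Edge V) (H : Multiset (Edge V)) (v : V) :
    star (e ::ₘ H) v = (if e.Inc v then {e} else 0) + star H v := by
  simp only [star, Multiset.filter_cons]

@[simp] theorem wdeg_add (H K : Multiset (Edge V)) (v : V) :
    wdeg (H + K) v = wdeg H v + wdeg K v := by simp [wdeg]

theorem wdeg_cons (e : Edge V) (H : Multiset (Edge V)) (v : V) :
    wdeg (e ::ₘ H) v = (if e.Inc v then e.wt else 0) + wdeg H v := by
  unfold wdeg
  rw [star_cons, weight_add]
  split_ifs <;> simp [weight]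

@[simp] theorem wdeg_zero (v : V) : wdeg (0 : Multiset (Edge V)) v = 0 := by simp [wdeg]

theorem weight_le_of_le {H K : Multiset (Edge V)} (h : H ≤ K) : weight H ≤ weight K := by
  obtain ⟨L, rfl⟩ := Multiset.le_iff_exists_add.1 h
  simp

theorem star_le_of_le {H K : Multiset (Edge V)} (h : H ≤ K) (v : V) : star H v ≤ star K v :=
  Multiset.filter_le_filter _ h

theorem wdeg_le_of_le {H K : Multiset (Edge V)} (h : H ≤ K) (v : V) : wdeg H v ≤ wdeg K v :=
  weight_le_of_le (star_le_of_le h v)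

theorem IsBMatching.mono {b : V → ℕ} {M N : Multiset (Edge V)} (hM : IsBMatching b M)
    (h : N ≤ M) : IsBMatching b N := fun v =>
  (Multiset.card_le_card (star_le_of_le h v)).trans (hM v)

theorem load_mono {b : V → ℕ} {H K : Multiset (Edge V)} (h : H ≤ K) (e : Edge V) :
    load b H e ≤ load b K e := by
  unfold load
  have h1 := wdeg_le_of_le h e.src
  have h2 := wdeg_le_of_le h e.dst
  gcongr

theorem card_le_weight {W : ℕ} {H : Multiset (Edge V)} (h : ∀ e ∈ H, e.Valid W) :
    H.card ≤ weight H := by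
  induction H using Multiset.induction_on with
  | empty => simp
  | cons e H ih =>
    have h1 := ih fun f hf => h f (Multiset.mem_cons_of_mem hf)
    have h2 := (h e (Multiset.mem_cons_self e H)).2.1
    simp only [Multiset.card_cons, weight_cons]
    omega

theorem weight_le_mul_card {W : ℕ} {H : Multiset (Edge V)} (h : ∀ e ∈ H, e.Valid W) :
    weight H ≤ W * H.card := by
  induction H using Multiset.induction_on with
  | empty => simp
  | cons e H ih =>
    have h1 := ih fun f hf => h f (Multiset.mem_cons_of_mem hf)
    have h2 := (h e (Multiset.mem_cons_self e H)).2.2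
    simp only [Multiset.card_cons, weight_cons]
    rw [mul_add]
    omega

theorem sum_ite_inc [Fintype V] {e : Edge V} (he : e.src ≠ e.dst) (f : V → ℝ) :
    ∑ v, (if e.Inc v then f v else 0) = f e.src + f e.dst := by
  have : ∀ v, (if e.Inc v then f v else 0) =
      (if e.src = v then f v else 0) + (if e.dst = v then f v else 0) := by
    intro v
    unfold Edge.Inc
    by_cases h1 : e.src = v <;> by_cases h2 : e.dst = v <;> simp [h1, h2]
    exact absurd (h1.trans h2.symm) he
  simp [this, Finset.sum_add_distrib]

theorem sum_card_star [Fintype V] {W : ℕ} {H : Multiset (Edge V)} (h : ∀ e ∈ H, e.Valid W) :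
    ∑ v, (star H v).card = 2 * H.card := by
  induction H using Multiset.induction_on with
  | empty => simp
  | cons e H ih =>
    have h1 := ih fun f hf => h f (Multiset.mem_cons_of_mem hf)
    have h2 := sum_ite_inc (h e (Multiset.mem_cons_self e H)).1 fun _ => 1
    have h3 : ∑ v, (if e.Inc v then 1 else 0) = 2 := by
      have : ((∑ v, (if e.Inc v then 1 else 0) : ℕ) : ℝ) = 2 := by
        push_cast; rw [h2]; norm_num
      exact_mod_cast this
    simp only [star_cons, Multiset.card_add, Finset.sum_add_distrib, h1, Multiset.card_cons]
    have h4 : ∀ v, (if e.Inc v then ({e} : Multiset (Edge V)) else 0).card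
        = if e.Inc v then 1 else 0 := by intro v; split_ifs <;> simp
    simp only [h4, h3]
    omega

theorem sum_wdeg [Fintype V] {W : ℕ} {H : Multiset (Edge V)} (h : ∀ e ∈ H, e.Valid W) :
    ∑ v, wdeg H v = 2 * weight H := by
  induction H using Multiset.induction_on with
  | empty => simp
  | cons e H ih =>
    have h1 := ih fun f hf => h f (Multiset.mem_cons_of_mem hf)
    have h2 := sum_ite_inc (h e (Multiset.mem_cons_self e H)).1 fun _ => (e.wt : ℝ)
    have h3 : ∑ v, (if e.Inc v then e.wt else 0) = 2 * e.wt := by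
      have : ((∑ v, (if e.Inc v then e.wt else 0) : ℕ) : ℝ) = 2 * e.wt := by
        push_cast; rw [h2]; ring
      exact_mod_cast this
    simp only [wdeg_cons, Finset.sum_add_distrib, h1, weight_cons, h3]
    omega

theorem card_star_le_wdeg {W : ℕ} {H : Multiset (Edge V)} (h : ∀ e ∈ H, e.Valid W) (v : V) :
    (star H v).card ≤ wdeg H v :=
  card_le_weight (W := W) fun e he => h e (Multiset.mem_of_mem_filter he)

/-- A set of edges whose degrees are at most `C` times the capacities contains a `b`-matching with
at least a fraction `1 / (2 C + 1)` of its edges. -/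
theorem exists_isBMatching_card_le [Fintype V] {W : ℕ} {b : V → ℕ} {H : Multiset (Edge V)}
    (h : ∀ e ∈ H, e.Valid W) (C : ℕ) (hC : ∀ v, (star H v).card ≤ C * b v) :
    ∃ T ≤ H, IsBMatching b T ∧ H.card ≤ (2 * C + 1) * T.card := by
  obtain ⟨T, hT, hmax⟩ := Finset.exists_max_image
    (H.powerset.toFinset.filter (fun N => IsBMatching b N)) Multiset.card
    ⟨0, Finset.mem_filter.2 ⟨by simp, fun v => by simp [star]⟩⟩
  simp only [Finset.mem_filter, Multiset.mem_toFinset, Multiset.mem_powerset] at hT hmax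
  refine ⟨T, hT.1, hT.2, ?_⟩
  obtain ⟨D, rfl⟩ := Multiset.le_iff_exists_add.1 hT.1
  -- By maximality of `T`, every edge left out has a saturated end. So the edges left out number at
  -- most the sum of their degrees over saturated vertices, where `C * b v` is `C` times the degree
  -- in `T`.
  have hsat : ∀ e ∈ D, ∃ v, e.Inc v ∧ b v = (star T v).card := by
    intro e he
    by_contra! hcon
    have : IsBMatching b (e ::ₘ T) := by
      intro v
      rw [star_cons, Multiset.card_add]
      by_cases hv : e.Inc v
      · have h1 := hT.2 v
        have h2 := hcon v hv
        simp only [hv, if_true, Multiset.card_singleton]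
        omega
      · simpa [hv] using hT.2 v
    have h2 := hmax (e ::ₘ T) ⟨by
      rw [← Multiset.singleton_add, add_comm]
      exact add_le_add_right (Multiset.singleton_le.2 he) T, this⟩
    simp at h2
  have hD : D.card ≤ ∑ v, (if b v = (star T v).card then (star D v).card else 0) := by
    have h1 : ∀ D' : Multiset (Edge V), (∀ e ∈ D', ∃ v, e.Inc v ∧ b v = (star T v).card) →
        D'.card ≤ ∑ v, (if b v = (star T v).card then (star D' v).card else 0) := by
      intro D'
      induction D' using Multiset.induction_on with
      | empty => simp
      | cons e D' ih =>
        intro hh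
        obtain ⟨v, hv, hbv⟩ := hh e (Multiset.mem_cons_self e D')
        have := ih fun f hf => hh f (Multiset.mem_cons_of_mem hf)
        have h3 : ∑ v, (if b v = (star T v).card then (star D' v).card else 0) <
            ∑ v, (if b v = (star T v).card then (star (e ::ₘ D') v).card else 0) := by
          apply Finset.sum_lt_sum
          · intro u _
            rw [star_cons]
            split_ifs <;> simp
          · refine ⟨v, Finset.mem_univ v, ?_⟩
            rw [if_pos hbv, if_pos hbv, star_cons, if_pos hv]
            simp
        rw [Multiset.card_cons]
        omega
    exact h1 D hsat
  have h2 : ∑ v, (if b v = (star T v).card then (star D v).card else 0) ≤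
      ∑ v, C * (star T v).card := by
    apply Finset.sum_le_sum
    intro v _
    split_ifs with hv
    · have := hC v
      rw [star_add, Multiset.card_add, hv] at this
      omega
    · simp
  rw [← Finset.mul_sum,
    sum_card_star fun e he => h e (Multiset.mem_add.2 (Or.inl he))] at h2
  rw [Multiset.card_add]
  nlinarith

theorem mem_between {H : Multiset (Edge V)} {u v : V} {e : Edge V} :
    e ∈ between H u v ↔ e ∈ H ∧ e.Inc u ∧ e.Inc v := by
  simp [between]

theorem between_mono {H K : Multiset (Edge V)} (h : H ≤ K) (u v : V) :
    between H u v ≤ between K u v :=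
  Multiset.filter_le_filter _ h

theorem between_cons (e : Edge V) (H : Multiset (Edge V)) (u v : V) :
    between (e ::ₘ H) u v = (if e.Inc u ∧ e.Inc v then {e} else 0) + between H u v := by
  simp only [between, Multiset.filter_cons]

theorem between_le_star_left (H : Multiset (Edge V)) (u v : V) : between H u v ≤ star H u :=
  Multiset.monotone_filter_right _ fun _ h => h.1

theorem between_le_star_right (H : Multiset (Edge V)) (u v : V) : between H u v ≤ star H v :=
  Multiset.monotone_filter_right _ fun _ h => h.2

theorem Edge.inc_src (e : Edge V) : e.Inc e.src := Or.inl rfl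

theorem Edge.inc_dst (e : Edge V) : e.Inc e.dst := Or.inr rfl

/-- Two edges with the same ends have the same incidences. -/
theorem Edge.inc_iff_of_parallel {e f : Edge V} (he : e.src ≠ e.dst) (h1 : f.Inc e.src)
    (h2 : f.Inc e.dst) (v : V) : f.Inc v ↔ e.Inc v := by
  unfold Edge.Inc at *
  rcases h1 with h1 | h1 <;> rcases h2 with h2 | h2
  · exact absurd (h1.symm.trans h2) he
  · rw [h1, h2]
  · rw [h1, h2]; exact or_comm
  · exact absurd (h1.symm.trans h2) he

/-- Irrelevant edges of a `b`-matching can be exchanged for edges at least as heavy. -/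
theorem exists_replacement {W : ℕ} {b : V → ℕ} {R : Multiset (Edge V)}
    (M₂ : Multiset (Edge V)) : ∀ (M₁ N : Multiset (Edge V)), (∀ e ∈ M₂, e.Valid W) →
    N ≤ R → N ≤ M₁ → IsBMatching b (M₁ + M₂) → (∀ e ∈ M₂, Irrelevant b R e) →
    ∃ M₃, N + M₃ ≤ R ∧ IsBMatching b (M₁ + M₃) ∧ weight M₂ ≤ weight M₃ := by
  induction M₂ using Multiset.induction_on with
  | empty => intro M₁ N _ hN _ hM _; exact ⟨0, by simpa using hN, hM, le_rfl⟩
  -- `N` is the part of `R` already in use and `M₁` the part of the `b`-matching that stays. Each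
  -- exchange adds one edge to both.
  | cons e M₂ ih =>
    intro M₁ N hv hNR hNM hM hirr
    obtain ⟨hfull, hmin⟩ := hirr e (Multiset.mem_cons_self e M₂)
    have hne := (hv e (Multiset.mem_cons_self e M₂)).1
    -- `N` together with `e` lies in a `b`-matching, so `N` leaves at least one of the `min (b u) (b
    -- v)` parallel edges of `R` unused.
    have hlt : (between N e.src e.dst).card < (between R e.src e.dst).card := by
      rw [hfull]
      have h1 : ∀ v, e.Inc v → (between N e.src e.dst ≤ star N v) →
          (between N e.src e.dst).card + 1 ≤ b v := by
        intro v hev hb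
        refine le_trans ?_ (hM v)
        have h1 := Multiset.card_le_card hb
        have h2 := Multiset.card_le_card (star_le_of_le hNM v)
        simp only [star_add, star_cons, hev, if_true, Multiset.card_add, Multiset.card_singleton]
        omega
      have h2 := h1 _ e.inc_src (between_le_star_left _ _ _)
      have h3 := h1 _ e.inc_dst (between_le_star_right _ _ _)
      omega
    obtain ⟨f, hf⟩ : ∃ f, (between N e.src e.dst).count f < (between R e.src e.dst).count f := by
      by_contra! hcon
      exact absurd (Multiset.card_le_card (Multiset.le_iff_count.2 hcon)) (by omega)
    have hfR : f ∈ between R e.src e.dst := Multiset.count_pos.1 (by omega)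
    have hfb := (mem_between.1 hfR).2
    have hcnt : N.count f < R.count f := by
      simpa [between, Multiset.count_filter, hfb] using hf
    have hpar := Edge.inc_iff_of_parallel hne hfb.1 hfb.2
    have hstar : ∀ (K : Multiset (Edge V)) v, (star (f ::ₘ K) v).card = (star (e ::ₘ K) v).card := by
      intro K v
      simp only [star_cons, hpar v]
      split_ifs <;> simp
    obtain ⟨M₃, h1, h2, h3⟩ := ih (f ::ₘ M₁) (f ::ₘ N)
      (fun g hg => hv g (Multiset.mem_cons_of_mem hg)) (by
        rw [Multiset.le_iff_count]
        intro g
        rw [Multiset.count_cons]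
        split_ifs with hg
        · subst hg; omega
        · exact Multiset.le_iff_count.1 hNR g)
      (Multiset.cons_le_cons f hNM) (by
        intro v
        rw [Multiset.cons_add, hstar, ← Multiset.add_cons]
        exact hM v)
      (fun g hg => hirr g (Multiset.mem_cons_of_mem hg))
    refine ⟨f ::ₘ M₃, ?_, ?_, ?_⟩
    · rwa [Multiset.add_cons, ← Multiset.cons_add]
    · rwa [Multiset.add_cons, ← Multiset.cons_add]
    · have := hmin f hfR
      simp only [weight_cons]
      omega

end

section

/-! ### Egerváry's theorem -/

/-- **Egerváry's theorem**: weighted bipartite matching duality, for a square matrix. -/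
theorem exists_perm_dual {K : Type*} [Fintype K] (w : K → K → ℕ) :
    ∃ (σ : Equiv.Perm K) (x y : K → ℕ), (∀ k l, w k l ≤ x k + y l) ∧
      ∑ k, x k + ∑ l, y l = ∑ k, w k (σ k) := by
  rcases isEmpty_or_nonempty K with hK | hK
  · exact ⟨Equiv.refl K, fun _ => 0, fun _ => 0, fun k => isEmptyElim k, by simp⟩
  let feas : (K → ℤ) × (K → ℤ) → Prop := fun p => ∀ k l, (w k l : ℤ) ≤ p.1 k + p.2 l
  let val : (K → ℤ) × (K → ℤ) → ℤ := fun p => ∑ k, p.1 k + ∑ l, p.2 l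
  have hnn : ∀ p, feas p → 0 ≤ val p := by
    intro p hp
    have : val p = ∑ k, (p.1 k + p.2 k) := by simp [val, Finset.sum_add_distrib]
    rw [this]
    exact Finset.sum_nonneg fun k _ => le_trans (by positivity) (hp k k)
  have hex : ∃ n : ℕ, ∃ p, feas p ∧ val p = n := by
    let p : (K → ℤ) × (K → ℤ) := (fun k => ∑ l, (w k l : ℤ), fun _ => 0)
    have hp : feas p := by
      intro k l
      simp only [p, add_zero]
      exact Finset.single_le_sum (f := fun l => (w k l : ℤ)) (fun _ _ => by positivity)
        (Finset.mem_univ l)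
    exact ⟨(val p).toNat, p, hp, by rw [Int.toNat_of_nonneg (hnn p hp)]⟩
  -- An integral feasible pair of least value. Its entries may be negative; only the value is known
  -- to be nonnegative.
  obtain ⟨p, hp, hval⟩ := Nat.find_spec hex
  have hmin : ∀ q, feas q → val p ≤ val q := by
    intro q hq
    rw [hval, ← Int.toNat_of_nonneg (hnn q hq)]
    exact_mod_cast Nat.find_min' hex ⟨q, hq, by rw [Int.toNat_of_nonneg (hnn q hq)]⟩
  let t : K → Finset K := fun k => Finset.univ.filter fun l => (w k l : ℤ) = p.1 k + p.2 l
  have hall : ∀ s : Finset K, s.card ≤ (s.biUnion t).card := by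
    intro s
    -- Lowering the rows in `s` and raising the columns tight with them by 1 keeps feasibility, by
    -- integrality. Minimality of `p` then gives Hall's condition for the tight entries.
    let q : (K → ℤ) × (K → ℤ) := (fun k => p.1 k - if k ∈ s then 1 else 0,
      fun l => p.2 l + if l ∈ s.biUnion t then 1 else 0)
    have hq : feas q := by
      intro k l
      have h1 := hp k l
      simp only [q]
      by_cases hk : k ∈ s
      · by_cases hl : l ∈ s.biUnion t
        · rw [if_pos hk, if_pos hl]; linarith
        · have : (w k l : ℤ) ≠ p.1 k + p.2 l := by
            intro heq
            exact hl (Finset.mem_biUnion.2 ⟨k, hk, by simp [t, heq]⟩)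
          rw [if_pos hk, if_neg hl]
          omega
      · rw [if_neg hk]
        split_ifs <;> linarith
    have h1 := hmin q hq
    simp only [val, q, Finset.sum_sub_distrib, Finset.sum_add_distrib] at h1
    have h2 : ∀ u : Finset K, ∑ k, (if k ∈ u then (1 : ℤ) else 0) = u.card := by simp
    rw [h2, h2] at h1
    have : (s.card : ℤ) ≤ (s.biUnion t).card := by linarith
    exact_mod_cast this
  obtain ⟨f, hf, hft⟩ := (Finset.all_card_le_biUnion_card_iff_exists_injective t).1 hall
  let σ : Equiv.Perm K := Equiv.ofBijective f (Finite.injective_iff_bijective.1 hf)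
  have hσ : ∀ k, (w k (σ k) : ℤ) = p.1 k + p.2 (σ k) := by
    intro k
    have := hft k
    exact (Finset.mem_filter.1 this).2
  -- Shifting by the least row variable makes all variables nonnegative: `p.2 l + p.1 k₀ ≥ w k₀ l ≥
  -- 0`.
  obtain ⟨k₀, -, hk₀⟩ := Finset.exists_min_image Finset.univ p.1 Finset.univ_nonempty
  have hx : ∀ k, 0 ≤ p.1 k - p.1 k₀ := fun k => sub_nonneg.2 (hk₀ k (Finset.mem_univ k))
  have hy : ∀ l, 0 ≤ p.2 l + p.1 k₀ := fun l => by
    have := hp k₀ l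
    have h2 : (0 : ℤ) ≤ w k₀ l := by positivity
    linarith
  refine ⟨σ, fun k => (p.1 k - p.1 k₀).toNat, fun l => (p.2 l + p.1 k₀).toNat, ?_, ?_⟩
  · intro k l
    have := hp k l
    have h1 := hx k
    have h2 := hy l
    zify
    rw [Int.toNat_of_nonneg h1, Int.toNat_of_nonneg h2]
    linarith
  · have : ((∑ k, (p.1 k - p.1 k₀).toNat + ∑ l, (p.2 l + p.1 k₀).toNat : ℕ) : ℤ) =
        ((∑ k, w k (σ k) : ℕ) : ℤ) := by
      push_cast
      rw [Finset.sum_congr rfl fun k _ => hσ k, Finset.sum_add_distrib, Equiv.sum_comp σ p.2]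
      rw [Finset.sum_congr rfl fun k _ => Int.toNat_of_nonneg (hx k),
        Finset.sum_congr rfl fun k _ => Int.toNat_of_nonneg (hy k)]
      simp [Finset.sum_sub_distrib, Finset.sum_add_distrib]
    exact_mod_cast this

end

section

/-! ### The charging argument -/

/-- With `s = τ - y`, the right side is at least `s * W / (W - s)`, which is convex in `s`; the left
side is its tangent at `s = 1/2`. The point `1/2` is half of the smallest possible deficit, which
the two ends of an uncovered edge share. -/
theorem tangent_le {W y τ : ℝ} (hW : 1 ≤ W) (hy : 0 ≤ y) (hyτ : y ≤ τ) (hτ : τ < W) :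
    W / (2 * W - 1) + (2 * W / (2 * W - 1)) ^ 2 * (τ - y - 1 / 2) ≤
      τ * ((W - y) / (W - τ)) := by
  have h1 : 0 < 2 * W - 1 := by linarith
  have h2 : 0 < W - τ := by linarith
  have h3 : 0 < W - (τ - y) := by linarith
  have hs : (τ - y) * (W / (W - (τ - y))) ≤ τ * ((W - y) / (W - τ)) := by
    rw [← mul_div_assoc, ← mul_div_assoc, div_le_div_iff₀ h3 h2]
    have h4 : τ * (W - y) * (W - (τ - y)) - (τ - y) * W * (W - τ) =
        y * (τ * (τ - y) + W * (W - τ)) := by ring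
    have h5 : 0 ≤ y * (τ * (τ - y) + W * (W - τ)) :=
      mul_nonneg hy (add_nonneg (mul_nonneg (by linarith) (by linarith))
        (mul_nonneg (by linarith) h2.le))
    linarith
  refine le_trans ?_ hs
  set s := τ - y with hsdef
  -- Convexity made explicit: the distance to the tangent is a square over a positive denominator.
  have : s * (W / (W - s)) - (W / (2 * W - 1) + (2 * W / (2 * W - 1)) ^ 2 * (s - 1 / 2)) =
      W ^ 2 * (2 * s - 1) ^ 2 / ((2 * W - 1) ^ 2 * (W - s)) := by
    obtain ⟨u, hu⟩ : ∃ u, u = 2 * W - 1 := ⟨_, rfl⟩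
    have hWu : W = (u + 1) / 2 := by linarith
    rw [← hu] at h1 ⊢
    have h1' := h1.ne'
    have h3' := h3.ne'
    field_simp
    rw [hWu]
    ring
  have h4 : 0 ≤ W ^ 2 * (2 * s - 1) ^ 2 / ((2 * W - 1) ^ 2 * (W - s)) := by positivity
  linarith

section

variable {K I J : Type*} [Fintype I]

/-- The sum at `k` of the coefficients of the edges with an end at `k`. -/
def cdeg (a d : I → K) (c : I → ℝ) (k : K) : ℝ :=
  ∑ i, c i * ((if a i = k then 1 else 0) + (if d i = k then 1 else 0))

/-- The amount that `k` receives from its neighbours. -/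
def received (a d : I → K) (c : I → ℝ) (z : K → ℝ) (k : K) : ℝ :=
  ∑ i, c i * ((if a i = k then z (d i) else 0) + (if d i = k then z (a i) else 0))

/-- Double counting: along edge `i` each end passes `c i` times its own `z` to the other end, so `k`
hands out `cdeg a d c k * z k`. -/
theorem sum_received [Fintype K] (a d : I → K) (c : I → ℝ) (z : K → ℝ) :
    ∑ k, received a d c z k = ∑ k, cdeg a d c k * z k := by
  unfold received cdeg
  simp only [Finset.sum_mul]
  rw [Finset.sum_comm, Finset.sum_comm (s := Finset.univ (α := K))]
  refine Finset.sum_congr rfl fun i _ => ?_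
  simp only [mul_assoc, ← Finset.mul_sum, add_mul, ite_mul, one_mul, zero_mul,
    Finset.sum_add_distrib]
  simp [add_comm]

/-- A neighbour `l` of `k` along an edge of weight `w` has `y l ≥ w - y k` and `t l ≤ w - t k`.
Hence, for `y k < τ`, the ratio `y l / t l` is at least `(w - y k) / (w - τ)`, which is at least `(W
- y k) / (W - τ)`. Summing over the edges at `k` and using `tangent_le` gives the bound. When `τ ≤ y
k` the left side is nonpositive. -/
theorem received_ge {W : ℕ} (hW : 1 ≤ W) {a d : I → K} {w : I → ℕ} {c : I → ℝ}
    (hc : ∀ i, 0 ≤ c i) (hw : ∀ i, w i ≤ W) {t : K → ℝ} (ht : ∀ k, 0 < t k) {y : K → ℕ}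
    (hy : ∀ i, 0 < c i → w i ≤ y (a i) + y (d i)) (htw : ∀ i, t (a i) + t (d i) ≤ w i) (k : K) :
    (W : ℝ) / (2 * W - 1) + (2 * W / (2 * W - 1)) ^ 2 *
      (min (t k) (cdeg a d c k) - y k - 1 / 2) ≤ received a d c (fun k => y k / t k) k := by
  have hW' : (1 : ℝ) ≤ W := by exact_mod_cast hW
  have h1 : 0 < 2 * (W : ℝ) - 1 := by linarith
  have hnn : 0 ≤ received a d c (fun k => y k / t k) k := by
    unfold received
    refine Finset.sum_nonneg fun i _ => mul_nonneg (hc i) ?_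
    have h2 := (ht (a i)).le
    have h3 := (ht (d i)).le
    split_ifs <;> positivity
  set τ := min (t k) (cdeg a d c k) with hτ
  rcases le_or_gt τ (y k) with hle | hgt
  · refine le_trans ?_ hnn
    have h2 : τ - y k - 1 / 2 ≤ -(1 / 2) := by linarith
    have h3 : (W : ℝ) / (2 * W - 1) ≤ (2 * W / (2 * W - 1)) ^ 2 * (1 / 2) := by
      rw [div_pow, div_mul_eq_mul_div, div_le_div_iff₀ h1 (by positivity)]
      have : 0 ≤ (W : ℝ) * (2 * W - 1) := by positivity
      nlinarith
    have h4 := mul_le_mul_of_nonneg_left h2 (sq_nonneg (2 * (W : ℝ) / (2 * W - 1)))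
    linarith
  have hterm : ∀ i, 0 < c i → (a i = k → t k < w i) ∧ (d i = k → t k < w i) := by
    intro i _
    have h2 := ht (a i)
    have h3 := ht (d i)
    have h4 := htw i
    constructor <;> intro h <;> subst h <;> linarith
  have hτW : τ < W := by
    have hpos : 0 < cdeg a d c k :=
      lt_of_le_of_lt (by positivity) (hgt.trans_le (min_le_right _ _))
    obtain ⟨i, -, hi⟩ := Finset.exists_lt_of_sum_lt
      (show ∑ i : I, (0 : ℝ) < ∑ i, c i * ((if a i = k then 1 else 0) + (if d i = k then 1 else 0))
        by simpa [cdeg] using hpos)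
    have hci : 0 < c i := lt_of_le_of_ne (hc i) (by rintro h; simp [← h] at hi)
    have hwi : (w i : ℝ) ≤ W := by exact_mod_cast hw i
    refine (min_le_left _ _).trans_lt (lt_of_lt_of_le ?_ hwi)
    by_cases h2 : a i = k
    · exact (hterm i hci).1 h2
    · by_cases h3 : d i = k
      · exact (hterm i hci).2 h3
      · simp [h2, h3] at hi
  refine (tangent_le hW' (Nat.cast_nonneg _) hgt.le hτW).trans ?_
  have hψ : 0 ≤ ((W : ℝ) - y k) / (W - τ) := div_nonneg (by linarith) (by linarith)
  refine (mul_le_mul_of_nonneg_right (min_le_right _ _) hψ).trans ?_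
  unfold cdeg received
  rw [Finset.sum_mul]
  refine Finset.sum_le_sum fun i _ => ?_
  rcases (hc i).eq_or_lt with h0 | h0
  · simp [← h0]
  have hwi : (w i : ℝ) ≤ W := by exact_mod_cast hw i
  have hyi : (w i : ℝ) ≤ y (a i) + y (d i) := by exact_mod_cast hy i h0
  have key : ∀ l, 0 < t l → t k < w i → t l ≤ w i - t k → (w i : ℝ) - y k ≤ y l →
      ((W : ℝ) - y k) / (W - τ) ≤ y l / t l := by
    intro l h2 h3 h4 h5
    have hτt : τ ≤ t k := min_le_left _ _
    have h6 : ((W : ℝ) - y k) / (W - τ) ≤ (w i - y k) / (w i - τ) := by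
      rw [div_le_div_iff₀ (by linarith) (by linarith)]
      nlinarith
    refine h6.trans ?_
    rw [div_le_div_iff₀ (by linarith) h2]
    have h7 : 0 ≤ (w i : ℝ) - y k := by linarith
    calc ((w i : ℝ) - y k) * t l ≤ (w i - y k) * (w i - τ) := by
          apply mul_le_mul_of_nonneg_left _ h7; linarith
      _ ≤ y l * (w i - τ) := by apply mul_le_mul_of_nonneg_right h5; linarith
  rw [mul_assoc]
  refine mul_le_mul_of_nonneg_left ?_ (hc i)
  have h4 := htw i
  rw [add_mul]
  refine add_le_add ?_ ?_
  · by_cases h : a i = k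
    · simp only [h, if_true, one_mul]
      rw [h] at h4 hyi
      exact key _ (ht _) ((hterm i h0).1 h) (by linarith) (by linarith)
    · simp [h]
  · by_cases h : d i = k
    · simp only [h, if_true, one_mul]
      rw [h] at h4 hyi
      exact key _ (ht _) ((hterm i h0).2 h) (by linarith) (by linarith)
    · simp [h]

theorem sum_ends_le [Fintype K] [Fintype J] {p q : J → K} (hp : Function.Injective p) (hq : Function.Injective q)
    (hpq : ∀ i j, p i ≠ q j) {f : K → ℝ} (hf : ∀ k, 0 ≤ f k) :
    ∑ j, (f (p j) + f (q j)) ≤ ∑ k, f k := by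
  have h1 : ∑ j, f (p j) = ∑ k ∈ Finset.univ.map ⟨p, hp⟩, f k := by simp
  have h2 : ∑ j, f (q j) = ∑ k ∈ Finset.univ.map ⟨q, hq⟩, f k := by simp
  rw [Finset.sum_add_distrib, h1, h2, ← Finset.sum_union]
  · exact Finset.sum_le_sum_of_subset_of_nonneg (Finset.subset_univ _) fun k _ _ => hf k
  · rw [Finset.disjoint_left]
    intro k hk hk'
    simp only [Finset.mem_map, Finset.mem_univ, true_and, Function.Embedding.coeFn_mk] at hk hk'
    obtain ⟨i, rfl⟩ := hk
    obtain ⟨j, hj⟩ := hk'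
    exact hpq i j hj.symm

/-- Weak duality for a matching some of whose edges violate the dual constraints `y`: the deficits
are charged to the vertices adjacent to their ends. -/
theorem sum_weight_le_of_dual [Fintype K] [Fintype J] {W : ℕ} (hW : 1 ≤ W) {a d : I → K} {w : I → ℕ} {c : I → ℝ}
    (hc : ∀ i, 0 ≤ c i) (hw : ∀ i, w i ≤ W) {t : K → ℝ} (ht : ∀ k, 0 < t k) {y : K → ℕ}
    (hy : ∀ i, 0 < c i → w i ≤ y (a i) + y (d i)) (htw : ∀ i, t (a i) + t (d i) ≤ w i)
    {p q : J → K} (hp : Function.Injective p) (hq : Function.Injective q)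
    (hpq : ∀ i j, p i ≠ q j) {v : J → ℕ} {N : J → Prop}
    (hN : ∀ j, N j → v j ≤ y (p j) + y (q j)) {η : ℝ} (hη : 0 ≤ η)
    (hO : ∀ j, ¬ N j → (1 - η) * v j ≤ t (p j) + t (q j)) :
    ∑ j, (v j : ℝ) ≤ ∑ k, (y k : ℝ) +
      (1 - 1 / (2 * W)) * ∑ k, cdeg a d c k * (y k / t k) +
      2 * ∑ j, (η * v j + (max 0 (t (p j) - cdeg a d c (p j)) +
        max 0 (t (q j) - cdeg a d c (q j)))) := by
  have hW' : (1 : ℝ) ≤ W := by exact_mod_cast hW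
  have h1 : 0 < 2 * (W : ℝ) - 1 := by linarith
  set C := received a d c (fun k => y k / t k) with hC
  have hCnn : ∀ k, 0 ≤ C k := by
    intro k
    refine Finset.sum_nonneg fun i _ => mul_nonneg (hc i) ?_
    have h2 := (ht (a i)).le
    have h3 := (ht (d i)).le
    split_ifs <;> positivity
  -- `κ ^ 2` is the slope of the tangent and `1 / κ = 1 - 1 / (2 W)` the charging rate. Up to
  -- errors, the ends of an edge of deficit `δ ≥ 1` receive `κ * (1 + κ * (δ - 1))`, and at that
  -- rate this pays `1 + κ * (δ - 1) ≥ δ`.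
  set κ : ℝ := 2 * W / (2 * W - 1) with hκ
  have hκinv : 1 - 1 / (2 * (W : ℝ)) = 1 / κ := by rw [hκ]; field_simp
  have hκ1 : 1 ≤ κ := by rw [hκ, le_div_iff₀ h1]; linarith
  have hκ2 : κ ≤ 2 := by rw [hκ, div_le_iff₀ h1]; linarith
  have hκpos : 0 < κ := by linarith
  set err : K → ℝ := fun k => max 0 (t k - cdeg a d c k) with herr
  have herr0 : ∀ k, 0 ≤ err k := fun k => le_max_left _ _
  have hlow : ∀ k, κ / 2 + κ ^ 2 * (t k - err k - y k - 1 / 2) ≤ C k := by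
    intro k
    have h2 := received_ge hW hc hw ht hy htw k
    have h3 : t k - err k = min (t k) (cdeg a d c k) := by
      simp only [herr]
      rcases le_total (t k) (cdeg a d c k) with h | h
      · rw [min_eq_left h, max_eq_left (by linarith)]; ring
      · rw [min_eq_right h, max_eq_right (by linarith)]; ring
    rw [h3]
    have h4 : κ / 2 = (W : ℝ) / (2 * W - 1) := by rw [hκ]; field_simp
    rw [h4]
    exact h2
  have hterm : ∀ j, (v j : ℝ) ≤ ((y (p j) : ℝ) + y (q j)) + (1 / κ) * (C (p j) + C (q j)) +
      2 * (η * v j + (err (p j) + err (q j))) := by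
    intro j
    have e1 := herr0 (p j)
    have e2 := herr0 (q j)
    have hrest : 0 ≤ (1 / κ) * (C (p j) + C (q j)) :=
      mul_nonneg (by positivity) (add_nonneg (hCnn _) (hCnn _))
    have hηv : 0 ≤ η * v j := by positivity
    by_cases hcov : v j ≤ y (p j) + y (q j)
    · have : (v j : ℝ) ≤ y (p j) + y (q j) := by exact_mod_cast hcov
      linarith
    have hNj : ¬ N j := fun h => hcov (hN j h)
    have h2 := hO j hNj
    -- Weights and dual variables are integers, so an uncovered edge has a deficit of at least 1.
    have h3 : (y (p j) : ℝ) + y (q j) + 1 ≤ v j := by exact_mod_cast not_le.1 hcov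
    set δ : ℝ := v j - y (p j) - y (q j) with hδ
    have h4 : κ * (κ * (δ - 1 - η * v j - err (p j) - err (q j)) + 1) ≤ C (p j) + C (q j) := by
      have h5 := hlow (p j)
      have h6 := hlow (q j)
      have h7 : κ ^ 2 * (δ - 1 - η * v j - err (p j) - err (q j)) ≤
          κ ^ 2 * ((t (p j) - err (p j) - y (p j) - 1 / 2) +
            (t (q j) - err (q j) - y (q j) - 1 / 2)) := by
        apply mul_le_mul_of_nonneg_left _ (sq_nonneg κ)
        rw [hδ]; linarith
      nlinarith
    have h5 : κ * (δ - 1 - η * v j - err (p j) - err (q j)) + 1 ≤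
        (1 / κ) * (C (p j) + C (q j)) := by
      rw [one_div, inv_mul_eq_div, le_div_iff₀ hκpos]
      linarith
    have h6 : 0 ≤ (κ - 1) * (δ - 1) := mul_nonneg (by linarith) (by rw [hδ]; linarith)
    have h7 : κ * (η * v j + (err (p j) + err (q j))) ≤ 2 * (η * v j + (err (p j) + err (q j))) :=
      mul_le_mul_of_nonneg_right hκ2 (by linarith)
    have h8 : (v j : ℝ) = δ + (y (p j) + y (q j)) := by rw [hδ]; ring
    nlinarith
  have h2 := Finset.sum_le_sum fun j (_ : j ∈ Finset.univ) => hterm j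
  rw [Finset.sum_add_distrib, Finset.sum_add_distrib, ← Finset.mul_sum, ← Finset.mul_sum] at h2
  have h3 := sum_ends_le hp hq hpq (f := fun k => (y k : ℝ)) fun k => by positivity
  have h4 := sum_ends_le hp hq hpq hCnn
  rw [sum_received] at h4
  rw [hκinv]
  have h5 := mul_le_mul_of_nonneg_left h4 (show 0 ≤ 1 / κ by positivity)
  linarith

end

end

section

/-! ### Second moments -/

section Pi

variable {I : Type*} [Fintype I] {A : I → Type*} [∀ i, Fintype (A i)]

theorem expect_pi_prod (f : ∀ i, A i → ℝ) :
    𝔼 c : ∀ i, A i, ∏ i, f i (c i) = ∏ i, 𝔼 x, f i x := by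
  simp only [Fintype.expect_eq_sum_div_card, Finset.prod_div_distrib]
  rw [Fintype.prod_sum, Fintype.card_pi]
  push_cast
  rfl

variable [∀ i, Nonempty (A i)]

theorem expect_pi_apply (g : ∀ i, A i → ℝ) (i : I) :
    𝔼 c : ∀ i, A i, g i (c i) = 𝔼 x, g i x := by
  have h := expect_pi_prod (fun j x => if j = i then g j x else 1)
  simp only [Finset.prod_ite_eq', Finset.mem_univ, if_true] at h
  rw [h, Finset.prod_eq_single i]
  · simp
  · intro j _ hj
    simp [hj]
  · simp

theorem expect_pi_mul (g : ∀ i, A i → ℝ) {i i' : I} (h : i ≠ i') :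
    𝔼 c : ∀ i, A i, g i (c i) * g i' (c i') = (𝔼 x, g i x) * 𝔼 x, g i' x := by
  have h1 := expect_pi_prod (fun j x => (if j = i then g j x else 1) * if j = i' then g j x else 1)
  simp only [Finset.prod_mul_distrib, Finset.prod_ite_eq', Finset.mem_univ, if_true] at h1
  rw [h1]
  have h2 : ∀ j, (𝔼 x, (if j = i then g j x else 1) * if j = i' then g j x else 1) =
      (if j = i then 𝔼 x, g j x else 1) * if j = i' then 𝔼 x, g j x else 1 := by
    intro j
    by_cases hj : j = i
    · have : j ≠ i' := fun h' => h (hj.symm.trans h')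
      simp [hj, h]
    · by_cases hj' : j = i'
      · simp [hj', h.symm]
      · simp [hj, hj']
  simp only [h2, Finset.prod_mul_distrib, Finset.prod_ite_eq', Finset.mem_univ, if_true]

/-- The second moment of a sum of independent random variables. -/
theorem expect_pi_sum_sub_sq_le (g : ∀ i, A i → ℝ) (μ : ℝ) :
    𝔼 c : ∀ i, A i, (∑ i, g i (c i) - μ) ^ 2 ≤
      ∑ i, 𝔼 x, g i x ^ 2 + (∑ i, 𝔼 x, g i x - μ) ^ 2 := by
  have h1 : ∀ c : ∀ i, A i, (∑ i, g i (c i) - μ) ^ 2 =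
      ∑ i, ∑ i', g i (c i) * g i' (c i') - 2 * μ * ∑ i, g i (c i) + μ ^ 2 := by
    intro c
    rw [sub_sq, sq (∑ i, g i (c i)), Finset.sum_mul_sum]
    ring
  simp only [h1, Finset.expect_add_distrib, Finset.expect_sub_distrib, ← Finset.mul_expect,
    Finset.expect_sum_comm, expect_pi_apply, Fintype.expect_const]
  have h2 : ∀ i i', 𝔼 c : ∀ i, A i, g i (c i) * g i' (c i') ≤
      (𝔼 x, g i x) * (𝔼 x, g i' x) + if i = i' then 𝔼 x, g i x ^ 2 else 0 := by
    intro i i'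
    by_cases h : i = i'
    · subst h
      rw [if_pos rfl]
      have h3 := expect_pi_apply (fun i x => g i x ^ 2) i
      simp only [sq] at h3 ⊢
      rw [h3]
      exact le_add_of_nonneg_left (mul_self_nonneg _)
    · rw [if_neg h, add_zero, expect_pi_mul g h]
  have h3 := Finset.sum_le_sum fun i (_ : i ∈ Finset.univ) =>
    Finset.sum_le_sum fun i' (_ : i' ∈ Finset.univ) => h2 i i'
  simp only [Finset.sum_add_distrib, Finset.sum_ite_eq, Finset.mem_univ, if_true,
    ← Finset.mul_sum, ← Finset.sum_mul] at h3
  nlinarith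

end Pi

/-- A Boolean as a sign. -/
def sgn (x : Bool) : ℝ := if x then 1 else -1

theorem sgn_sq (x : Bool) : sgn x ^ 2 = 1 := by cases x <;> simp [sgn]

theorem expect_sgn : 𝔼 x, sgn x = 0 := by
  rw [Fintype.expect_eq_sum_div_card]
  simp [sgn]

/-! ### Random sides, opposite at the two ends of each pair -/

section Sides

variable {K J : Type*}

/-- The first end of a pair whose second end is `k`, or `k` itself. -/
def root (p q : J → K) (k : K) : K := if h : ∃ j, q j = k then p h.choose else k

/-- The sign of `k` relative to `root p q k`. -/
def rsgn (q : J → K) (k : K) : ℝ := if ∃ j, q j = k then -1 else 1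

theorem root_snd {p q : J → K} (hq : Function.Injective q) (j : J) : root p q (q j) = p j := by
  have h : ∃ j', q j' = q j := ⟨j, rfl⟩
  rw [root, dif_pos h, hq h.choose_spec]

theorem root_fst {p q : J → K} (hpq : ∀ i j, p i ≠ q j) (j : J) : root p q (p j) = p j := by
  rw [root, dif_neg]
  rintro ⟨i, hi⟩
  exact hpq j i hi.symm

theorem rsgn_sq (q : J → K) (k : K) : rsgn q k ^ 2 = 1 := by
  unfold rsgn; split_ifs <;> norm_num

/-- Among the copies with a given root, at most one is a second end, since `p` is injective, and at
most one is not, since such a copy is its own root. -/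
theorem rsgn_mul_nonpos {p q : J → K} (hp : Function.Injective p)
    {k l : K} (hkl : k ≠ l) (h : root p q k = root p q l) : rsgn q k * rsgn q l ≤ 0 := by
  unfold root at h
  unfold rsgn
  by_cases hk : ∃ j, q j = k <;> by_cases hl : ∃ j, q j = l
  · rw [dif_pos hk, dif_pos hl] at h
    have h1 := hk.choose_spec
    have h2 := hl.choose_spec
    rw [hp h, h2] at h1
    exact absurd h1.symm hkl
  · simp [hk, hl]
  · simp [hk, hl]
  · rw [dif_neg hk, dif_neg hl] at h
    exact absurd h hkl

/-- The random side of `k`: the two ends of a pair are on different sides. -/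
def side (p q : J → K) (ξ : K → Bool) (k : K) : ℝ := rsgn q k * sgn (ξ (root p q k))

theorem side_sq (p q : J → K) (ξ : K → Bool) (k : K) : side p q ξ k ^ 2 = 1 := by
  rw [side, mul_pow, rsgn_sq, sgn_sq, one_mul]

theorem side_snd {p q : J → K} (hq : Function.Injective q) (hpq : ∀ i j, p i ≠ q j)
    (ξ : K → Bool) (j : J) : side p q ξ (q j) = -side p q ξ (p j) := by
  have h1 : rsgn q (q j) = -1 := if_pos ⟨j, rfl⟩
  have h2 : rsgn q (p j) = 1 := if_neg fun ⟨i, hi⟩ => hpq j i hi.symm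
  rw [side, side, root_snd hq, root_fst hpq, h1, h2]
  ring

/-- Grouped by root, the sum is a combination of independent signs, so the cross terms between
groups vanish on average. Inside a group they are nonpositive, because distinct members have
opposite relative signs and `α` is nonnegative. -/
theorem expect_sum_side_sq_le [Fintype K] {p q : J → K} (hp : Function.Injective p) {α : K → ℝ} (hα : ∀ k, 0 ≤ α k) :
    𝔼 ξ : K → Bool, (∑ k, α k * side p q ξ k) ^ 2 ≤ ∑ k, α k ^ 2 := by
  let C : K → ℝ := fun l => ∑ k, if root p q k = l then α k * rsgn q k else 0
  have h1 : ∀ ξ : K → Bool, ∑ k, α k * side p q ξ k = ∑ l, C l * sgn (ξ l) := by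
    intro ξ
    simp only [C, Finset.sum_mul]
    rw [Finset.sum_comm]
    refine Finset.sum_congr rfl fun k _ => ?_
    simp only [ite_mul, zero_mul, Finset.sum_ite_eq, Finset.mem_univ, if_true, side]
    ring
  have h2 := expect_pi_sum_sub_sq_le (fun (l : K) (x : Bool) => C l * sgn x) 0
  simp only [sub_zero, ← Finset.mul_expect, expect_sgn, mul_zero, Finset.sum_const_zero,
    mul_pow, sgn_sq, Fintype.expect_const, mul_one, zero_pow two_ne_zero, add_zero] at h2
  simp only [h1]
  refine h2.trans ?_
  have h3 : ∀ l, C l ^ 2 ≤ ∑ k, if root p q k = l then α k ^ 2 else 0 := by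
    intro l
    simp only [C]
    rw [sq, Finset.sum_mul_sum]
    refine Finset.sum_le_sum fun k _ => ?_
    by_cases hk : root p q k = l
    · rw [if_pos hk]
      rw [← Finset.add_sum_erase _ _ (Finset.mem_univ k)]
      simp only [hk, if_true]
      have h4 : (α k * rsgn q k) * (α k * rsgn q k) = α k ^ 2 := by
        linear_combination α k ^ 2 * rsgn_sq q k
      have h5 : ∑ k' ∈ Finset.univ.erase k,
          (α k * rsgn q k) * (if root p q k' = l then α k' * rsgn q k' else 0) ≤ 0 := by
        refine Finset.sum_nonpos fun k' hk' => ?_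
        split_ifs with h6
        · have h7 := rsgn_mul_nonpos hp (Finset.ne_of_mem_erase hk').symm (hk.trans h6.symm)
          have h8 := mul_nonneg (hα k) (hα k')
          nlinarith
        · simp
      linarith
    · simp [hk]
  refine (Finset.sum_le_sum fun l _ => h3 l).trans ?_
  rw [Finset.sum_comm]
  simp

end Sides

/-! ### Random copies for the ends of the edges -/

section Placement

variable {V I : Type*} [Fintype I] {b : V → ℕ}

/-- The copies of the vertices: `b v` copies of `v`. -/
structure Copies (b : V → ℕ) where
  vert : V
  idx : Fin (b vert)

/-- The copies as a sigma type. -/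
def Copies.equiv (b : V → ℕ) : (Σ v, Fin (b v)) ≃ Copies b where
  toFun k := ⟨k.1, k.2⟩
  invFun k := ⟨k.vert, k.idx⟩
  left_inv _ := rfl
  right_inv _ := rfl

instance [Fintype V] (b : V → ℕ) : Fintype (Copies b) := Fintype.ofEquiv _ (Copies.equiv b)

theorem sum_copies [Fintype V] (f : Copies b → ℝ) :
    ∑ k, f k = ∑ v, ∑ i : Fin (b v), f ⟨v, i⟩ := by
  rw [← Equiv.sum_comp (Copies.equiv b), Fintype.sum_sigma]
  rfl

/-- A choice of a copy of each end of each edge. -/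
abbrev Placement (b : V → ℕ) (u₀ u₁ : I → V) : Type _ := ∀ i, Fin (b (u₀ i)) × Fin (b (u₁ i))

/-- The copy of the first end of `i`. -/
def Placement.fst {u₀ u₁ : I → V} (c : Placement b u₀ u₁) (i : I) : Copies b := ⟨u₀ i, (c i).1⟩

/-- The copy of the second end of `i`. -/
def Placement.snd {u₀ u₁ : I → V} (c : Placement b u₀ u₁) (i : I) : Copies b := ⟨u₁ i, (c i).2⟩

theorem expect_ite_copy (v : V) (k : Copies b) :
    𝔼 x : Fin (b v), (if (⟨v, x⟩ : Copies b) = k then (1 : ℝ) else 0) =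
      if v = k.1 then 1 / (b k.1 : ℝ) else 0 := by
  obtain ⟨u, l⟩ := k
  by_cases h : v = u
  · subst h
    rw [if_pos rfl, Fintype.expect_eq_sum_div_card]
    simp [Copies.mk.injEq]
  · rw [if_neg h]
    refine Finset.expect_eq_zero fun x _ => ?_
    rw [if_neg]
    intro h'
    exact h (congrArg Copies.vert h')

theorem expect_prod_mul {X Y : Type*} [Fintype X] [Fintype Y] (f : X → ℝ) (g : Y → ℝ) :
    𝔼 x : X × Y, f x.1 * g x.2 = (𝔼 x, f x) * 𝔼 y, g y := by
  rw [Finset.expect_mul_expect, ← Finset.univ_product_univ, Finset.expect_product]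

/-- The expected weight of the edges that meet the copy `k` and cross. -/
theorem expect_place (hb : ∀ v, 1 ≤ b v) (s : Copies b → ℝ) (w : ℝ) (v v' : V)
    (k : Copies b) :
    𝔼 x : Fin (b v) × Fin (b v'), (w * ((1 - s ⟨v, x.1⟩ * s ⟨v', x.2⟩) / 2) *
      ((if (⟨v, x.1⟩ : Copies b) = k then 1 else 0) +
        if (⟨v', x.2⟩ : Copies b) = k then 1 else 0)) =
    w / (2 * b k.1) * (((if v = k.1 then 1 else 0) + if v' = k.1 then 1 else 0) -
      s k * ((if v = k.1 then 𝔼 x, s ⟨v', x⟩ else 0) + if v' = k.1 then 𝔼 x, s ⟨v, x⟩ else 0)) := by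
  have : Nonempty (Fin (b v)) := ⟨⟨0, hb v⟩⟩
  have : Nonempty (Fin (b v')) := ⟨⟨0, hb v'⟩⟩
  have h1 : ∀ x : Fin (b v) × Fin (b v'), (w * ((1 - s ⟨v, x.1⟩ * s ⟨v', x.2⟩) / 2) *
      ((if (⟨v, x.1⟩ : Copies b) = k then 1 else 0) +
        if (⟨v', x.2⟩ : Copies b) = k then 1 else 0)) =
      w / 2 * ((if (⟨v, x.1⟩ : Copies b) = k then 1 else 0) * 1 +
        1 * (if (⟨v', x.2⟩ : Copies b) = k then 1 else 0) -
        s k * ((if (⟨v, x.1⟩ : Copies b) = k then 1 else 0) * s ⟨v', x.2⟩ +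
          s ⟨v, x.1⟩ * (if (⟨v', x.2⟩ : Copies b) = k then 1 else 0))) := by
    intro x
    by_cases h2 : (⟨v, x.1⟩ : Copies b) = k <;> by_cases h3 : (⟨v', x.2⟩ : Copies b) = k <;>
      simp [h2, h3] <;> ring
  simp only [h1]
  rw [← Finset.mul_expect, Finset.expect_sub_distrib, ← Finset.mul_expect _ _ (s k),
    Finset.expect_add_distrib, Finset.expect_add_distrib,
    expect_prod_mul (fun x => if (⟨v, x⟩ : Copies b) = k then (1 : ℝ) else 0) fun _ => 1,
    expect_prod_mul (fun x => if (⟨v, x⟩ : Copies b) = k then (1 : ℝ) else 0) fun y => s ⟨v', y⟩,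
    expect_prod_mul (fun _ => (1 : ℝ)) fun y => if (⟨v', y⟩ : Copies b) = k then (1 : ℝ) else 0,
    expect_prod_mul (fun x => s ⟨v, x⟩) fun y => if (⟨v', y⟩ : Copies b) = k then (1 : ℝ) else 0,
    expect_ite_copy, expect_ite_copy, Fintype.expect_const, Fintype.expect_const]
  by_cases h2 : v = k.1 <;> by_cases h3 : v' = k.1 <;> simp [h2, h3] <;> ring

/-- As `v ≠ v'`, the two ends are never both at `k`, so the sum of the two indicators equals its
square. Each indicator has mean `1 / b` or 0. -/
theorem expect_place_sq_le (hb : ∀ v, 1 ≤ b v) {s : Copies b → ℝ} (hs : ∀ k, s k ^ 2 = 1)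
    (w : ℝ) {v v' : V} (hv : v ≠ v') (k : Copies b) :
    𝔼 x : Fin (b v) × Fin (b v'), (w * ((1 - s ⟨v, x.1⟩ * s ⟨v', x.2⟩) / 2) *
      ((if (⟨v, x.1⟩ : Copies b) = k then 1 else 0) +
        if (⟨v', x.2⟩ : Copies b) = k then 1 else 0)) ^ 2 ≤
    w ^ 2 / b k.1 * ((if v = k.1 then 1 else 0) + if v' = k.1 then 1 else 0) := by
  have : Nonempty (Fin (b v)) := ⟨⟨0, hb v⟩⟩
  have : Nonempty (Fin (b v')) := ⟨⟨0, hb v'⟩⟩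
  have h1 : ∀ x : Fin (b v) × Fin (b v'), (w * ((1 - s ⟨v, x.1⟩ * s ⟨v', x.2⟩) / 2) *
      ((if (⟨v, x.1⟩ : Copies b) = k then 1 else 0) +
        if (⟨v', x.2⟩ : Copies b) = k then 1 else 0)) ^ 2 ≤
      w ^ 2 * ((if (⟨v, x.1⟩ : Copies b) = k then 1 else 0) * 1 +
        1 * (if (⟨v', x.2⟩ : Copies b) = k then 1 else 0)) := by
    intro x
    have h2 : ((1 - s ⟨v, x.1⟩ * s ⟨v', x.2⟩) / 2) ^ 2 ≤ 1 := by
      have h3 := hs ⟨v, x.1⟩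
      have h4 := hs ⟨v', x.2⟩
      nlinarith [sq_nonneg (s ⟨v, x.1⟩ + s ⟨v', x.2⟩)]
    have h3 : ((if (⟨v, x.1⟩ : Copies b) = k then (1 : ℝ) else 0) +
        if (⟨v', x.2⟩ : Copies b) = k then 1 else 0) ^ 2 =
        (if (⟨v, x.1⟩ : Copies b) = k then 1 else 0) * 1 +
        1 * (if (⟨v', x.2⟩ : Copies b) = k then 1 else 0) := by
      by_cases h4 : (⟨v, x.1⟩ : Copies b) = k <;> by_cases h5 : (⟨v', x.2⟩ : Copies b) = k
      · exact absurd (congrArg Copies.vert (h4.trans h5.symm)) hv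
      all_goals simp [h4, h5]
    rw [mul_pow, mul_pow, h3]
    refine mul_le_mul_of_nonneg_right ?_ (by positivity)
    nlinarith [sq_nonneg w]
  refine (Finset.expect_le_expect fun x _ => h1 x).trans (le_of_eq ?_)
  rw [← Finset.mul_expect, Finset.expect_add_distrib,
    expect_prod_mul (fun x => if (⟨v, x⟩ : Copies b) = k then (1 : ℝ) else 0) fun _ => 1,
    expect_prod_mul (fun _ => (1 : ℝ)) fun y => if (⟨v', y⟩ : Copies b) = k then (1 : ℝ) else 0,
    expect_ite_copy, expect_ite_copy, Fintype.expect_const, Fintype.expect_const]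
  by_cases h2 : v = k.1 <;> by_cases h3 : v' = k.1 <;> simp [h2, h3] <;> ring

/-- The total weight of the edges with an end at `u`. -/
def ideg (u₀ u₁ : I → V) (w : I → ℕ) (u : V) : ℝ :=
  ∑ i, (w i : ℝ) * ((if u₀ i = u then 1 else 0) + if u₁ i = u then 1 else 0)

/-- The total weight of the edges linking `u` and `x`. -/
def ibetween (u₀ u₁ : I → V) (w : I → ℕ) (u x : V) : ℝ :=
  ∑ i, (w i : ℝ) * ((if u₀ i = u ∧ u₁ i = x then 1 else 0) + if u₁ i = u ∧ u₀ i = x then 1 else 0)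

theorem sum_ibetween [Fintype V] (u₀ u₁ : I → V) (w : I → ℕ) (u : V) :
    ∑ x, ibetween u₀ u₁ w u x = ideg u₀ u₁ w u := by
  unfold ibetween ideg
  rw [Finset.sum_comm]
  refine Finset.sum_congr rfl fun i _ => ?_
  rw [← Finset.mul_sum, Finset.sum_add_distrib]
  simp [ite_and]

theorem ideg_nonneg (u₀ u₁ : I → V) (w : I → ℕ) (u : V) : 0 ≤ ideg u₀ u₁ w u :=
  Finset.sum_nonneg fun i _ => mul_nonneg (Nat.cast_nonneg _) (by positivity)

theorem ibetween_nonneg (u₀ u₁ : I → V) (w : I → ℕ) (u x : V) : 0 ≤ ibetween u₀ u₁ w u x :=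
  Finset.sum_nonneg fun i _ => mul_nonneg (Nat.cast_nonneg _) (by positivity)

/-- The crossing weight at the copy `k`, for the sides `s` and the placement `c`. -/
def crossDeg {u₀ u₁ : I → V} (w : I → ℕ) (s : Copies b → ℝ) (c : Placement b u₀ u₁)
    (k : Copies b) : ℝ :=
  cdeg c.fst c.snd (fun i => (w i : ℝ) * ((1 - s (c.fst i) * s (c.snd i)) / 2)) k

/-- For fixed sides the edges are placed independently, so the second moment is at most a variance
term plus a squared bias. The bias measures how unevenly the neighbours of `k` are spread over the
two sides. -/
theorem expect_crossDeg_le (hb : ∀ v, 1 ≤ b v) {u₀ u₁ : I → V} (hu : ∀ i, u₀ i ≠ u₁ i)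
    {W : ℕ} {w : I → ℕ} (hw : ∀ i, w i ≤ W) {s : Copies b → ℝ} (hs : ∀ k, s k ^ 2 = 1)
    [Fintype V] (k : Copies b) :
    𝔼 c : Placement b u₀ u₁, (crossDeg w s c k - ideg u₀ u₁ w k.1 / b k.1 / 2) ^ 2 ≤
      W * (ideg u₀ u₁ w k.1 / b k.1) +
        (1 / (2 * b k.1)) ^ 2 * (∑ l, ibetween u₀ u₁ w k.1 l.1 / b l.1 * s l) ^ 2 := by
  have hne : ∀ i, Nonempty (Fin (b (u₀ i)) × Fin (b (u₁ i))) := fun i =>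
    ⟨⟨0, hb _⟩, ⟨0, hb _⟩⟩
  have h1 := expect_pi_sum_sub_sq_le (I := I) (A := fun i => Fin (b (u₀ i)) × Fin (b (u₁ i)))
    (fun i x => (w i : ℝ) * ((1 - s ⟨u₀ i, x.1⟩ * s ⟨u₁ i, x.2⟩) / 2) *
      ((if (⟨u₀ i, x.1⟩ : Copies b) = k then 1 else 0) +
        if (⟨u₁ i, x.2⟩ : Copies b) = k then 1 else 0)) (ideg u₀ u₁ w k.1 / b k.1 / 2)
  refine h1.trans (add_le_add ?_ (le_of_eq ?_))
  · refine (Finset.sum_le_sum fun i _ => expect_place_sq_le hb hs _ (hu i) k).trans ?_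
    rw [ideg, Finset.sum_div, Finset.mul_sum]
    refine Finset.sum_le_sum fun i _ => ?_
    have h2 : (w i : ℝ) ≤ W := by exact_mod_cast hw i
    have h3 : (0 : ℝ) ≤ (w i : ℝ) / b k.1 *
      ((if u₀ i = k.1 then 1 else 0) + if u₁ i = k.1 then 1 else 0) := by positivity
    calc _ = (w i : ℝ) * ((w i : ℝ) / b k.1 *
          ((if u₀ i = k.1 then 1 else 0) + if u₁ i = k.1 then 1 else 0)) := by ring
      _ ≤ W * ((w i : ℝ) / b k.1 *
          ((if u₀ i = k.1 then 1 else 0) + if u₁ i = k.1 then 1 else 0)) :=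
        mul_le_mul_of_nonneg_right h2 h3
      _ = _ := by ring
  · simp only [expect_place hb]
    have h2 : ∑ l : Copies b, ibetween u₀ u₁ w k.1 l.1 / b l.1 * s l =
        ∑ i, (w i : ℝ) * ((if u₀ i = k.1 then 𝔼 x, s ⟨u₁ i, x⟩ else 0) +
          if u₁ i = k.1 then 𝔼 x, s ⟨u₀ i, x⟩ else 0) := by
      rw [sum_copies]
      have h3 : ∀ x, ∑ j : Fin (b x), ibetween u₀ u₁ w k.1 x / b x * s ⟨x, j⟩ =
          ibetween u₀ u₁ w k.1 x * 𝔼 j, s ⟨x, j⟩ := by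
        intro x
        rw [← Finset.mul_sum, Fintype.expect_eq_sum_div_card, Fintype.card_fin]
        ring
      simp only [h3]
      simp only [ibetween, Finset.sum_mul]
      rw [Finset.sum_comm]
      refine Finset.sum_congr rfl fun i _ => ?_
      simp only [mul_assoc]
      rw [← Finset.mul_sum]
      simp only [add_mul, Finset.sum_add_distrib, ite_and, ite_mul, one_mul, zero_mul]
      congr 2
      · split_ifs <;> simp
      · split_ifs <;> simp
    rw [h2, ideg, Finset.sum_div, Finset.sum_div, ← Finset.sum_sub_distrib]
    have h4 : ∀ i, (w i : ℝ) / (2 * b k.1) * (((if u₀ i = k.1 then 1 else 0) +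
        if u₁ i = k.1 then 1 else 0) - s k * ((if u₀ i = k.1 then 𝔼 x, s ⟨u₁ i, x⟩ else 0) +
          if u₁ i = k.1 then 𝔼 x, s ⟨u₀ i, x⟩ else 0)) -
        (w i : ℝ) * ((if u₀ i = k.1 then 1 else 0) + if u₁ i = k.1 then 1 else 0) / b k.1 / 2 =
        -(s k * (1 / (2 * b k.1))) * ((w i : ℝ) *
          ((if u₀ i = k.1 then 𝔼 x, s ⟨u₁ i, x⟩ else 0) +
            if u₁ i = k.1 then 𝔼 x, s ⟨u₀ i, x⟩ else 0)) := by
      intro i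
      ring
    simp only [h4]
    rw [← Finset.mul_sum]
    rw [mul_pow, neg_sq, mul_pow, hs, one_mul]

/-- Averaging over the sides turns the squared bias into a sum of squares of `ibetween / b`. The
bound `hbet` on parallel edges makes each of these ratios at most `W`, so the bias is no larger in
order than the variance. -/
theorem expect_expect_crossDeg_le (hb : ∀ v, 1 ≤ b v) {u₀ u₁ : I → V} (hu : ∀ i, u₀ i ≠ u₁ i)
    {W : ℕ} {w : I → ℕ} (hw : ∀ i, w i ≤ W)
    [Fintype V] (hbet : ∀ u x, ibetween u₀ u₁ w u x ≤ W * b x)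
    {J : Type*} {p q : J → Copies b} (hp : Function.Injective p) (k : Copies b) :
    𝔼 ξ : Copies b → Bool, 𝔼 c : Placement b u₀ u₁,
      (crossDeg w (side p q ξ) c k - ideg u₀ u₁ w k.1 / b k.1 / 2) ^ 2 ≤
      2 * W * (ideg u₀ u₁ w k.1 / b k.1) := by
  refine (Finset.expect_le_expect fun ξ _ =>
    expect_crossDeg_le hb hu hw (side_sq p q ξ) k).trans ?_
  rw [Finset.expect_add_distrib, Fintype.expect_const, ← Finset.mul_expect]
  have h1 := expect_sum_side_sq_le (q := q) hp
    (α := fun l => ibetween u₀ u₁ w k.1 l.1 / b l.1)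
    fun l => div_nonneg (ibetween_nonneg _ _ _ _ _) (Nat.cast_nonneg _)
  have h2 : ∑ l : Copies b, (ibetween u₀ u₁ w k.1 l.1 / b l.1) ^ 2 ≤ W * ideg u₀ u₁ w k.1 := by
    rw [sum_copies, ← sum_ibetween, Finset.mul_sum]
    refine Finset.sum_le_sum fun x _ => ?_
    have hbx : (0 : ℝ) < b x := by exact_mod_cast hb x
    simp only [Finset.sum_const, Finset.card_univ, Fintype.card_fin, nsmul_eq_mul]
    have : (b x : ℝ) * (ibetween u₀ u₁ w k.1 x / b x) ^ 2 =
        (ibetween u₀ u₁ w k.1 x / b x) * ibetween u₀ u₁ w k.1 x := by field_simp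
    rw [this]
    refine mul_le_mul_of_nonneg_right ?_ (ibetween_nonneg _ _ _ _ _)
    rw [div_le_iff₀ hbx]
    exact hbet _ _
  have hbk : (1 : ℝ) ≤ b k.1 := by exact_mod_cast hb k.1
  have h3 := mul_le_mul_of_nonneg_left (h1.trans h2) (sq_nonneg (1 / (2 * (b k.1 : ℝ))))
  have h4 : (1 / (2 * (b k.1 : ℝ))) ^ 2 * (W * ideg u₀ u₁ w k.1) ≤
      W * (ideg u₀ u₁ w k.1 / b k.1) := by
    have h5 : (1 / (2 * (b k.1 : ℝ))) ^ 2 ≤ 1 / b k.1 := by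
      rw [div_pow, div_le_div_iff₀ (by positivity) (by positivity)]
      nlinarith
    have h6 : (0 : ℝ) ≤ W * ideg u₀ u₁ w k.1 := mul_nonneg (Nat.cast_nonneg _) (ideg_nonneg _ _ _ _)
    calc _ ≤ 1 / (b k.1 : ℝ) * (W * ideg u₀ u₁ w k.1) := mul_le_mul_of_nonneg_right h5 h6
      _ = _ := by ring
  linarith

end Placement

end

section

/-! ### Heavy `b`-matchings from a degree constrained subgraph -/

/-- Weighted bipartite duality for a graph with the colour classes `L` and its complement. -/
theorem exists_matching_dual {K E : Type*} [Fintype K] [Fintype E] (L : K → Prop) (a d : E → K)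
    (w : E → ℕ) {W : ℕ} (hw : ∀ e, w e ≤ W) (cr : E → Prop)
    (hcr : ∀ e, cr e → (L (a e) ↔ ¬ L (d e))) :
    ∃ (T : Finset E) (y : K → ℕ), (∀ k, y k ≤ W) ∧ (∀ e, cr e → w e ≤ y (a e) + y (d e)) ∧
      (∀ e ∈ T, ∀ e' ∈ T, e ≠ e' → a e ≠ a e' ∧ d e ≠ d e' ∧ a e ≠ d e') ∧
      ∑ k, y k ≤ ∑ e ∈ T, w e := by
  rcases isEmpty_or_nonempty E with hE | hE
  · exact ⟨∅, fun _ => 0, fun _ => Nat.zero_le _, fun e => isEmptyElim e, by simp, by simp⟩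
  -- Egerváry's theorem needs a full square matrix: the entry is the weight of a heaviest crossing
  -- edge from a row end in `L` to a column end outside `L`, and 0 if there is none.
  let joins : K → K → Finset E := fun k l => Finset.univ.filter fun e =>
    cr e ∧ L k ∧ ¬ L l ∧ (a e = k ∧ d e = l ∨ a e = l ∧ d e = k)
  obtain ⟨σ, x, y, hxy, hsum⟩ := exists_perm_dual fun k l => (joins k l).sup w
  -- Each vertex needs only its row or its column variable. As no weight exceeds `W`, capping at `W`
  -- keeps the edges covered.
  let y' : K → ℕ := fun k => min W (if L k then x k else y k)
  have hch : ∀ k, ∃ e, (joins k (σ k)).Nonempty →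
      e ∈ joins k (σ k) ∧ w e = (joins k (σ k)).sup w := by
    intro k
    by_cases h : (joins k (σ k)).Nonempty
    · obtain ⟨e, he, hs⟩ := Finset.exists_mem_eq_sup _ h w
      exact ⟨e, fun _ => ⟨he, hs.symm⟩⟩
    · exact ⟨Classical.arbitrary E, fun h' => absurd h' h⟩
  choose f hf using hch
  let S : Finset K := Finset.univ.filter fun k => (joins k (σ k)).Nonempty
  have hS : ∀ k ∈ S, L k ∧ ¬ L (σ k) ∧
      (a (f k) = k ∧ d (f k) = σ k ∨ a (f k) = σ k ∧ d (f k) = k) := by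
    intro k hk
    exact (Finset.mem_filter.1 (hf k (Finset.mem_filter.1 hk).2).1).2.2
  have hinj : ∀ k ∈ S, ∀ k' ∈ S, f k = f k' → k = k' := by
    intro k hk k' hk' h
    obtain ⟨h1, h2, h3⟩ := hS k hk
    obtain ⟨h4, h5, h6⟩ := hS k' hk'
    rw [h] at h3
    rcases h3 with ⟨h7, h8⟩ | ⟨h7, h8⟩ <;> rcases h6 with ⟨h9, h10⟩ | ⟨h9, h10⟩
    · exact h7.symm.trans h9
    · rw [← h7, h9] at h1; exact absurd h1 h5
    · rw [← h8, h10] at h1; exact absurd h1 h5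
    · exact h8.symm.trans h10
  refine ⟨S.image f, y', fun k => min_le_left _ _, ?_, ?_, ?_⟩
  · intro e he
    have h1 := hcr e he
    have key : ∀ k l, e ∈ joins k l → w e ≤ y' k + y' l := by
      intro k l hel
      have h2 := (Finset.le_sup (f := w) hel).trans (hxy k l)
      have h3 := (Finset.mem_filter.1 hel).2
      have h4 := hw e
      simp only [y', h3.2.1, h3.2.2.1, if_true, if_false]
      omega
    by_cases hL : L (a e)
    · exact key _ _ (by simp [joins, he, hL, h1.1 hL])
    · rw [add_comm]
      have h2 : L (d e) := by by_contra h; exact hL (h1.2 h)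
      exact key _ _ (by simp [joins, he, hL, h2])
  · intro e he e' he' hne
    obtain ⟨k, hk, rfl⟩ := Finset.mem_image.1 he
    obtain ⟨k', hk', rfl⟩ := Finset.mem_image.1 he'
    have hkk : k ≠ k' := fun h => hne (by rw [h])
    have hσ : σ k ≠ σ k' := fun h => hkk (σ.injective h)
    obtain ⟨h1, h2, h3⟩ := hS k hk
    obtain ⟨h4, h5, h6⟩ := hS k' hk'
    have h7 : k ≠ σ k' := fun h => h5 (h ▸ h1)
    have h8 : σ k ≠ k' := fun h => h2 (h.symm ▸ h4)
    rcases h3 with ⟨h9, h10⟩ | ⟨h9, h10⟩ <;> rcases h6 with ⟨h11, h12⟩ | ⟨h11, h12⟩ <;>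
      rw [h9, h10, h11, h12] <;> exact ⟨by assumption, by assumption, by assumption⟩
  · rw [Finset.sum_image hinj]
    calc ∑ k, y' k ≤ ∑ k, (x k + y k) := by
          refine Finset.sum_le_sum fun k _ => (min_le_right _ _).trans ?_
          split_ifs <;> omega
      _ = ∑ k, (joins k (σ k)).sup w := by rw [Finset.sum_add_distrib, hsum]
      _ = ∑ k ∈ S, (joins k (σ k)).sup w := by
          rw [Finset.sum_filter]
          refine Finset.sum_congr rfl fun k _ => ?_
          split_ifs with h
          · rfl
          · rw [Finset.not_nonempty_iff_eq_empty.1 h]; simp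
      _ ≤ ∑ k ∈ S, w (f k) := by
          refine Finset.sum_le_sum fun k hk => ?_
          exact (hf k (Finset.mem_filter.1 hk).2).2.ge

theorem star_map_val {V E : Type*} (T : Finset E) (g : E → Edge V) (v : V) :
    (star (T.val.map g) v).card = (T.filter fun e => (g e).Inc v).card := by
  rw [star, Multiset.filter_map, Multiset.card_map]
  rfl

/-- A set of edges whose ends are at pairwise distinct copies is a `b`-matching. -/
theorem isBMatching_of_copies {V E : Type*} {b : V → ℕ} (g : E → Edge V)
    (a d : E → Copies b) (ha : ∀ e, (a e).vert = (g e).src) (hd : ∀ e, (d e).vert = (g e).dst)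
    (T : Finset E)
    (hT : ∀ e ∈ T, ∀ e' ∈ T, e ≠ e' → a e ≠ a e' ∧ d e ≠ d e' ∧ a e ≠ d e') :
    IsBMatching b (T.val.map g) := by
  intro v
  rw [star_map_val]
  let φ : E → Copies b := fun e => if (g e).src = v then a e else d e
  have hφ : ∀ e ∈ T.filter fun e => (g e).Inc v,
      φ e ∈ (Finset.univ : Finset (Fin (b v))).image fun i => (⟨v, i⟩ : Copies b) := by
    intro e he
    have h1 := (Finset.mem_filter.1 he).2
    have h2 : (φ e).vert = v := by
      simp only [φ]
      split_ifs with h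
      · rw [ha, h]
      · rw [hd]; exact h1.resolve_left h
    refine Finset.mem_image.2 ⟨h2 ▸ (φ e).idx, Finset.mem_univ _, ?_⟩
    generalize φ e = k at h2
    subst h2
    rfl
  refine (Finset.card_le_card_of_injOn φ hφ ?_).trans
    (Finset.card_image_le.trans (by simp))
  intro e he e' he' h
  by_contra hne
  have h1 := (Finset.mem_filter.1 he).1
  have h2 := (Finset.mem_filter.1 he').1
  obtain ⟨h3, h4, h5⟩ := hT e h1 e' h2 hne
  have h6 := (hT e' h2 e h1 (Ne.symm hne)).2.2
  simp only [φ] at h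
  split_ifs at h
  · exact h3 h
  · exact h5 h
  · exact h6 h.symm
  · exact h4 h

theorem weight_map_val {V E : Type*} (T : Finset E) (g : E → Edge V) :
    weight (T.val.map g) = ∑ e ∈ T, (g e).wt := by
  rw [weight, Multiset.map_map]
  rfl

/-- Some outcome of the random sides and copies has total error at most the mean; for it, bipartite
duality and the charging argument apply. Here `h` lists the edges of the load-bounded graph, `g`
those of the given `b`-matching, and `N` marks the ones that may be used. The slack `ρ` serves to
replace linear fluctuations by second moments. -/
theorem exists_heavy_isBMatching_of_copies {V : Type*} [Fintype V] {b : V → ℕ} (hb : ∀ v, 1 ≤ b v)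
    {W : ℕ} (hW : 1 ≤ W) {I J : Type*} [Fintype I] [Fintype J] (h : I → Edge V) (g : J → Edge V)
    (hh : ∀ i, (h i).Valid W) (hg : ∀ j, (g j).Valid W) {p q : J → Copies b}
    (hp : Function.Injective p) (hq : Function.Injective q) (hpq : ∀ i j, p i ≠ q j)
    (hpv : ∀ j, (p j).vert = (g j).src) (hqv : ∀ j, (q j).vert = (g j).dst) (N : J → Prop)
    (δ : V → ℝ)
    (hδ : ∀ u, δ u = ideg (fun i => (h i).src) (fun i => (h i).dst) (fun i => (h i).wt) u / b u)
    {β ρ η : ℝ} (hβ : 0 ≤ β) (hρ : 0 < ρ) (hη : 0 ≤ η)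
    (hA : ∀ i, δ (h i).src + δ (h i).dst ≤ β * (h i).wt)
    (hO : ∀ j, ¬ N j → (1 - η) * (g j).wt * (β + 2 * ρ) ≤ δ (g j).src + δ (g j).dst + 2 * ρ)
    (hbet : ∀ u x, ibetween (fun i => (h i).src) (fun i => (h i).dst) (fun i => (h i).wt) u x
      ≤ W * b x) :
    ∃ T : Finset (I ⊕ {j // N j}),
      IsBMatching b (T.val.map (Sum.elim h fun j => g j.1)) ∧
      (∑ j, ((g j).wt : ℝ)) ≤ (2 - 1 / (2 * W)) *
        (weight (T.val.map (Sum.elim h fun j => g j.1)) : ℝ) +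
        (W / ρ ^ 2 * ∑ k : Copies b, 2 * W * δ k.vert) + 2 * η * ∑ j, ((g j).wt : ℝ) +
        2 / (ρ * (β + 2 * ρ)) *
          ∑ j, (4 * ρ ^ 2 + (2 * W * δ (g j).src + 2 * W * δ (g j).dst)) := by
  set u₀ : I → V := fun i => (h i).src with hu₀
  set u₁ : I → V := fun i => (h i).dst with hu₁
  set w : I → ℕ := fun i => (h i).wt with hw
  set B : ℝ := β + 2 * ρ with hB
  have hBpos : 0 < B := by linarith
  have hW' : (1 : ℝ) ≤ W := by exact_mod_cast hW
  have hδ0 : ∀ u, 0 ≤ δ u := fun u => by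
    rw [hδ]; exact div_nonneg (ideg_nonneg _ _ _ _) (Nat.cast_nonneg _)
  have hnonempty : Nonempty (Placement b u₀ u₁) := ⟨fun i => ⟨⟨0, hb _⟩, ⟨0, hb _⟩⟩⟩
  have hmoment : ∀ k : Copies b, 𝔼 ξ : Copies b → Bool, 𝔼 c : Placement b u₀ u₁,
      (crossDeg w (side p q ξ) c k - δ k.vert / 2) ^ 2 ≤ 2 * W * δ k.vert := by
    intro k
    simp only [hδ]
    exact expect_expect_crossDeg_le hb (fun i => (hh i).1) (fun i => (hh i).2.2) hbet hp k
  obtain ⟨ξ, -, hξ⟩ := Finset.exists_le_of_expect_le (s := Finset.univ)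
    (f := fun ξ : Copies b → Bool => 𝔼 c : Placement b u₀ u₁,
      (W / ρ ^ 2 * ∑ k : Copies b, (crossDeg w (side p q ξ) c k - δ k.vert / 2) ^ 2 +
        2 / (ρ * B) * ∑ j, (4 * ρ ^ 2 +
          ((crossDeg w (side p q ξ) c (p j) - δ (p j).vert / 2) ^ 2 +
            (crossDeg w (side p q ξ) c (q j) - δ (q j).vert / 2) ^ 2))))
    (a := W / ρ ^ 2 * ∑ k : Copies b, 2 * W * δ k.vert + 2 / (ρ * B) *
      ∑ j, (4 * ρ ^ 2 + (2 * W * δ (p j).vert + 2 * W * δ (q j).vert)))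
    Finset.univ_nonempty (by
      simp only [Finset.expect_add_distrib, ← Finset.mul_expect, Finset.expect_sum_comm,
        Fintype.expect_const]
      have h1 : (0 : ℝ) ≤ W / ρ ^ 2 := by positivity
      have h2 : (0 : ℝ) ≤ 2 / (ρ * B) := by positivity
      refine add_le_add (mul_le_mul_of_nonneg_left (Finset.sum_le_sum fun k _ => hmoment k) h1)
        (mul_le_mul_of_nonneg_left (Finset.sum_le_sum fun j _ => ?_) h2)
      exact add_le_add le_rfl (add_le_add (hmoment _) (hmoment _)))
  obtain ⟨c, -, hc⟩ := Finset.exists_le_of_expect_le Finset.univ_nonempty hξ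
  set s := side p q ξ with hs
  have hs2 : ∀ k, s k = 1 ∨ s k = -1 := fun k => by
    have := side_sq p q ξ k
    exact sq_eq_one_iff.1 this
  let a' : I ⊕ {j // N j} → Copies b := Sum.elim c.fst fun j => p j.1
  let d' : I ⊕ {j // N j} → Copies b := Sum.elim c.snd fun j => q j.1
  have hvalid : ∀ e : I ⊕ {j // N j}, ((Sum.elim h fun j => g j.1) e).Valid W := by
    rintro (i | j)
    · exact hh i
    · exact hg j.1
  obtain ⟨T, y, hyW, hy, hT, hsum⟩ := exists_matching_dual (fun k => s k = 1) a' d'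
    (fun e => ((Sum.elim h fun j => g j.1) e : Edge V).wt) (fun e => (hvalid e).2.2)
    (fun e => s (a' e) ≠ s (d' e)) (by
      intro e he
      rcases hs2 (a' e) with h1 | h1 <;> rcases hs2 (d' e) with h2 | h2 <;>
        simp only [h1, h2] at he ⊢ <;> norm_num at *)
  refine ⟨T, isBMatching_of_copies _ a' d' ?_ ?_ T hT, ?_⟩
  · rintro (i | j)
    · rfl
    · exact hpv j.1
  · rintro (i | j)
    · rfl
    · exact hqv j.1
  set Δ : Copies b → ℝ := fun k => crossDeg w s c k - δ k.vert / 2 with hΔ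
  -- The slack `ρ` makes `t` positive, and the `2 * ρ` in `B` pays for it at both ends: `t (a i) + t
  -- (d i) ≤ w i`, because `1 ≤ w i`.
  set t : Copies b → ℝ := fun k => (δ k.vert + ρ) / B with ht
  -- About half of the weight at a copy crosses, so crossing edges count double: `cdeg` becomes `(δ
  -- + 2 * Δ) / B`, to be compared with `t`.
  set cc : I → ℝ := fun i => 2 / B * ((w i : ℝ) * ((1 - s (c.fst i) * s (c.snd i)) / 2)) with hcc
  have hcdeg : ∀ k, cdeg c.fst c.snd cc k = 2 / B * crossDeg w s c k := by
    intro k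
    simp only [crossDeg, cdeg, hcc, Finset.mul_sum, mul_assoc]
  have hχ : ∀ i, (s (c.fst i) = s (c.snd i) ∧ (1 - s (c.fst i) * s (c.snd i)) / 2 = 0) ∨
      (s (c.fst i) ≠ s (c.snd i) ∧ (1 - s (c.fst i) * s (c.snd i)) / 2 = 1) := by
    intro i
    rcases hs2 (c.fst i) with h1 | h1 <;> rcases hs2 (c.snd i) with h2 | h2 <;>
      rw [h1, h2] <;> norm_num
  have hcharge := sum_weight_le_of_dual hW (a := c.fst) (d := c.snd) (w := w) (c := cc)
    (t := t) (y := y) (p := p) (q := q) (v := fun j => (g j).wt) (N := N) (η := η)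
    (fun i => by
      have : (0 : ℝ) ≤ (1 - s (c.fst i) * s (c.snd i)) / 2 := by
        rcases hχ i with h1 | h1 <;> rw [h1.2]; norm_num
      simp only [hcc]; positivity)
    (fun i => (hh i).2.2)
    (fun k => div_pos (add_pos_of_nonneg_of_pos (hδ0 _) hρ) hBpos)
    (fun i hi => by
      refine hy (Sum.inl i) ?_
      rcases hχ i with h1 | h1
      · simp [hcc, h1.2] at hi
      · exact h1.1)
    (fun i => by
      have h1 := hA i
      have h2 : (1 : ℝ) ≤ w i := by exact_mod_cast (hh i).2.1
      simp only [ht]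
      rw [← add_div, div_le_iff₀ hBpos]
      have h3 : δ (c.fst i).vert = δ (h i).src := rfl
      have h4 : δ (c.snd i).vert = δ (h i).dst := rfl
      rw [h3, h4, hB]
      nlinarith)
    hp hq hpq
    (fun j hj => by
      refine hy (Sum.inr ⟨j, hj⟩) ?_
      show s (p j) ≠ s (q j)
      rw [hs, side_snd hq hpq, ← hs]
      rcases hs2 (p j) with h1 | h1 <;> rw [h1] <;> norm_num)
    hη
    (fun j hj => by
      have h1 := hO j hj
      simp only [ht]
      rw [← add_div, le_div_iff₀ hBpos, hpv, hqv]
      linarith)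
  -- A copy hands out too much only if `2 * Δ > ρ`, and `(2 * Δ - ρ) * ρ ≤ Δ ^ 2` leaves a purely
  -- quadratic error.
  have hover : ∀ k, cdeg c.fst c.snd cc k * (y k / t k) ≤ y k + W / ρ ^ 2 * Δ k ^ 2 := by
    intro k
    have h1 := hδ0 k.vert
    have h2 : (y k : ℝ) ≤ W := by exact_mod_cast hyW k
    have h3 : cdeg c.fst c.snd cc k * (y k / t k) =
        y k + y k * ((2 * Δ k - ρ) / (δ k.vert + ρ)) := by
      rw [hcdeg]
      simp only [ht, hΔ]
      field_simp
      ring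
    have h4 : (2 * Δ k - ρ) / (δ k.vert + ρ) ≤ Δ k ^ 2 / ρ ^ 2 := by
      rw [div_le_div_iff₀ (by positivity) (by positivity)]
      have h5 : (2 * Δ k - ρ) * ρ ≤ Δ k ^ 2 := by nlinarith [sq_nonneg (Δ k - ρ)]
      have h6 : 0 ≤ Δ k ^ 2 * δ k.vert := by positivity
      nlinarith
    have h7 : (y k : ℝ) * ((2 * Δ k - ρ) / (δ k.vert + ρ)) ≤ W * (Δ k ^ 2 / ρ ^ 2) :=
      (mul_le_mul_of_nonneg_left h4 (Nat.cast_nonneg _)).trans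
        (mul_le_mul_of_nonneg_right h2 (by positivity))
    rw [h3]
    have h8 : (W : ℝ) * (Δ k ^ 2 / ρ ^ 2) = W / ρ ^ 2 * Δ k ^ 2 := by ring
    linarith
  -- The shortfall is `(ρ - 2 * Δ) / B`; again `-2 * ρ * Δ ≤ ρ ^ 2 + Δ ^ 2` removes the linear term.
  have herr : ∀ k, max 0 (t k - cdeg c.fst c.snd cc k) ≤ 1 / (ρ * B) * (2 * ρ ^ 2 + Δ k ^ 2) := by
    intro k
    refine max_le (by positivity) ?_
    have h3 : t k - cdeg c.fst c.snd cc k = 1 / (ρ * B) * (ρ * (ρ - 2 * Δ k)) := by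
      rw [hcdeg]
      simp only [ht, hΔ]
      field_simp
      ring
    rw [h3]
    refine mul_le_mul_of_nonneg_left ?_ (by positivity)
    nlinarith [sq_nonneg (Δ k + ρ)]
  have hY : (∑ k, (y k : ℝ)) ≤ (weight (T.val.map (Sum.elim h fun j => g j.1)) : ℝ) := by
    rw [weight_map_val]
    exact_mod_cast hsum
  have h1 : ∑ k, cdeg c.fst c.snd cc k * (y k / t k) ≤
      ∑ k, (y k : ℝ) + W / ρ ^ 2 * ∑ k, Δ k ^ 2 := by
    rw [Finset.mul_sum, ← Finset.sum_add_distrib]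
    exact Finset.sum_le_sum fun k _ => hover k
  have h2 : 2 * ∑ j, (η * ((g j).wt : ℝ) + (max 0 (t (p j) - cdeg c.fst c.snd cc (p j)) +
      max 0 (t (q j) - cdeg c.fst c.snd cc (q j)))) ≤ 2 * η * ∑ j, ((g j).wt : ℝ) +
      2 / (ρ * B) * ∑ j, (4 * ρ ^ 2 + (Δ (p j) ^ 2 + Δ (q j) ^ 2)) := by
    rw [Finset.mul_sum, Finset.mul_sum, Finset.mul_sum, ← Finset.sum_add_distrib]
    refine Finset.sum_le_sum fun j _ => ?_
    have h3 := herr (p j)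
    have h4 := herr (q j)
    have h5 : 2 / (ρ * B) * (4 * ρ ^ 2 + (Δ (p j) ^ 2 + Δ (q j) ^ 2)) =
      2 * (1 / (ρ * B) * (2 * ρ ^ 2 + Δ (p j) ^ 2) + 1 / (ρ * B) * (2 * ρ ^ 2 + Δ (q j) ^ 2)) := by
      ring
    rw [h5]
    linarith
  simp only [hpv, hqv] at hc
  have h3 : (0 : ℝ) ≤ 1 - 1 / (2 * W) := by
    rw [sub_nonneg, div_le_one (by positivity)]; linarith
  have h4 : (1 - 1 / (2 * (W : ℝ))) ≤ 1 := by
    have : (0 : ℝ) ≤ 1 / (2 * W) := by positivity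
    linarith
  have h5 := mul_le_mul_of_nonneg_left h1 h3
  have h6 : (0 : ℝ) ≤ W / ρ ^ 2 * ∑ k, Δ k ^ 2 := by positivity
  have h7 := mul_le_mul_of_nonneg_right h4 h6
  have h8 := mul_le_mul_of_nonneg_left hY (show (0 : ℝ) ≤ 2 - 1 / (2 * W) by linarith)
  simp only [hΔ, hpv, hqv] at *
  linarith

end

/-! ### The duality bound for multisets of edges -/

section

variable {V : Type*} {b : V → ℕ}

theorem exists_eq_map_univ {α : Type*} (S : Multiset α) :
    ∃ (n : ℕ) (f : Fin n → α), S = Finset.univ.val.map f := by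
  induction S using Quotient.inductionOn with
  | h l => exact ⟨l.length, l.get, by rw [Fin.univ_val_map, List.ofFn_get]; rfl⟩

/-- The edges of a `b`-matching can be attached to distinct copies of their ends. -/
theorem exists_copies {J : Type*} [Fintype J] (g : J → Edge V) (hg : ∀ j, (g j).src ≠ (g j).dst)
    (h : IsBMatching b (Finset.univ.val.map g)) :
    ∃ p q : J → Copies b, Function.Injective p ∧ Function.Injective q ∧ (∀ i j, p i ≠ q j) ∧
      (∀ j, (p j).vert = (g j).src) ∧ ∀ j, (q j).vert = (g j).dst := by
  have hφ : ∀ v, Nonempty ({j // (g j).Inc v} ↪ Fin (b v)) := by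
    intro v
    refine Function.Embedding.nonempty_of_card_le ?_
    have h1 := h v
    rw [star_map_val] at h1
    simpa [Fintype.card_subtype] using h1
  let F : ∀ v, {j // (g j).Inc v} → Copies b := fun v j => ⟨v, (hφ v).some j⟩
  have hF : ∀ v v' j j', F v j = F v' j' → v = v' ∧ j.1 = j'.1 := by
    intro v v' j j' hjj
    have h1 : v = v' := congrArg Copies.vert hjj
    subst h1
    simp only [F, Copies.mk.injEq, heq_eq_eq, true_and] at hjj
    exact ⟨rfl, congrArg Subtype.val ((hφ v).some.injective hjj)⟩
  refine ⟨fun j => F _ ⟨j, (g j).inc_src⟩, fun j => F _ ⟨j, (g j).inc_dst⟩, ?_, ?_, ?_,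
    fun _ => rfl, fun _ => rfl⟩
  · intro i j hij
    exact (hF _ _ _ _ hij).2
  · intro i j hij
    exact (hF _ _ _ _ hij).2
  · intro i j hij
    obtain ⟨h1, h2⟩ := hF _ _ _ _ hij
    have h3 : i = j := h2
    subst h3
    exact hg i h1

theorem ideg_eq_wdeg {I : Type*} [Fintype I] (h : I → Edge V) (hh : ∀ i, (h i).src ≠ (h i).dst)
    (u : V) : ideg (fun i => (h i).src) (fun i => (h i).dst) (fun i => (h i).wt) u =
      wdeg (Finset.univ.val.map h) u := by
  rw [ideg, wdeg, star, weight, Multiset.filter_map, Multiset.map_map]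
  have : (Multiset.map (Edge.wt ∘ h)
      (Multiset.filter ((fun e => e.Inc u) ∘ h) Finset.univ.val)).sum =
      ∑ i ∈ Finset.univ.filter fun i => (h i).Inc u, (h i).wt := rfl
  rw [this, Finset.sum_filter]
  push_cast
  refine Finset.sum_congr rfl fun i _ => ?_
  have h1 := hh i
  unfold Edge.Inc
  by_cases h2 : (h i).src = u <;> by_cases h3 : (h i).dst = u
  · exact absurd (h2.trans h3.symm) h1
  all_goals simp [h2, h3]

theorem ibetween_le {W : ℕ} {I : Type*} [Fintype I] (h : I → Edge V)
    (hh : ∀ i, (h i).Valid W)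
    (hbet : ∀ u x, u ≠ x → (between (Finset.univ.val.map h) u x).card ≤ b x) (u x : V) :
    ibetween (fun i => (h i).src) (fun i => (h i).dst) (fun i => (h i).wt) u x ≤ W * b x := by
  by_cases hux : u = x
  · subst hux
    refine le_trans (Finset.sum_nonpos fun i _ => ?_) (by positivity)
    have h1 := (hh i).1
    rw [if_neg fun h2 => h1 (h2.1.trans h2.2.symm), if_neg fun h2 => h1 (h2.2.trans h2.1.symm)]
    simp
  · refine le_trans ?_ (b := ((W * (between (Finset.univ.val.map h) u x).card : ℕ) : ℝ)) (by
      exact_mod_cast Nat.mul_le_mul_left W (hbet u x hux))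
    rw [between, Multiset.filter_map, Multiset.card_map]
    have : Multiset.card (Multiset.filter ((fun e : Edge V => e.Inc u ∧ e.Inc x) ∘ h)
        Finset.univ.val) = ∑ i, if (h i).Inc u ∧ (h i).Inc x then 1 else 0 := by
      rw [← Finset.card_filter]; rfl
    rw [this, ibetween]
    push_cast
    rw [Finset.mul_sum]
    refine Finset.sum_le_sum fun i _ => ?_
    have h1 : ((h i).wt : ℝ) ≤ W := by exact_mod_cast (hh i).2.2
    refine mul_le_mul h1 ?_ (by positivity) (Nat.cast_nonneg _)
    have hxu : ¬ x = u := fun h => hux h.symm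
    unfold Edge.Inc
    by_cases h2 : (h i).src = u <;> by_cases h3 : (h i).dst = u <;>
      by_cases h4 : (h i).src = x <;> by_cases h5 : (h i).dst = x
    all_goals first
      | exact absurd (h2.trans h3.symm) (hh i).1
      | simp [h2, h3, h4, h5, hux, hxu]

/-- Any one edge of `H` at `v` has a load dominating `wdeg H v / b v`, and that load is at most `β *
W`. -/
theorem wdeg_le_of_load_le (hb : ∀ v, 1 ≤ b v) {W β : ℕ} {H : Multiset (Edge V)}
    (hv : ∀ e ∈ H, e.Valid W) (hA : ∀ e ∈ H, load b H e ≤ β * e.wt) (v : V) :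
    wdeg H v ≤ β * W * b v := by
  by_cases hs : star H v = 0
  · rw [wdeg, hs]; simp
  obtain ⟨e, he⟩ := Multiset.exists_mem_of_ne_zero hs
  obtain ⟨heH, hev⟩ := Multiset.mem_filter.1 he
  have hbv : (0 : ℝ) < b v := by exact_mod_cast hb v
  have h1 : (wdeg H v : ℝ) / b v ≤ load b H e := by
    unfold load
    rcases hev with h | h <;> subst h
    · exact le_add_of_nonneg_right (by positivity)
    · exact le_add_of_nonneg_left (by positivity)
  have h2 : (β : ℝ) * e.wt ≤ β * W :=
    mul_le_mul_of_nonneg_left (by exact_mod_cast (hv e heH).2.2) (Nat.cast_nonneg _)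
  have h3 := (h1.trans (hA e heH)).trans h2
  rw [div_le_iff₀ hbv] at h3
  exact_mod_cast h3

variable [Fintype V]

/-- A set of edges whose loads are bounded contains a `b`-matching with a constant fraction of its
edges. -/
theorem exists_isBMatching_of_load_le (hb : ∀ v, 1 ≤ b v) {W β : ℕ} {H : Multiset (Edge V)}
    (hv : ∀ e ∈ H, e.Valid W) (hA : ∀ e ∈ H, load b H e ≤ β * e.wt) :
    ∃ T ≤ H, IsBMatching b T ∧ H.card ≤ (2 * (β * W) + 1) * T.card :=
  exists_isBMatching_card_le hv (β * W) fun v =>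
    (card_star_le_wdeg hv v).trans (wdeg_le_of_load_le hb hv hA v)

/-- If `H` has bounded loads, then every `b`-matching composed of edges of `N` and of edges of large
load is not much heavier than some `b`-matching of `H + N`. -/
theorem exists_heavy_isBMatching (hb : ∀ v, 1 ≤ b v) {W : ℕ} (hW : 1 ≤ W)
    {H N O : Multiset (Edge V)} (hH : ∀ e ∈ H, e.Valid W) (hN : ∀ e ∈ N, e.Valid W)
    (hO : ∀ e ∈ O, e.Valid W) {β : ℕ} {l : ℝ} (hl : 0 < l) (hl1 : l ≤ 1)
    (hβ : 16 * (W : ℝ) ^ 4 ≤ l ^ 4 * β)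
    (hbet : ∀ u x, u ≠ x → (between H u x).card ≤ b x)
    (hA : ∀ e ∈ H, load b H e ≤ β * e.wt) (hB : ∀ e ∈ O, (1 - l) * β * e.wt ≤ load b H e)
    (hNO : IsBMatching b (N + O)) :
    ∃ T ≤ H + N, IsBMatching b T ∧
      (1 - 15 * l) * weight (N + O) ≤ (2 - 1 / (2 * W) + l) * weight T := by
  -- An optimal `T` dominates both the `b`-matching produced by duality and the one holding a
  -- constant fraction of `H`. The latter turns an error proportional to `weight H` into a multiple
  -- of `weight T`.
  obtain ⟨T, hTle, hTb, hTmax⟩ := exists_isMaxWeightBMatching b (H + N)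
  refine ⟨T, hTle, hTb, ?_⟩
  have hW' : (1 : ℝ) ≤ W := by exact_mod_cast hW
  have hβpos : (0 : ℝ) < β := by
    have h1 : 0 < l ^ 4 * (β : ℝ) := lt_of_lt_of_le (by positivity) hβ
    exact pos_of_mul_pos_right h1 (by positivity)
  have hHw : (weight H : ℝ) ≤ 3 * β * W ^ 2 * weight T := by
    obtain ⟨S, hS, hSb, hcard⟩ := exists_isBMatching_of_load_le hb hH hA
    have h1 := weight_le_mul_card hH
    have h2 := card_le_weight fun e he => hH e (Multiset.mem_of_le hS he)
    have h3 := hTmax S (hS.trans (Multiset.le_add_right H N)) hSb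
    have h4 : (2 * (β * W) + 1) ≤ 3 * (β * W) := by
      have h5 : 1 ≤ β := by exact_mod_cast hβpos
      nlinarith
    have h6 : weight H ≤ 3 * β * W ^ 2 * weight T := by
      calc weight H ≤ W * H.card := h1
        _ ≤ W * (3 * (β * W) * weight T) := by
          refine Nat.mul_le_mul_left W (hcard.trans (Nat.mul_le_mul h4 (h2.trans h3)))
        _ = 3 * β * W ^ 2 * weight T := by ring
    exact_mod_cast h6
  obtain ⟨nH, h, rfl⟩ := exists_eq_map_univ H
  obtain ⟨nN, gN, rfl⟩ := exists_eq_map_univ N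
  obtain ⟨nO, gO, rfl⟩ := exists_eq_map_univ O
  set H := Finset.univ.val.map h with hHdef
  have hh : ∀ i, (h i).Valid W := fun i => hH _ (Multiset.mem_map_of_mem _ (Finset.mem_univ i))
  let g : Fin nN ⊕ Fin nO → Edge V := Sum.elim gN gO
  have hg : ∀ j, (g j).Valid W := by
    rintro (j | j)
    · exact hN _ (Multiset.mem_map_of_mem _ (Finset.mem_univ j))
    · exact hO _ (Multiset.mem_map_of_mem _ (Finset.mem_univ j))
  have hmap : ∀ {X Y : Type} [Fintype X] [Fintype Y] (f : X ⊕ Y → Edge V),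
      Finset.univ.val.map f = Finset.univ.val.map (fun x => f (Sum.inl x)) +
        Finset.univ.val.map fun y => f (Sum.inr y) := by
    intro X Y _ _ f
    rw [← Finset.univ_disjSum_univ]
    simp [Finset.disjSum, Multiset.disjSum, Multiset.map_map]
  have hgmap : Finset.univ.val.map g = Finset.univ.val.map gN + Finset.univ.val.map gO := hmap g
  obtain ⟨p, q, hp, hq, hpq, hpv, hqv⟩ := exists_copies g (fun j => (hg j).1) (by
    rw [hgmap]; exact hNO)
  let δ : V → ℝ := fun u => (wdeg H u : ℝ) / b u
  have hδload : ∀ e : Edge V, load b H e = δ e.src + δ e.dst := fun _ => rfl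
  have hδ0 : ∀ u, 0 ≤ δ u := fun u => by positivity
  have hδle : ∀ u, δ u ≤ β * W := fun u => by
    have hbu : (0 : ℝ) < b u := by exact_mod_cast hb u
    rw [div_le_iff₀ hbu]
    exact_mod_cast wdeg_le_of_load_le hb hH hA u
  have hρ : 0 < l * β := by positivity
  obtain ⟨S, hSb, hS⟩ := exists_heavy_isBMatching_of_copies hb hW h g hh hg hp hq hpq hpv hqv
    (fun j => j.isLeft = true) δ (fun u => by rw [ideg_eq_wdeg h fun i => (hh i).1])
    -- `ρ` is small against `β`, while `ρ ^ 2` is large against the second moments, which are of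
    -- order `β * W ^ 2`. The value `η = 3 * l` compensates the factor `1 + 2 * l` in `β + 2 * ρ`:
    -- `(1 - 3 * l) * (1 + 2 * l) ≤ 1 - l`.
    (β := β) (ρ := l * β) (η := 3 * l) hβpos.le hρ (by positivity)
    (fun i => by
      rw [← hδload]; exact hA _ (Multiset.mem_map_of_mem _ (Finset.mem_univ i)))
    (fun j hj => by
      rcases j with j | j
      · exact absurd rfl hj
      · have h1 := hB (gO j) (Multiset.mem_map_of_mem _ (Finset.mem_univ j))
        rw [← hδload]
        have h2 : (0 : ℝ) ≤ β * (gO j).wt := by positivity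
        have h3 : (1 - 3 * l) * (gO j).wt * (β + 2 * (l * β)) =
          (1 - l) * β * (gO j).wt - 6 * l ^ 2 * (β * (gO j).wt) := by ring
        show (1 - 3 * l) * ((gO j).wt : ℝ) * (β + 2 * (l * β)) ≤ load b H (gO j) + 2 * (l * β)
        have h4 : 0 ≤ 6 * l ^ 2 * (β * ((gO j).wt : ℝ)) := by positivity
        linarith)
    (ibetween_le h hh hbet)
  have hSle : S.val.map (Sum.elim h fun j => g j.1) ≤ H + Finset.univ.val.map gN := by
    refine (Multiset.map_le_map (Finset.val_le_iff.2 (Finset.subset_univ S))).trans (le_of_eq ?_)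
    rw [hmap]
    congr 1
    let ψ : Fin nN ≃ {j : Fin nN ⊕ Fin nO // j.isLeft = true} :=
      Equiv.ofBijective (fun i => ⟨Sum.inl i, rfl⟩) ⟨fun i j hij =>
        Sum.inl_injective (congrArg Subtype.val hij), by
        rintro ⟨j | j, hj⟩
        · exact ⟨j, rfl⟩
        · simp at hj⟩
    rw [← Finset.map_univ_equiv ψ, Finset.map_val, Multiset.map_map]
    rfl
  have hST : (weight (S.val.map (Sum.elim h fun j => g j.1)) : ℝ) ≤ weight T := by
    exact_mod_cast hTmax _ hSle hSb
  have hwg : (weight (Finset.univ.val.map gN + Finset.univ.val.map gO) : ℝ) =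
      ∑ j, ((g j).wt : ℝ) := by
    rw [← hgmap, weight_map_val]
    push_cast
    rfl
  rw [hwg]
  set w := ∑ j, ((g j).wt : ℝ) with hw
  have hsum : ∑ k : Copies b, 2 * W * δ k.vert = 4 * W * weight H := by
    rw [sum_copies]
    have h1 : ∀ v, ∑ i : Fin (b v), 2 * W * δ (⟨v, i⟩ : Copies b).vert = 2 * W * wdeg H v := by
      intro v
      have hbv : (b v : ℝ) ≠ 0 := by have := hb v; positivity
      simp only [Finset.sum_const, Finset.card_univ, Fintype.card_fin, nsmul_eq_mul, δ]
      field_simp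
    rw [Finset.sum_congr rfl fun v _ => h1 v, ← Finset.mul_sum]
    have h2 := sum_wdeg hH
    have h3 : (∑ v, (wdeg H v : ℝ)) = 2 * weight H := by exact_mod_cast h2
    rw [h3]; ring
  have hl4 : l ^ 4 ≤ l ^ 3 := by
    nlinarith [pow_pos hl 3]
  have hl3 : l ^ 3 ≤ l ^ 2 := by nlinarith [pow_pos hl 2]
  have hl2 : l ^ 2 ≤ l := by nlinarith
  have hT0 : (0 : ℝ) ≤ weight T := Nat.cast_nonneg _
  have hw0 : 0 ≤ w := Finset.sum_nonneg fun j _ => Nat.cast_nonneg _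
  -- The factor in front of `weight T` is `12 W⁴ / (l² β)`, which `hβ` bounds by `l²`.
  have e1 : (W : ℝ) / (l * β) ^ 2 * ∑ k : Copies b, 2 * W * δ k.vert ≤ l * weight T := by
    rw [hsum, div_mul_eq_mul_div, div_le_iff₀ (by positivity)]
    have h1 : (W : ℝ) * (4 * W * weight H) ≤ W * (4 * W * (3 * β * W ^ 2 * weight T)) := by gcongr
    refine h1.trans ?_
    have h2 : (16 * (W : ℝ) ^ 4) * (β * weight T) ≤ (l ^ 4 * β) * (β * weight T) := by gcongr
    have h3 : l ^ 4 * ((β : ℝ) ^ 2 * weight T) ≤ l ^ 3 * (β ^ 2 * weight T) := by gcongr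
    have h4 : (0 : ℝ) ≤ W ^ 4 * (β * weight T) := by positivity
    nlinarith
  have e2 : 2 / (l * β * (β + 2 * (l * β))) * ∑ j, (4 * (l * β) ^ 2 +
      (2 * W * δ (g j).src + 2 * W * δ (g j).dst)) ≤ 9 * l * w := by
    rw [hw, Finset.mul_sum, Finset.mul_sum]
    refine Finset.sum_le_sum fun j _ => ?_
    have h1 : (1 : ℝ) ≤ (g j).wt := by exact_mod_cast (hg j).2.1
    have h2 : 9 * l ≤ 9 * l * (g j).wt := le_mul_of_one_le_right (by positivity) h1
    refine le_trans ?_ h2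
    rw [div_mul_eq_mul_div, div_le_iff₀ (by positivity)]
    have h3 : 2 * (W : ℝ) * δ (g j).src ≤ 2 * W * (β * W) := by gcongr; exact hδle _
    have h4 : 2 * (W : ℝ) * δ (g j).dst ≤ 2 * W * (β * W) := by gcongr; exact hδle _
    have h5 : (16 * (W : ℝ) ^ 4) * β ≤ (l ^ 4 * β) * β := by gcongr
    have h6 : (W : ℝ) ^ 2 * β ≤ W ^ 4 * β := by
      have : (W : ℝ) ^ 2 ≤ W ^ 4 := pow_le_pow_right₀ hW' (by norm_num)
      gcongr
    have h7 : l ^ 4 * (β : ℝ) ^ 2 ≤ l ^ 2 * β ^ 2 := by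
      have := hl4.trans hl3
      gcongr
    have h8 : 0 ≤ l ^ 2 * (β : ℝ) ^ 2 := by positivity
    have h9 : 0 ≤ l ^ 3 * (β : ℝ) ^ 2 := by positivity
    nlinarith
  have e3 : (2 - 1 / (2 * (W : ℝ))) * weight (S.val.map (Sum.elim h fun j => g j.1)) ≤
      (2 - 1 / (2 * W)) * weight T := by
    refine mul_le_mul_of_nonneg_left hST ?_
    have : 1 / (2 * (W : ℝ)) ≤ 1 := by rw [div_le_one (by positivity)]; linarith
    linarith
  linarith

end

section

variable {V : Type*} {b : V → ℕ} {p : Params}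

/-! ### The insertion of edges -/

/-- No pair of vertices is linked by more edges than a `b`-matching can use. -/
def Bounded (b : V → ℕ) (H : Multiset (Edge V)) : Prop :=
  ∀ u x, u ≠ x → (between H u x).card ≤ min (b u) (b x)

theorem Bounded.mono {H K : Multiset (Edge V)} (hK : Bounded b K) (h : H ≤ K) : Bounded b H :=
  fun u x hux => (Multiset.card_le_card (between_mono h u x)).trans (hK u x hux)

theorem bounded_zero : Bounded b 0 := fun u x _ => by simp [between]

theorem between_comm (H : Multiset (Edge V)) (u x : V) : between H u x = between H x u := by
  simp only [between, and_comm]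

theorem ends_of_inc {e : Edge V} {u x : V} (hu : e.Inc u) (hx : e.Inc x) (hux : u ≠ x) :
    (e.src = u ∧ e.dst = x) ∨ (e.src = x ∧ e.dst = u) := by
  unfold Edge.Inc at *
  rcases hu with h | h <;> rcases hx with h' | h'
  · exact absurd (h.symm.trans h') hux
  · exact Or.inl ⟨h, h'⟩
  · exact Or.inr ⟨h', h⟩
  · exact absurd (h.symm.trans h') hux

/-- The effect of swapping an edge in: either there was room, or a lightest parallel edge is
replaced. -/
theorem swapIn_cases (c : Choices b p) (hb : ∀ v, 1 ≤ b v) (H : Multiset (Edge V)) (e : Edge V) :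
    (¬ Full b H e ∧ swapIn c H e = e ::ₘ H) ∨
    ∃ f H', H = f ::ₘ H' ∧ swapIn c H e = e ::ₘ H' ∧ Full b H e ∧ f.Inc e.src ∧ f.Inc e.dst ∧
      ∀ g ∈ between H e.src e.dst, f.wt ≤ g.wt := by
  by_cases h : Full b H e
  · right
    have hne : between H e.src e.dst ≠ 0 := by
      intro h0
      have h1 : (between H e.src e.dst).card = min (b e.src) (b e.dst) := h
      rw [h0, Multiset.card_zero] at h1
      have h2 := hb e.src
      have h3 := hb e.dst
      omega
    obtain ⟨h1, h2⟩ := c.lightest_spec _ hne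
    obtain ⟨h3, h4, h5⟩ := mem_between.1 h1
    exact ⟨_, _, (Multiset.cons_erase h3).symm, by rw [swapIn, if_pos h], h, h4, h5, h2⟩
  · exact Or.inl ⟨h, by rw [swapIn, if_neg h]⟩

theorem swapIn_le (c : Choices b p) (hb : ∀ v, 1 ≤ b v) (H : Multiset (Edge V)) (e : Edge V) :
    swapIn c H e ≤ e ::ₘ H := by
  rcases swapIn_cases c hb H e with ⟨-, h⟩ | ⟨f, H', h1, h2, -⟩
  · rw [h]
  · rw [h2, h1]
    exact Multiset.cons_le_cons e (Multiset.le_cons_self H' f)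

theorem Bounded.swapIn (c : Choices b p) (hb : ∀ v, 1 ≤ b v) {H : Multiset (Edge V)}
    (hH : Bounded b H) (e : Edge V) : Bounded b (swapIn c H e) := by
  rcases swapIn_cases c hb H e with ⟨h, h'⟩ | ⟨f, H', rfl, h', -, h3, h4, -⟩
  · rw [h']
    intro u x hux
    rw [between_cons, Multiset.card_add]
    split_ifs with hux'
    · have h1 := hH u x hux
      have h2 : (between H u x).card ≠ min (b u) (b x) := by
        intro h0
        rcases ends_of_inc hux'.1 hux'.2 hux with ⟨h5, h6⟩ | ⟨h5, h6⟩ <;> apply h <;>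
          unfold Full <;> rw [h5, h6]
        · exact h0
        · rw [between_comm, h0, min_comm]
      simp only [Multiset.card_singleton]
      omega
    · simpa using hH u x hux
  · rw [h']
    intro u x hux
    have h1 := hH u x hux
    rw [between_cons, Multiset.card_add] at h1 ⊢
    by_cases h5 : e.Inc u ∧ e.Inc x
    · have h6 : f.Inc u ∧ f.Inc x := by
        rcases ends_of_inc h5.1 h5.2 hux with ⟨h7, h8⟩ | ⟨h7, h8⟩
        · rw [← h7, ← h8]; exact ⟨h3, h4⟩
        · rw [← h7, ← h8]; exact ⟨h4, h3⟩
      rw [if_pos h6] at h1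
      rw [if_pos h5]
      simpa using h1
    · rw [if_neg h5]
      simp only [Multiset.card_zero]
      omega

theorem prune_of_exists (c : Choices b p) {H : Multiset (Edge V)}
    (h : ∃ e ∈ H, (p.β : ℝ) * e.wt < load b H e) : prune c H = prune c (H.erase (c.excess H)) := by
  rw [prune, dif_pos h]

theorem prune_of_not_exists (c : Choices b p) {H : Multiset (Edge V)}
    (h : ¬ ∃ e ∈ H, (p.β : ℝ) * e.wt < load b H e) : prune c H = H := by
  rw [prune, dif_neg h]

/-- A property that is kept by the removal of edges of excessive load is kept by `prune`. -/
theorem prune_induction (c : Choices b p) (P : Multiset (Edge V) → Prop)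
    (hP : ∀ f H, P (f ::ₘ H) → (p.β : ℝ) * f.wt < load b (f ::ₘ H) f → P H)
    (H : Multiset (Edge V)) (hH : P H) : P (prune c H) := by
  induction hn : H.card using Nat.strong_induction_on generalizing H with
  | _ n ih =>
    by_cases h : ∃ e ∈ H, (p.β : ℝ) * e.wt < load b H e
    · rw [prune_of_exists c h]
      obtain ⟨h1, h2⟩ := c.excess_spec H h
      have h3 := Multiset.cons_erase h1
      refine ih _ ?_ _ (hP (c.excess H) _ ?_ ?_) rfl
      · rw [← hn]; exact Multiset.card_erase_lt_of_mem h1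
      · rwa [h3]
      · rwa [h3]
    · rwa [prune_of_not_exists c h]

theorem prune_le (c : Choices b p) (H : Multiset (Edge V)) : prune c H ≤ H :=
  prune_induction c (fun K => K ≤ H) (fun f K h _ => (Multiset.le_cons_self K f).trans h) H le_rfl

theorem load_prune_le (c : Choices b p) (H : Multiset (Edge V)) :
    ∀ e ∈ prune c H, load b (prune c H) e ≤ p.β * e.wt := by
  induction hn : H.card using Nat.strong_induction_on generalizing H with
  | _ n ih =>
    by_cases h : ∃ e ∈ H, (p.β : ℝ) * e.wt < load b H e
    · rw [prune_of_exists c h]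
      refine ih _ ?_ _ rfl
      rw [← hn]; exact Multiset.card_erase_lt_of_mem (c.excess_spec H h).1
    · rw [prune_of_not_exists c h]
      push Not at h
      exact h

theorem load_cons_self (H : Multiset (Edge V)) {e f : Edge V} (h1 : f.Inc e.src) (h2 : f.Inc e.dst) :
    load b (f ::ₘ H) e = load b H e + f.wt * (1 / b e.src + 1 / b e.dst) := by
  simp only [load, wdeg_cons, h1, h2, if_true]
  push_cast
  ring

theorem load_parallel (H : Multiset (Edge V)) {e f : Edge V} (he : e.src ≠ e.dst)
    (h1 : f.Inc e.src) (h2 : f.Inc e.dst) : load b H f = load b H e ∧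
      (1 : ℝ) / b f.src + 1 / b f.dst = 1 / b e.src + 1 / b e.dst := by
  rcases ends_of_inc h1 h2 he with ⟨h, h'⟩ | ⟨h, h'⟩ <;> unfold load <;> rw [h, h'] <;>
    constructor <;> ring

theorem inv_add_inv_le (hb : ∀ v, 1 ≤ b v) (u v : V) : (1 : ℝ) / b u + 1 / b v ≤ 2 := by
  have h : ∀ v, (1 : ℝ) / b v ≤ 1 := fun v => by
    have h1 : (1 : ℝ) ≤ b v := by exact_mod_cast hb v
    rw [div_le_one (by linarith)]; exact h1
  linarith [h u, h v]

/-! ### A potential that counts insertions -/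

section Potential

variable [Fintype V]

/-- The potential function. -/
def potential (b : V → ℕ) (s : ℝ) (H : Multiset (Edge V)) : ℝ :=
  2 * s * (H.map fun e => (e.wt : ℝ) ^ 2).sum - ∑ v, (wdeg H v : ℝ) ^ 2 / b v

theorem potential_zero (s : ℝ) : potential b s 0 = 0 := by simp [potential]

theorem potential_cons (s : ℝ) (H : Multiset (Edge V)) {e : Edge V} (he : e.src ≠ e.dst) :
    potential b s (e ::ₘ H) = potential b s H + (2 * s * (e.wt : ℝ) ^ 2 -
      2 * e.wt * load b H e - (e.wt : ℝ) ^ 2 * (1 / b e.src + 1 / b e.dst)) := by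
  have h1 : ∀ v, (wdeg (e ::ₘ H) v : ℝ) ^ 2 / b v = (wdeg H v : ℝ) ^ 2 / b v +
      if e.Inc v then (2 * (e.wt : ℝ) * (wdeg H v / b v) + (e.wt : ℝ) ^ 2 * (1 / b v)) else 0 := by
    intro v
    rw [wdeg_cons]
    split_ifs
    · push_cast; ring
    · simp
  simp only [potential, h1, Finset.sum_add_distrib, sum_ite_inc he, Multiset.map_cons,
    Multiset.sum_cons, load]
  ring

/-- An edge `f` of excessive load has load above `(β - 1 / b u - 1 / b v) * w` in the graph without
it, so adding it changes the potential by at most `(1 / b u + 1 / b v - 4) * w ^ 2 ≤ 0`. Removing it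
cannot lower the potential. -/
theorem potential_prune (hb : ∀ v, 1 ≤ b v) (c : Choices b p) (H : Multiset (Edge V))
    (hH : ∀ e ∈ H, e.src ≠ e.dst) :
    potential b (p.β - 2) H ≤ potential b (p.β - 2) (prune c H) := by
  refine (prune_induction c (fun K => (∀ e ∈ K, e.src ≠ e.dst) ∧
    potential b (p.β - 2) H ≤ potential b (p.β - 2) K) ?_ H ⟨hH, le_rfl⟩).2
  rintro f K ⟨h1, h2⟩ h3
  have hf := h1 f (Multiset.mem_cons_self f K)
  refine ⟨fun e he => h1 e (Multiset.mem_cons_of_mem he), h2.trans ?_⟩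
  rw [potential_cons _ _ hf]
  rw [load_cons_self K f.inc_src f.inc_dst] at h3
  have h4 := inv_add_inv_le hb f.src f.dst
  have h5 : (0 : ℝ) ≤ f.wt := Nat.cast_nonneg _
  set cc : ℝ := 1 / b f.src + 1 / b f.dst
  have h6 := mul_le_mul_of_nonneg_left h3.le h5
  have h7 := mul_le_mul_of_nonneg_left h4 (sq_nonneg (f.wt : ℝ))
  nlinarith

/-- With room left, the gain is at least `(2 * (β - 2) - 2 * β⁻ - 2) * w ^ 2 = 2 * w ^ 2`. If an
edge is replaced, it is strictly lighter because the new one is not irrelevant; the gain then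
factors as the weight difference, at least 1, times a quantity at least 2. -/
theorem potential_swapIn (hb : ∀ v, 1 ≤ b v) (hp : p.βm + 4 = p.β) (c : Choices b p)
    (H : Multiset (Edge V)) {e : Edge V} {W : ℕ} (he : e.Valid W) (hacc : Accepts b p H e)
    (hH : ∀ f ∈ H, f.Valid W) :
    potential b (p.β - 2) H + 2 ≤ potential b (p.β - 2) (swapIn c H e) := by
  obtain ⟨hload, hirr⟩ := hacc
  have hβ : (p.β : ℝ) = p.βm + 4 := by exact_mod_cast hp.symm
  have hβm : (0 : ℝ) ≤ p.βm := Nat.cast_nonneg _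
  have he1 : (1 : ℝ) ≤ e.wt := by exact_mod_cast he.2.1
  have h4 := inv_add_inv_le hb e.src e.dst
  set cc : ℝ := 1 / b e.src + 1 / b e.dst with hcc
  have hcc0 : 0 ≤ cc := by positivity
  rcases swapIn_cases c hb H e with ⟨-, h'⟩ | ⟨f, H', rfl, h', h2, h3, h5, h6⟩
  · rw [h', potential_cons _ _ he.1, ← hcc]
    have h7 := mul_le_mul_of_nonneg_left hload.le (show (0 : ℝ) ≤ e.wt by linarith)
    have h8 := mul_le_mul_of_nonneg_left h4 (sq_nonneg (e.wt : ℝ))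
    nlinarith
  · have hf := hH f (Multiset.mem_cons_self f H')
    rw [h', potential_cons _ _ he.1, potential_cons _ _ hf.1, ← hcc]
    obtain ⟨h7, h8⟩ := load_parallel (b := b) H' he.1 h3 h5
    rw [h7, h8, ← hcc]
    rw [load_cons_self H' h3 h5, ← hcc] at hload
    have hlt : f.wt < e.wt := by
      by_contra hle
      exact hirr ⟨h2, fun g hg => (not_lt.1 hle).trans (h6 g hg)⟩
    have h9 : (f.wt : ℝ) + 1 ≤ e.wt := by exact_mod_cast hlt
    have h10 : (1 : ℝ) ≤ f.wt := by exact_mod_cast hf.2.1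
    set x : ℝ := (e.wt : ℝ)
    set y : ℝ := (f.wt : ℝ)
    set L := load b H' e
    have h11 : 0 ≤ y * cc := by positivity
    have h12 : L ≤ p.βm * x := by linarith
    have h13 : 2 ≤ (2 * (p.β - 2) - cc) * (x + y) - 2 * L := by
      have : (2 * ((p.β : ℝ) - 2) - 2) * (x + y) ≤ (2 * (p.β - 2) - cc) * (x + y) :=
        mul_le_mul_of_nonneg_right (by linarith) (by linarith)
      rw [hβ] at this ⊢
      nlinarith
    have h14 : (1 : ℝ) * 2 ≤ (x - y) * ((2 * (p.β - 2) - cc) * (x + y) - 2 * L) :=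
      mul_le_mul (by linarith) h13 (by norm_num) (by linarith)
    nlinarith

/-- Dropping the degree term is enough. Together with the gain of 2 per insertion, this bounds the
number of insertions by a multiple of the size of `H`. -/
theorem potential_le {W : ℕ} {s : ℝ} (hs : 0 ≤ s) {H : Multiset (Edge V)}
    (hH : ∀ e ∈ H, e.Valid W) : potential b s H ≤ 2 * s * W ^ 2 * H.card := by
  have h1 : (H.map fun e => (e.wt : ℝ) ^ 2).sum ≤ W ^ 2 * H.card := by
    induction H using Multiset.induction_on with
    | empty => simp
    | cons e H ih =>
      have h2 := ih fun f hf => hH f (Multiset.mem_cons_of_mem hf)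
      have h3 : (e.wt : ℝ) ≤ W := by exact_mod_cast (hH e (Multiset.mem_cons_self e H)).2.2
      have h4 : (e.wt : ℝ) ^ 2 ≤ W ^ 2 := by gcongr
      rw [Multiset.map_cons, Multiset.sum_cons, Multiset.card_cons]
      push_cast
      linarith
  have h2 : 0 ≤ ∑ v, (wdeg H v : ℝ) ^ 2 / b v := Finset.sum_nonneg fun v _ => by positivity
  have h3 := mul_le_mul_of_nonneg_left h1 (show 0 ≤ 2 * s by linarith)
  unfold potential
  linarith

end Potential

/-! ### Invariants of the algorithm -/

variable (c : Choices b p) (W n m : ℕ)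

theorem run_nil : run c W n m [] = initState V p W m := rfl

theorem run_append_singleton (l : List (Edge V)) (e : Edge V) :
    run c W n m (l ++ [e]) = step c W n m (run c W n m l) e := by
  simp [run, List.foldl_append]

theorem coe_append_singleton (l : List (Edge V)) (e : Edge V) :
    ((l ++ [e] : List (Edge V)) : Multiset (Edge V)) = e ::ₘ (l : Multiset (Edge V)) := by
  rw [← Multiset.coe_add, Multiset.coe_singleton, add_comm, Multiset.singleton_add]

theorem run_stored (hb : ∀ v, 1 ≤ b v) (l : List (Edge V)) :
    (run c W n m l).H + (run c W n m l).X ≤ (l : Multiset (Edge V)) ∧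
    (∀ e ∈ (run c W n m l).H, load b (run c W n m l).H e ≤ p.β * e.wt) ∧
    Bounded b (run c W n m l).H := by
  induction l using List.reverseRecOn with
  | nil => rw [run_nil]; exact ⟨by simp [initState], by simp [initState], bounded_zero⟩
  | append_singleton l e ih =>
    obtain ⟨h1, h2, h3⟩ := ih
    rw [run_append_singleton, coe_append_singleton]
    set s := run c W n m l with hs
    have hle : s.H + s.X ≤ e ::ₘ (l : Multiset (Edge V)) := h1.trans (Multiset.le_cons_self _ _)
    unfold step
    rcases hph : s.phase with ⟨i, j, k, found⟩ | _
    · by_cases hacc : Accepts b p s.H e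
      · simp only [if_pos hacc]
        refine ⟨?_, load_prune_le c _, (h3.swapIn c hb e).mono (prune_le c _)⟩
        calc prune c (swapIn c s.H e) + s.X ≤ e ::ₘ s.H + s.X :=
              add_le_add_left ((prune_le c _).trans (swapIn_le c hb _ _)) _
          _ = e ::ₘ (s.H + s.X) := Multiset.cons_add _ _ _
          _ ≤ _ := Multiset.cons_le_cons e h1
      · simp only [if_neg hacc]
        exact ⟨hle, h2, h3⟩
    · refine ⟨?_, h2, h3⟩
      by_cases hacc : Accepts b p s.H e
      · simp only [if_pos hacc, Multiset.add_cons]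
        exact Multiset.cons_le_cons e h1
      · simp only [if_neg hacc]
        exact hle

/-- The relevant edges stored by the auxiliary procedure. -/
theorem run_relevant (hb : ∀ v, 1 ≤ b v) (l : List (Edge V)) (hl : ∀ e ∈ l, e.src ≠ e.dst) :
    (∀ R, (run c W n m l).R = some R → Bounded b R ∧
      (R = 0 ∨ (R.card : ℝ) < auxLimit p W n m) ∧
      ∃ D, (l : Multiset (Edge V)) = R + D ∧ ∀ e ∈ D, Irrelevant b R e) ∧
    ((run c W n m l).R = none → ∃ R ≤ (l : Multiset (Edge V)), Bounded b R ∧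
      auxLimit p W n m ≤ R.card) := by
  induction l using List.reverseRecOn with
  | nil =>
    rw [run_nil]
    refine ⟨?_, by simp [initState]⟩
    intro R hR
    simp only [initState, Option.some.injEq] at hR
    subst hR
    exact ⟨bounded_zero, Or.inl rfl, 0, by simp, by simp⟩
  | append_singleton l e ih =>
    obtain ⟨h1, h2⟩ := ih fun f hf => hl f (by simp [hf])
    have he : e.src ≠ e.dst := hl e (by simp)
    rw [run_append_singleton, coe_append_singleton]
    have hR : (step c W n m (run c W n m l) e).R =
      (run c W n m l).R.bind fun R => auxStep c W n m R e := rfl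
    rw [hR]
    rcases hRl : (run c W n m l).R with _ | R
    · refine ⟨by simp, fun _ => ?_⟩
      obtain ⟨R, h3, h4⟩ := h2 hRl
      exact ⟨R, h3.trans (Multiset.le_cons_self _ _), h4⟩
    obtain ⟨h3, -, D, h4, h5⟩ := h1 R hRl
    set R' := if Irrelevant b R e then R else swapIn c R e with hR'
    have key : Bounded b R' ∧ ∃ D, e ::ₘ (l : Multiset (Edge V)) = R' + D ∧
        ∀ f ∈ D, Irrelevant b R' f := by
      by_cases hirr : Irrelevant b R e
      · rw [hR', if_pos hirr]
        refine ⟨h3, e ::ₘ D, by rw [h4, Multiset.add_cons], fun f hf => ?_⟩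
        rcases Multiset.mem_cons.1 hf with rfl | hf
        · exact hirr
        · exact h5 f hf
      · rw [hR', if_neg hirr]
        refine ⟨h3.swapIn c hb e, ?_⟩
        have hDne : ∀ f ∈ D, f.src ≠ f.dst := by
          intro f hf
          refine hl f ?_
          have : f ∈ (l : Multiset (Edge V)) := by rw [h4]; exact Multiset.mem_add.2 (Or.inr hf)
          exact List.mem_append_left _ this
        -- Discarded edges stay irrelevant. If there was room for `e`, none of them is parallel to
        -- it; if `e` replaces the lighter `f`, numbers of parallel edges are unchanged and minimal
        -- weights do not decrease. In the second case `f` joins the discarded edges.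
        rcases swapIn_cases c hb R e with ⟨hnf, h'⟩ | ⟨f, R₀, hRf, h', hfull, h7, h8, h9⟩
        · rw [h']
          refine ⟨D, by rw [h4, Multiset.cons_add], fun f hf => ?_⟩
          obtain ⟨h6, h7⟩ := h5 f hf
          have hpar : ¬ (e.Inc f.src ∧ e.Inc f.dst) := by
            intro h8
            rcases ends_of_inc h8.1 h8.2 (hDne f hf) with ⟨h9, h10⟩ | ⟨h9, h10⟩ <;> apply hnf <;>
              unfold Full <;> rw [h9, h10]
            · exact h6
            · rw [between_comm, min_comm]; exact h6
          have h8 : between (e ::ₘ R) f.src f.dst = between R f.src f.dst := by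
            rw [between_cons, if_neg hpar, zero_add]
          unfold Irrelevant Full
          rw [h8]
          exact ⟨h6, h7⟩
        · rw [h']
          subst hRf
          have hlt : f.wt < e.wt := by
            by_contra hle
            exact hirr ⟨hfull, fun g hg => (not_lt.1 hle).trans (h9 g hg)⟩
          refine ⟨f ::ₘ D, by rw [h4, Multiset.cons_add, Multiset.cons_add, Multiset.add_cons], ?_⟩
          have hpar : ∀ u x, u ≠ x → (e.Inc u ∧ e.Inc x ↔ f.Inc u ∧ f.Inc x) := by
            intro u x _
            rw [Edge.inc_iff_of_parallel he h7 h8, Edge.inc_iff_of_parallel he h7 h8]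
          have hcard : ∀ u x, u ≠ x →
              (between (e ::ₘ R₀) u x).card = (between (f ::ₘ R₀) u x).card := by
            intro u x hux
            simp only [between_cons, hpar u x hux, Multiset.card_add]
            split_ifs <;> simp
          have hfne : f.src ≠ f.dst := by
            rcases ends_of_inc h7 h8 he with ⟨h10, h11⟩ | ⟨h10, h11⟩ <;> rw [h10, h11]
            · exact he
            · exact he.symm
          have hbe : between (f ::ₘ R₀) f.src f.dst = between (f ::ₘ R₀) e.src e.dst ∧
              min (b f.src) (b f.dst) = min (b e.src) (b e.dst) := by
            rcases ends_of_inc h7 h8 he with ⟨h10, h11⟩ | ⟨h10, h11⟩ <;> rw [h10, h11]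
            · exact ⟨rfl, rfl⟩
            · exact ⟨between_comm _ _ _, min_comm _ _⟩
          intro g hg
          rcases Multiset.mem_cons.1 hg with rfl | hg
          · refine ⟨?_, fun x hx => ?_⟩
            · unfold Full
              rw [hcard _ _ hfne, hbe.1, hbe.2]
              exact hfull
            · obtain ⟨hx1, hx2⟩ := mem_between.1 hx
              rcases Multiset.mem_cons.1 hx1 with rfl | hx1
              · exact hlt.le
              · refine h9 x ?_
                rw [← hbe.1]
                exact mem_between.2 ⟨Multiset.mem_cons_of_mem hx1, hx2⟩
          · obtain ⟨h10, h11⟩ := h5 g hg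
            refine ⟨?_, fun x hx => ?_⟩
            · unfold Full
              rw [hcard _ _ (hDne g hg)]
              exact h10
            · obtain ⟨hx1, hx2⟩ := mem_between.1 hx
              rcases Multiset.mem_cons.1 hx1 with rfl | hx1
              · have h12 := (hpar _ _ (hDne g hg)).1 hx2
                exact (h11 f (mem_between.2 ⟨Multiset.mem_cons_self _ _, h12⟩)).trans hlt.le
              · exact h11 x (mem_between.2 ⟨Multiset.mem_cons_of_mem hx1, hx2⟩)
    have haux : (some R).bind (fun R => auxStep c W n m R e) =
        if (R'.card : ℝ) < auxLimit p W n m then some R' else none := rfl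
    rw [haux]
    split_ifs with hlim
    · refine ⟨?_, by simp⟩
      intro R₁ hR₁
      obtain rfl := Option.some.inj hR₁
      exact ⟨key.1, Or.inr hlim, key.2⟩
    · refine ⟨by simp, fun _ => ⟨R', ?_, key.1, not_lt.1 hlim⟩⟩
      obtain ⟨D', hD', -⟩ := key.2
      rw [hD']
      exact Multiset.le_add_right _ _

end

/-! ### Epochs, levels and the end of the first phase -/

section

variable {V : Type*} {b : V → ℕ} {p : Params}

/-- The number of edges read before level `i` if no epoch ends the first phase. -/
def elapsed (p : Params) (W m i : ℕ) : ℕ :=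
  ∑ i' ∈ Finset.range i, epochCount p W i' * epochLength p W m i'

theorem elapsed_mono (p : Params) (W m : ℕ) {i j : ℕ} (h : i ≤ j) :
    elapsed p W m i ≤ elapsed p W m j :=
  Finset.sum_le_sum_of_subset (Finset.range_mono h)

theorem elapsed_add_le (p : Params) (W m : ℕ) {i j : ℕ} (hi : i ≤ Nat.log 2 m)
    (hj : j ≤ epochCount p W i) :
    elapsed p W m i + j * epochLength p W m i ≤ elapsed p W m (Nat.log 2 m + 1) := by
  refine le_trans ?_ (elapsed_mono p W m (Nat.succ_le_succ hi))
  rw [elapsed, elapsed, Finset.sum_range_succ]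
  exact Nat.add_le_add_left (Nat.mul_le_mul_right _ hj) _

variable (c : Choices b p) (W n m : ℕ)

theorem valid_H (hb : ∀ v, 1 ≤ b v) {q : List (Edge V)} (hq : ∀ e ∈ q, e.Valid W) :
    ∀ e ∈ (run c W n m q).H, e.Valid W := fun e he =>
  hq e (Multiset.mem_coe.1
    (Multiset.mem_of_le ((Multiset.le_add_right _ _).trans (run_stored c W n m hb q).1) he))

variable [Fintype V]

/-- The potential of `H` after the edges `q`. -/
def phi (q : List (Edge V)) : ℝ := potential b (p.β - 2) (run c W n m q).H

/-- The first phase ended after `t` of the edges `q`. -/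
structure EndedAt (q : List (Edge V)) (t : ℕ) : Prop where
  le_length : t ≤ q.length
  le_elapsed : t ≤ elapsed p W m (Nat.log 2 m + 1)
  X_eq : (run c W n m q).X = ((q.drop t).filter fun e => Accepts b p (run c W n m q).H e)
  reason : ∃ i, (i = 0 ∨ 2 * (epochCount p W (i - 1) : ℝ) ≤ phi c W n m q) ∧
    ((i ≤ Nat.log 2 m ∧ 0 < epochLength p W m i ∧ epochLength p W m i ≤ t ∧
      (run c W n m (q.take (t - epochLength p W m i))).H = (run c W n m q).H ∧
      ∀ e ∈ (q.take t).drop (t - epochLength p W m i), ¬ Accepts b p (run c W n m q).H e) ∨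
    (i ≤ Nat.log 2 m ∧ epochLength p W m i = 0) ∨ Nat.log 2 m < i)

/-- What is known about the state after the edges `q`, according to the phase. -/
def PhaseInv (q : List (Edge V)) : Phase → Prop
  | .early i j k found => i ≤ Nat.log 2 m ∧ k < epochLength p W m i ∧ j < epochCount p W i ∧
      q.length = elapsed p W m i + j * epochLength p W m i + k ∧
      2 * ((j : ℝ) + if found then 1 else 0) ≤ phi c W n m q ∧
      (i = 0 ∨ 2 * (epochCount p W (i - 1) : ℝ) ≤ phi c W n m q) ∧
      (run c W n m q).X = 0 ∧
      (found = false → (run c W n m (q.take (q.length - k))).H = (run c W n m q).H ∧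
        ∀ e ∈ q.drop (q.length - k), ¬ Accepts b p (run c W n m q).H e)
  | .late => ∃ t, EndedAt c W n m q t

/-- The case `i = Nat.log 2 m + 1`, `j = 0` arises when the last level is completed; then, as for an
epoch of length 0, the first phase ends on the spot. -/
theorem phaseInv_startEpoch {q : List (Edge V)} {i j : ℕ}
    (hi : i ≤ Nat.log 2 m ∨ (i = Nat.log 2 m + 1 ∧ j = 0)) (hj : j < epochCount p W i)
    (hX : (run c W n m q).X = 0)
    (hlen : q.length = elapsed p W m i + j * epochLength p W m i)
    (hphi : 2 * (j : ℝ) ≤ phi c W n m q)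
    (hlev : i = 0 ∨ 2 * (epochCount p W (i - 1) : ℝ) ≤ phi c W n m q) :
    PhaseInv c W n m q (startEpoch p W m i j) := by
  unfold startEpoch
  split_ifs with h
  · refine ⟨h.1, h.2, hj, by omega, by simpa using hphi, hlev, hX, fun _ => ?_⟩
    simp
  · refine ⟨q.length, le_rfl, ?_, by simp [hX], i, hlev, ?_⟩
    · rw [hlen]
      rcases hi with hi | ⟨rfl, rfl⟩
      · exact elapsed_add_le p W m hi hj.le
      · simp
    · rcases hi with hi | ⟨rfl, rfl⟩
      · refine Or.inr (Or.inl ⟨hi, ?_⟩)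
        by_contra h'
        exact h ⟨hi, Nat.pos_of_ne_zero h'⟩
      · exact Or.inr (Or.inr (Nat.lt_succ_self _))

theorem epochCount_pos (p : Params) (W i : ℕ) : 0 < epochCount p W i := Nat.succ_pos _

/-- An insertion gains 2 in `swapIn`, and the pruning that follows loses nothing. -/
theorem phi_step (hb : ∀ v, 1 ≤ b v) (hp : p.βm + 4 = p.β) {q : List (Edge V)}
    (hq : ∀ e ∈ q, e.Valid W) {e : Edge V} (he : e.Valid W) {i j k : ℕ} {found : Bool}
    (hph : (run c W n m q).phase = .early i j k found) :
    (¬ Accepts b p (run c W n m q).H e ∧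
      (run c W n m (q ++ [e])).H = (run c W n m q).H) ∨
    (Accepts b p (run c W n m q).H e ∧ phi c W n m q + 2 ≤ phi c W n m (q ++ [e])) := by
  have hv := valid_H c W n m hb hq
  have hH : (run c W n m (q ++ [e])).H = if Accepts b p (run c W n m q).H e then
      prune c (swapIn c (run c W n m q).H e) else (run c W n m q).H := by
    rw [run_append_singleton, step, hph]
  by_cases h : Accepts b p (run c W n m q).H e
  · right
    refine ⟨h, ?_⟩
    rw [if_pos h] at hH
    rw [phi, phi, hH]
    refine (potential_swapIn hb hp c _ he h hv).trans (potential_prune hb c _ fun f hf => ?_)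
    rcases Multiset.mem_cons.1 (Multiset.mem_of_le (swapIn_le c hb _ _) hf) with rfl | hf
    · exact he.1
    · exact (hv f hf).1
  · left
    exact ⟨h, by rw [hH, if_neg h]⟩

/-- The invariant of the phases. -/
theorem phaseInv_run (hb : ∀ v, 1 ≤ b v) (hp : p.βm + 4 = p.β) (q : List (Edge V))
    (hq : ∀ e ∈ q, e.Valid W) : PhaseInv c W n m q (run c W n m q).phase := by
  induction q using List.reverseRecOn with
  | nil =>
    refine phaseInv_startEpoch c W n m (Or.inl (Nat.zero_le _)) (epochCount_pos _ _ _) rfl ?_ ?_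
      (Or.inl rfl)
    · simp [elapsed]
    · simp [phi, run_nil, initState, potential_zero]
  | append_singleton q e ih =>
    have hq' : ∀ e ∈ q, e.Valid W := fun f hf => hq f (by simp [hf])
    have he : e.Valid W := hq e (by simp)
    have ih := ih hq'
    have hlen : (q ++ [e]).length = q.length + 1 := by simp
    have hphase : (run c W n m (q ++ [e])).phase = (run c W n m q).phase.advance p W m
        (decide (Accepts b p (run c W n m q).H e)) := by
      rw [run_append_singleton]; rfl
    rcases hph : (run c W n m q).phase with ⟨i, j, k, found⟩ | _
    · rw [hph] at ih
      obtain ⟨h1, h2, h3, h4, h5, h6, h7, h8⟩ := ih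
      have hX : (run c W n m (q ++ [e])).X = 0 := by
        rw [run_append_singleton, step, hph]; exact h7
      have hstep := phi_step c W n m hb hp hq' he hph
      have hmono : phi c W n m q ≤ phi c W n m (q ++ [e]) := by
        rcases hstep with ⟨-, h⟩ | ⟨-, h⟩
        · rw [phi, phi, h]
        · linarith
      have hlev := h6.imp id fun h => h.trans hmono
      set hit := decide (Accepts b p (run c W n m q).H e) with hhit
      have hphi' : 2 * ((j : ℝ) + if (found || hit) = true then 1 else 0) ≤
          phi c W n m (q ++ [e]) := by
        rcases hstep with ⟨h, -⟩ | ⟨h, h'⟩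
        · have : hit = false := by simpa [hhit] using h
          rw [this, Bool.or_false]
          exact h5.trans hmono
        · have : hit = true := by simpa [hhit] using h
          rw [this, Bool.or_true, if_pos rfl]
          have h9 : (0 : ℝ) ≤ if found = true then 1 else 0 := by positivity
          linarith
      have hwin : (found || hit) = false →
          (run c W n m ((q ++ [e]).take (q.length - k))).H = (run c W n m (q ++ [e])).H ∧
          ∀ f ∈ (q ++ [e]).drop (q.length - k), ¬ Accepts b p (run c W n m (q ++ [e])).H f := by
        intro h
        obtain ⟨hf, hh⟩ := Bool.or_eq_false_iff.1 h
        have hna : ¬ Accepts b p (run c W n m q).H e := by simpa [hhit] using hh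
        rcases hstep with ⟨-, h9⟩ | ⟨h9, -⟩
        · obtain ⟨h10, h11⟩ := h8 hf
          rw [h9, List.take_append_of_le_length (Nat.sub_le _ _),
            List.drop_append_of_le_length (Nat.sub_le _ _)]
          refine ⟨h10, fun f hf => ?_⟩
          rcases List.mem_append.1 hf with hf | hf
          · exact h11 f hf
          · rw [List.mem_singleton.1 hf]; exact hna
        · exact absurd h9 hna
      rw [hphase, hph, Phase.advance]
      -- The epoch goes on, or ends the first phase, or is followed by another epoch of its level,
      -- or completes its level.
      split_ifs with h9 h10 h11
      · refine ⟨h1, h9, h3, by rw [hlen]; omega, hphi', hlev, hX, fun h => ?_⟩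
        rw [hlen, Nat.add_sub_add_right]
        exact hwin h
      · have hα : epochLength p W m i = k + 1 := by omega
        obtain ⟨h11, h12⟩ := hwin h10
        have hle : k ≤ q.length := by omega
        refine ⟨q.length + 1, by rw [hlen], ?_, ?_, i, hlev, Or.inl ⟨h1, by omega, by omega, ?_⟩⟩
        · have := elapsed_add_le p W m h1 (Nat.succ_le_of_lt h3)
          rw [hα, Nat.succ_mul] at this
          rw [h4, hα]
          omega
        · rw [← hlen, List.drop_length, hX]; simp
        · rw [hα, Nat.add_sub_add_right, ← hlen, List.take_length]
          exact ⟨h11, h12⟩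
      · have hfh : (found || hit) = true := Bool.eq_true_of_not_eq_false h10
        rw [hfh, if_pos rfl] at hphi'
        refine phaseInv_startEpoch c W n m (Or.inl h1) h11 hX ?_ (by push_cast; exact hphi') hlev
        rw [hlen, h4, Nat.succ_mul]
        omega
      · have hfh : (found || hit) = true := Bool.eq_true_of_not_eq_false h10
        rw [hfh, if_pos rfl] at hphi'
        have hjN : epochCount p W i = j + 1 := by omega
        refine phaseInv_startEpoch c W n m ?_ (epochCount_pos _ _ _) hX ?_ ?_ ?_
        · rcases h1.lt_or_eq with h | h
          · exact Or.inl h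
          · exact Or.inr ⟨by rw [h], rfl⟩
        · have hα : epochLength p W m i = k + 1 := by omega
          rw [hlen, h4, elapsed, elapsed, Finset.sum_range_succ, hjN, hα]
          ring
        · have h12 : (0 : ℝ) ≤ j := Nat.cast_nonneg j
          push_cast
          linarith
        -- All epochs of the completed level inserted an edge, so their number, doubled, is a lower
        -- bound for the potential.
        · right
          rw [Nat.add_sub_cancel, hjN]
          push_cast
          exact hphi'
    · rw [hph] at ih
      obtain ⟨t, h1, h2, h4, i, h5, h6⟩ := ih
      have hH : (run c W n m (q ++ [e])).H = (run c W n m q).H := by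
        rw [run_append_singleton, step, hph]
      have hX : (run c W n m (q ++ [e])).X = if Accepts b p (run c W n m q).H e then
          e ::ₘ (run c W n m q).X else (run c W n m q).X := by
        rw [run_append_singleton, step, hph]
      have hphi : phi c W n m (q ++ [e]) = phi c W n m q := by rw [phi, phi, hH]
      rw [hphase, hph]
      refine ⟨t, by rw [hlen]; omega, h2, ?_, i, by rwa [hphi], ?_⟩
      · rw [hX, hH, List.drop_append_of_le_length h1, List.filter_append, h4]
        split_ifs with h
        · rw [List.filter_singleton]
          simp only [h, decide_true, cond_true, coe_append_singleton]
        · rw [List.filter_singleton]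
          simp [h]
      · rw [hH, List.take_append_of_le_length h1]
        rcases h6 with ⟨h6, h7, h8, h9⟩ | h6
        · left
          rw [List.take_append_of_le_length (by omega)]
          exact ⟨h6, h7, h8, h9⟩
        · exact Or.inr h6

end

section

/-! ### Uniformly random permutations -/

section Perm

variable {m : ℕ}

/-- Multiplication by a transposition is a bijection, so position `t` may be resampled among the
positions from `t` on. This replaces conditioning on the first `t` positions. -/
theorem sum_perm_mul_swap (F : Equiv.Perm (Fin m) → ℝ) (t : Fin m) :
    ((m : ℝ) - t) * ∑ π, F π =
      ∑ π, ∑ j ∈ Finset.Ici t, F (π * Equiv.swap t j) := by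
  rw [Finset.sum_comm]
  have h : ∀ j, ∑ π, F (π * Equiv.swap t j) = ∑ π, F π := fun j =>
    Equiv.sum_comp (Equiv.mulRight (Equiv.swap t j)) F
  simp only [h, Finset.sum_const, Fin.card_Ici, nsmul_eq_mul]
  rw [Nat.cast_sub t.2.le]

theorem swap_apply_of_lt {t j i : Fin m} (hj : t ≤ j) (hi : i < t) : Equiv.swap t j i = i :=
  Equiv.swap_apply_of_ne_of_ne hi.ne (hi.trans_le hj).ne

/-- The number of permutations for which many of the elements from position `s` on belong to a set
depending only on the first `s` positions, but none of the first `k` of them does. -/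
def missing (A : Equiv.Perm (Fin m) → Fin m → Prop) (s : ℕ) (γ : ℝ) (k : ℕ) :
    Finset (Equiv.Perm (Fin m)) :=
  Finset.univ.filter fun π =>
    γ ≤ (Finset.univ.filter fun i : Fin m => s ≤ i.1 ∧ A π (π i)).card ∧
      ∀ i : Fin m, s ≤ i.1 → i.1 < s + k → ¬ A π (π i)

/-- If the first `k` positions from `s` on avoid the set, at least `γ` of its elements remain among
the `m - s - k` later ones. Resampling position `s + k` then hits one with probability at least `γ /
(m - s - k) ≥ γ / m`. By `hA` the set itself does not change under the resampling. -/
theorem card_missing_succ_le {A : Equiv.Perm (Fin m) → Fin m → Prop} {s : ℕ}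
    (hA : ∀ π, ∀ t j : Fin m, s ≤ t.1 → t ≤ j → A (π * Equiv.swap t j) = A π) {γ : ℝ} (hγ : 0 ≤ γ)
    {k : ℕ} (hk : s + k < m) :
    ((missing A s γ (k + 1)).card : ℝ) ≤ (1 - γ / m) * (missing A s γ k).card := by
  let t : Fin m := ⟨s + k, hk⟩
  have hst : s ≤ t.1 := Nat.le_add_right s k
  have hmt : (0 : ℝ) < m - (t.1 : ℝ) := by
    have : (t.1 : ℝ) < m := by exact_mod_cast hk
    linarith
  have h1 := sum_perm_mul_swap (fun π => if π ∈ missing A s γ (k + 1) then (1 : ℝ) else 0) t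
  have h2 : ∀ π, ∑ j ∈ Finset.Ici t, (if π * Equiv.swap t j ∈ missing A s γ (k + 1) then (1 : ℝ)
      else 0) ≤ if π ∈ missing A s γ k then (m : ℝ) - t.1 - γ else 0 := by
    intro π
    have h3 : ∀ j ∈ Finset.Ici t, π * Equiv.swap t j ∈ missing A s γ (k + 1) →
        π ∈ missing A s γ k ∧ ¬ A π (π j) := by
      intro j hj hmem
      have hj := Finset.mem_Ici.1 hj
      simp only [missing, Finset.mem_filter, Finset.mem_univ, true_and, hA π t j hst hj,
        Equiv.Perm.mul_apply] at hmem ⊢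
      obtain ⟨h4, h5⟩ := hmem
      refine ⟨⟨?_, fun i hi hi' => ?_⟩, ?_⟩
      · refine h4.trans (le_of_eq ?_)
        congr 1
        refine Finset.card_equiv (Equiv.swap t j) fun i => ?_
        simp only [Finset.mem_filter, Finset.mem_univ, true_and]
        refine and_congr_left fun _ => ?_
        by_cases hi : i < t
        · rw [swap_apply_of_lt hj hi]
        · have h6 : s ≤ i.1 := hst.trans (not_lt.1 hi)
          refine iff_of_true h6 ?_
          by_cases h7 : i = t
          · rw [h7, Equiv.swap_apply_left]; exact hst.trans hj
          · by_cases h8 : i = j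
            · rw [h8, Equiv.swap_apply_right]; exact hst
            · rw [Equiv.swap_apply_of_ne_of_ne h7 h8]; exact h6
      · have h6 := h5 i hi (by omega)
        rwa [swap_apply_of_lt hj (show i < t from hi')] at h6
      · have h6 := h5 t hst (show s + k < s + (k + 1) by omega)
        rwa [Equiv.swap_apply_left] at h6
    split_ifs with hπ
    · have h4 : ∑ j ∈ Finset.Ici t, (if π * Equiv.swap t j ∈ missing A s γ (k + 1) then (1 : ℝ)
          else 0) ≤ ∑ j ∈ Finset.Ici t, (1 - if A π (π j) then (1 : ℝ) else 0) := by
        refine Finset.sum_le_sum fun j hj => ?_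
        by_cases h5 : π * Equiv.swap t j ∈ missing A s γ (k + 1)
        · rw [if_pos h5, if_neg (h3 j hj h5).2]; norm_num
        · rw [if_neg h5]; split_ifs <;> norm_num
      refine h4.trans ?_
      rw [Finset.sum_sub_distrib]
      have h5 : (∑ j ∈ Finset.Ici t, (1 : ℝ)) = m - t.1 := by
        simp only [Finset.sum_const, Fin.card_Ici, nsmul_eq_mul, mul_one]
        rw [Nat.cast_sub t.2.le]
      have h6 : γ ≤ ∑ j ∈ Finset.Ici t, (if A π (π j) then (1 : ℝ) else 0) := by
        have h7 := (Finset.mem_filter.1 hπ).2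
        refine h7.1.trans ?_
        rw [Finset.sum_boole]
        refine Nat.cast_le.2 (Finset.card_le_card fun i hi => ?_)
        obtain ⟨h8, h9⟩ := (Finset.mem_filter.1 hi).2
        refine Finset.mem_filter.2 ⟨Finset.mem_Ici.2 ?_, h9⟩
        by_contra h10
        exact h7.2 i h8 (show i < t from not_le.1 h10) h9
      linarith
    · refine Finset.sum_nonpos fun j hj => ?_
      rw [if_neg fun h => hπ (h3 j hj h).1]
  have h3 := h1.le.trans (Finset.sum_le_sum fun π _ => h2 π)
  have hcard : ∀ S : Finset (Equiv.Perm (Fin m)), ∀ x : ℝ,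
      ∑ π, (if π ∈ S then x else 0) = x * S.card := by
    intro S x
    rw [← Finset.sum_filter]
    simp [mul_comm]
  rw [hcard, hcard, one_mul] at h3
  have h4 : ((m : ℝ) - t.1 - γ) ≤ (m - t.1) * (1 - γ / m) := by
    have hm : (0 : ℝ) < m := by
      have : 0 < m := by omega
      exact_mod_cast this
    have h5 : (m - (t.1 : ℝ)) * (γ / m) ≤ γ := by
      rw [← mul_div_assoc, div_le_iff₀ hm]
      have h6 : (0 : ℝ) ≤ t.1 := Nat.cast_nonneg _
      nlinarith
    linarith
  have h5 := h3.trans (mul_le_mul_of_nonneg_right h4 (Nat.cast_nonneg _))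
  rw [mul_assoc] at h5
  exact le_of_mul_le_mul_left h5 hmt

theorem card_missing_le {A : Equiv.Perm (Fin m) → Fin m → Prop} {s : ℕ}
    (hA : ∀ π, ∀ t j : Fin m, s ≤ t.1 → t ≤ j → A (π * Equiv.swap t j) = A π) {γ : ℝ} (hγ : 0 ≤ γ)
    {α : ℕ} (hα : s + α ≤ m) :
    ((missing A s γ α).card : ℝ) ≤ Real.exp (-(γ * α / m)) * (m.factorial : ℝ) := by
  have h1 : ∀ k, s + k ≤ m → ((missing A s γ k).card : ℝ) ≤
      Real.exp (-(γ / m)) ^ k * (m.factorial : ℝ) := by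
    intro k
    induction k with
    | zero =>
      intro _
      rw [pow_zero, one_mul]
      refine Nat.cast_le.2 ((Finset.card_le_univ _).trans ?_)
      rw [Fintype.card_perm, Fintype.card_fin]
    | succ k ih =>
      intro hk
      have h2 := card_missing_succ_le hA hγ (show s + k < m by omega)
      refine h2.trans ?_
      have h3 : 1 - γ / m ≤ Real.exp (-(γ / m)) := by
        have := Real.add_one_le_exp (-(γ / m))
        linarith
      rw [pow_succ', mul_assoc]
      exact mul_le_mul h3 (ih (by omega)) (Nat.cast_nonneg _) (Real.exp_pos _).le
  refine (h1 α hα).trans (le_of_eq ?_)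
  rw [← Real.exp_nat_mul]
  congr 2
  ring

/-- The number of elements of `S` in the first `t` positions. -/
def hits (S : Finset (Fin m)) (t : ℕ) (π : Equiv.Perm (Fin m)) : ℕ :=
  (Finset.univ.filter fun i : Fin m => i.1 < t ∧ π i ∈ S).card

/-- Given the earlier positions, position `t` holds an element of `S` with probability at most
`S.card / (m - t)`, and such an element multiplies the exponential by `e ≤ 1 + 2`. -/
theorem sum_exp_hits_succ_le (S : Finset (Fin m)) {t : ℕ} (ht : t < m) :
    ((m : ℝ) - t) * ∑ π, Real.exp (hits S (t + 1) π) ≤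
      (m - t + 2 * S.card) * ∑ π, Real.exp (hits S t π) := by
  let t' : Fin m := ⟨t, ht⟩
  have h1 := sum_perm_mul_swap (fun π => Real.exp (hits S (t + 1) π)) t'
  refine h1.le.trans ?_
  rw [Finset.mul_sum]
  refine Finset.sum_le_sum fun π _ => ?_
  have h2 : ∀ j ∈ Finset.Ici t', Real.exp (hits S (t + 1) (π * Equiv.swap t' j)) ≤
      (1 + 2 * if π j ∈ S then 1 else 0) * Real.exp (hits S t π) := by
    intro j hj
    have hj := Finset.mem_Ici.1 hj
    have h3 : hits S (t + 1) (π * Equiv.swap t' j) = hits S t π + if π j ∈ S then 1 else 0 := by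
      unfold hits
      have h4 : (Finset.univ.filter fun i : Fin m => i.1 < t + 1 ∧ (π * Equiv.swap t' j) i ∈ S) =
          (Finset.univ.filter fun i : Fin m => i.1 < t ∧ π i ∈ S) ∪
            Finset.univ.filter fun i : Fin m => i = t' ∧ π j ∈ S := by
        ext i
        rw [Finset.mem_union, Finset.mem_filter, Finset.mem_filter, Finset.mem_filter]
        simp only [Finset.mem_univ, true_and, Equiv.Perm.mul_apply]
        by_cases h5 : i = t'
        · subst h5
          rw [Equiv.swap_apply_left]
          simp [t']
        · have h6 : i.1 ≠ t := fun h => h5 (Fin.ext h)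
          constructor
          · rintro ⟨h7, h8⟩
            have h9 : i.1 < t := by omega
            rw [swap_apply_of_lt hj (show i < t' from h9)] at h8
            exact Or.inl ⟨h9, h8⟩
          · rintro (⟨h7, h8⟩ | ⟨h7, -⟩)
            · refine ⟨by omega, ?_⟩
              rwa [swap_apply_of_lt hj (show i < t' from h7)]
            · exact absurd h7 h5
      rw [h4, Finset.card_union_of_disjoint]
      · congr 1
        split_ifs with h5
        · exact Finset.card_eq_one.2 ⟨t', by ext i; simp [h5]⟩
        · simp [h5]
      · rw [Finset.disjoint_left]
        intro i hi hi'
        have h5 := (Finset.mem_filter.1 hi).2.1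
        have h6 := (Finset.mem_filter.1 hi').2.1
        rw [h6] at h5
        exact lt_irrefl _ h5
    rw [h3]
    push_cast
    rw [Real.exp_add, mul_comm]
    refine mul_le_mul_of_nonneg_right ?_ (Real.exp_pos _).le
    split_ifs
    · have := Real.exp_one_lt_d9
      linarith
    · simp
  refine (Finset.sum_le_sum h2).trans ?_
  rw [← Finset.sum_mul]
  refine mul_le_mul_of_nonneg_right ?_ (Real.exp_pos _).le
  rw [Finset.sum_add_distrib, ← Finset.mul_sum]
  have h5 : (∑ j ∈ Finset.Ici t', (1 : ℝ)) = m - t := by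
    simp only [Finset.sum_const, Fin.card_Ici, nsmul_eq_mul, mul_one]
    rw [Nat.cast_sub t'.2.le]
  have h6 : ∑ j ∈ Finset.Ici t', (if π j ∈ S then (1 : ℝ) else 0) ≤ S.card := by
    rw [Finset.sum_boole]
    refine Nat.cast_le.2 (Finset.card_le_card_of_injOn π (fun i hi => (Finset.mem_filter.1 hi).2)
      π.injective.injOn)
  linarith

/-- A tail bound for the number of elements of `S` in the first `L` positions. -/
theorem card_hits_ge_le (S : Finset (Fin m)) {L : ℕ} (hL : L < m) (z : ℝ) :
    ((Finset.univ.filter fun π => z ≤ hits S L π).card : ℝ) ≤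
      Real.exp (2 * S.card * L / (m - L) - z) * (m.factorial : ℝ) := by
  have hmL : (0 : ℝ) < m - (L : ℝ) := by
    have : (L : ℝ) < m := by exact_mod_cast hL
    linarith
  set x : ℝ := 2 * S.card / (m - L) with hx
  have hx0 : 0 ≤ x := by positivity
  have h1 : ∀ t ≤ L, ∑ π, Real.exp (hits S t π) ≤ Real.exp x ^ t * (m.factorial : ℝ) := by
    intro t
    induction t with
    | zero =>
      intro _
      simp [hits, Fintype.card_perm]
    | succ t ih =>
      intro ht
      have htm : t < m := by omega
      have h2 := sum_exp_hits_succ_le S htm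
      have h3 : (0 : ℝ) < m - (t : ℝ) := by
        have : (t : ℝ) < m := by exact_mod_cast htm
        linarith
      have h4 : (m : ℝ) - t + 2 * S.card ≤ (m - t) * Real.exp x := by
        have h5 := Real.add_one_le_exp x
        have h6 : 2 * (S.card : ℝ) ≤ (m - t) * x := by
          rw [hx, ← mul_div_assoc, le_div_iff₀ hmL, mul_comm]
          refine mul_le_mul_of_nonneg_right ?_ (by positivity)
          have : (t : ℝ) ≤ L := by exact_mod_cast (Nat.le_of_succ_le ht)
          linarith
        have h7 := mul_le_mul_of_nonneg_left h5 h3.le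
        linarith
      have h5 : (0 : ℝ) ≤ ∑ π, Real.exp (hits S t π) :=
        Finset.sum_nonneg fun π _ => (Real.exp_pos _).le
      have h6 := h2.trans (mul_le_mul_of_nonneg_right h4 h5)
      rw [mul_assoc] at h6
      refine (le_of_mul_le_mul_left h6 h3).trans ?_
      rw [pow_succ', mul_assoc]
      exact mul_le_mul_of_nonneg_left (ih (by omega)) (Real.exp_pos _).le
  have h2 : ((Finset.univ.filter fun π => z ≤ hits S L π).card : ℝ) * Real.exp z ≤
      ∑ π, Real.exp (hits S L π) := by
    rw [← nsmul_eq_mul, ← Finset.sum_const]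
    refine (Finset.sum_le_sum fun π hπ => ?_).trans (Finset.sum_le_sum_of_subset_of_nonneg
      (Finset.filter_subset _ _) fun π _ _ => (Real.exp_pos _).le)
    exact Real.exp_le_exp.2 (Finset.mem_filter.1 hπ).2
  have h3 := h2.trans (h1 L le_rfl)
  rw [Real.exp_sub, div_mul_eq_mul_div, le_div_iff₀ (Real.exp_pos _)]
  refine h3.trans (le_of_eq ?_)
  rw [← Real.exp_nat_mul]
  congr 2
  rw [hx]
  ring

end Perm

end

section

variable {V : Type*} {b : V → ℕ} {p : Params}

/-! ### Streams -/

section Stream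

variable {m : ℕ} (e : Fin m → Edge V)

theorem coe_stream (π : Equiv.Perm (Fin m)) :
    (stream e π : Multiset (Edge V)) = graph e := by
  rw [stream, graph, ← Fin.univ_val_map, ← Fin.univ_val_map]
  have h : (Finset.univ : Finset (Fin m)).val.map π = Finset.univ.val := by
    have := congrArg Finset.val (Finset.map_univ_equiv π)
    simp
  conv_rhs => rw [← h, Multiset.map_map]
  rfl

theorem exists_index_set {M : Multiset (Edge V)} (hM : M ≤ graph e) :
    ∃ S : Finset (Fin m), M = S.val.map e := by
  rw [graph, ← Fin.univ_val_map] at hM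
  obtain ⟨s, hs, rfl⟩ : ∃ s ≤ (Finset.univ : Finset (Fin m)).val, M = s.map e := by
    generalize (Finset.univ : Finset (Fin m)).val = u at hM
    induction u using Multiset.induction_on generalizing M with
    | empty => exact ⟨0, le_rfl, by simpa using hM⟩
    | cons a u ih =>
      rw [Multiset.map_cons] at hM
      by_cases ha : e a ∈ M
      · obtain ⟨M', rfl⟩ := Multiset.exists_cons_of_mem ha
        obtain ⟨s, hs, rfl⟩ := ih ((Multiset.cons_le_cons_iff _).1 hM)
        exact ⟨a ::ₘ s, Multiset.cons_le_cons a hs, by simp⟩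
      · obtain ⟨s, hs, rfl⟩ := ih ((Multiset.le_cons_of_notMem ha).1 hM)
        exact ⟨s, hs.trans (Multiset.le_cons_self _ _), rfl⟩
  exact ⟨⟨s, Multiset.nodup_of_le hs Finset.univ.nodup⟩, rfl⟩

theorem stream_eq (π : Equiv.Perm (Fin m)) :
    stream e π = ((List.finRange m).map π).map e := by
  rw [stream, List.ofFn_eq_map, List.map_map]
  rfl

/-- The edges of `S` in the positions from `t` on form a part of the stream from `t` on. -/
theorem late_le_drop (π : Equiv.Perm (Fin m)) (S : Finset (Fin m)) (t : ℕ) :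
    (S.filter fun x => t ≤ (π.symm x).1).val.map e ≤ ((stream e π).drop t : List (Edge V)) := by
  rw [stream_eq, ← List.map_drop, ← Multiset.map_coe]
  refine Multiset.map_le_map ((Multiset.le_iff_subset (Finset.nodup _)).2 fun x hx => ?_)
  have hx2 := (Finset.mem_filter.1 hx).2
  rw [Multiset.mem_coe, List.mem_drop_iff_getElem]
  refine ⟨(π.symm x).1 - t, ?_, ?_⟩
  · simp only [List.length_map, List.length_finRange]
    have := (π.symm x).2
    omega
  · simp only [List.getElem_map, List.getElem_finRange]
    have : t + ((π.symm x).1 - t) = (π.symm x).1 := by omega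
    simp [this]

theorem card_early_le (π : Equiv.Perm (Fin m)) (S : Finset (Fin m)) {t L : ℕ} (h : t ≤ L) :
    (S.filter fun x => ¬ t ≤ (π.symm x).1).card ≤ hits S L π := by
  refine Finset.card_le_card_of_injOn π.symm (fun x hx => ?_) π.symm.injective.injOn
  obtain ⟨h1, h2⟩ := Finset.mem_filter.1 hx
  refine Finset.mem_filter.2 ⟨Finset.mem_univ _, by omega, ?_⟩
  simpa using h1

/-- The prefix does not see a swap of later positions, so anything computed from it satisfies the
invariance required by `card_missing_le`. -/
theorem take_stream_mul_swap (π : Equiv.Perm (Fin m)) {s : ℕ} {t j : Fin m} (hs : s ≤ t.1)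
    (hj : t ≤ j) : (stream e (π * Equiv.swap t j)).take s = (stream e π).take s := by
  refine List.ext_getElem (by simp [stream]) fun i h1 h2 => ?_
  simp only [stream, List.getElem_take, List.getElem_ofFn, Equiv.Perm.mul_apply]
  rw [swap_apply_of_lt hj]
  have h3 : i < s := by
    have := List.length_take (i := s) (l := stream e π)
    omega
  exact Fin.lt_def.2 (lt_of_lt_of_le h3 hs)

end Stream

/-! ### The quality of the result -/

theorem output_of_run (c : Choices b p) (W n m : ℕ) (hb : ∀ v, 1 ≤ b v) (l : List (Edge V))
    (hl : ∀ e ∈ l, e.src ≠ e.dst) :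
    output c (run c W n m l) ≤ (l : Multiset (Edge V)) ∧
      IsBMatching b (output c (run c W n m l)) := by
  unfold output
  rcases hR : (run c W n m l).R with _ | R
  · have h := c.best_spec ((run c W n m l).H + (run c W n m l).X)
    exact ⟨h.1.trans (run_stored c W n m hb l).1, h.2.1⟩
  · have h := c.best_spec R
    obtain ⟨-, -, D, hD, -⟩ := (run_relevant c W n m hb l hl).1 R hR
    refine ⟨h.1.trans ?_, h.2.1⟩
    rw [hD]
    exact Multiset.le_add_right _ _

/-- If only irrelevant edges are missing from `R`, then `R` contains a `b`-matching of maximum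
weight. -/
theorem weight_le_best_of_irrelevant (c : Choices b p) {W : ℕ} {R D M : Multiset (Edge V)}
    (hD : ∀ e ∈ D, Irrelevant b R e) (hM : M ≤ R + D) (hMb : IsBMatching b M)
    (hv : ∀ e ∈ M, e.Valid W) : weight M ≤ weight (c.best R) := by
  have h1 : M ∩ R + (M - R) = M := by rw [add_comm, Multiset.sub_add_inter]
  have h2 : M - R ≤ D := by
    rw [Multiset.sub_le_iff_le_add, add_comm]; exact hM
  obtain ⟨M₃, h3, h4, h5⟩ := exists_replacement (R := R) (M - R) (M ∩ R) (M ∩ R)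
    (fun e he => hv e (Multiset.mem_of_le (Multiset.sub_le_self _ _) he))
    (Multiset.inter_le_right) le_rfl (by rwa [h1])
    (fun e he => hD e (Multiset.mem_of_le h2 he))
  have h6 := (c.best_spec R).2.2 _ h3 h4
  rw [← h1, weight_add]
  rw [weight_add] at h6
  omega

theorem load_le_of_isBMatching {W : ℕ} (hb : ∀ v, 1 ≤ b v) {M : Multiset (Edge V)}
    (hM : IsBMatching b M) (hv : ∀ e ∈ M, e.Valid W) (e : Edge V) : load b M e ≤ 2 * W := by
  have h : ∀ v, (wdeg M v : ℝ) / b v ≤ W := by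
    intro v
    have hbv : (0 : ℝ) < b v := by exact_mod_cast hb v
    rw [div_le_iff₀ hbv]
    have h1 := weight_le_mul_card (W := W) (H := star M v)
      fun f hf => hv f (Multiset.mem_of_mem_filter hf)
    exact_mod_cast h1.trans (Nat.mul_le_mul_left W (hM v))
  have h1 := h e.src
  have h2 := h e.dst
  unfold load
  linarith

theorem load_add (H K : Multiset (Edge V)) (e : Edge V) :
    load b (H + K) e = load b H e + load b K e := by
  unfold load
  simp only [wdeg_add]
  push_cast
  ring

variable [Fintype V]

/-- A large multigraph without superfluous parallel edges contains a large `b`-matching. -/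
theorem exists_isBMatching_of_bounded {W : ℕ} {R : Multiset (Edge V)} (hR : ∀ e ∈ R, e.Valid W)
    (hbd : Bounded b R) :
    ∃ T ≤ R, IsBMatching b T ∧ R.card ≤ (2 * Fintype.card V + 1) * T.card := by
  refine exists_isBMatching_card_le hR _ fun v => ?_
  have h1 : ∀ S : Multiset (Edge V), (∀ e ∈ S, e.Valid W) →
      (star S v).card ≤ ∑ x, if v ≠ x then (between S v x).card else 0 := by
    intro S
    induction S using Multiset.induction_on with
    | empty => simp
    | cons e S ih =>
      intro hS
      have h2 := ih fun f hf => hS f (Multiset.mem_cons_of_mem hf)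
      have he := (hS e (Multiset.mem_cons_self e S)).1
      rw [star_cons, Multiset.card_add]
      have hmono : ∀ x, (if v ≠ x then (between S v x).card else 0) ≤
          if v ≠ x then (between (e ::ₘ S) v x).card else 0 := by
        intro x
        rw [between_cons]
        split_ifs <;> simp
      by_cases hev : e.Inc v
      · rw [if_pos hev, Multiset.card_singleton]
        obtain ⟨x, hx, hvx⟩ : ∃ x, e.Inc x ∧ v ≠ x := by
          rcases hev with h | h
          · exact ⟨e.dst, e.inc_dst, fun h' => he (h.trans h')⟩
          · exact ⟨e.src, e.inc_src, fun h' => he (h'.symm.trans h.symm)⟩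
        have h3 : ∑ x, (if v ≠ x then (between S v x).card else 0) <
            ∑ x, if v ≠ x then (between (e ::ₘ S) v x).card else 0 := by
          refine Finset.sum_lt_sum (fun x _ => hmono x) ⟨x, Finset.mem_univ x, ?_⟩
          rw [if_pos hvx, if_pos hvx, between_cons, if_pos ⟨hev, hx⟩]
          simp
        omega
      · rw [if_neg hev, Multiset.card_zero, zero_add]
        exact h2.trans (Finset.sum_le_sum fun x _ => hmono x)
  refine (h1 R hR).trans ?_
  rw [Fintype.card, ← smul_eq_mul]
  refine Finset.sum_le_card_nsmul _ _ _ fun x _ => ?_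
  split_ifs with h
  · exact (hbd v x h).trans (min_le_left _ _)
  · exact Nat.zero_le _

/-- The subgraph `H`, with the underfull edges among those of `L`, contains a good approximation of
every `b`-matching of `L`. -/
theorem weight_le_best_of_underfull (c : Choices b p) (hb : ∀ v, 1 ≤ b v) {W : ℕ} (hW : 1 ≤ W)
    {H X L M : Multiset (Edge V)} (hH : ∀ e ∈ H, e.Valid W) (hbd : Bounded b H)
    (hA : ∀ e ∈ H, load b H e ≤ p.β * e.wt) (hL : ∀ e ∈ L, e.Valid W)
    (hX : L.filter (fun e => Accepts b p H e) ≤ X) (hM : M ≤ L) (hMb : IsBMatching b M)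
    {l : ℝ} (hl : 0 < l) (hl1 : l ≤ 1) (hβ : 16 * (W : ℝ) ^ 4 ≤ l ^ 4 * p.β)
    (hβm : (1 - l) * p.β ≤ p.βm - 2 * W) :
    (1 - 15 * l) * weight M ≤ (2 - 1 / (2 * W) + l) * weight (c.best (H + X)) := by
  have hMv : ∀ e ∈ M, e.Valid W := fun e he => hL e (Multiset.mem_of_le hM he)
  -- Three kinds of edges: accepted ones, stored in `X`; rejected ones of large load; and rejected
  -- ones of small load, which must be irrelevant for `H`.
  set P₁ := M.filter fun e => Accepts b p H e with hP₁
  set P₀ := M.filter fun e => ¬ Accepts b p H e with hP₀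
  set P₂ := P₀.filter fun e => (p.βm : ℝ) * e.wt ≤ load b H e with hP₂
  set P₃ := P₀.filter fun e => ¬ (p.βm : ℝ) * e.wt ≤ load b H e with hP₃
  have h01 : P₁ + P₀ = M := Multiset.filter_add_not _ M
  have h23 : P₂ + P₃ = P₀ := Multiset.filter_add_not _ P₀
  have hsplit : P₁ + P₂ + P₃ = M := by rw [add_assoc, h23, h01]
  have hmem : ∀ e ∈ P₀, e ∈ M := fun e he => Multiset.mem_of_mem_filter he
  -- The irrelevant edges are exchanged for `M₃ ≤ H`. As `M₃` is used on the side of `N`, it is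
  -- taken out of `H`. Being a `b`-matching, it contributes at most `2 * W` to any load, which `hβm`
  -- allows for.
  obtain ⟨M₃, h3, h4, h5⟩ := exists_replacement (R := H) P₃ (P₁ + P₂) 0
    (fun e he => hMv e (hmem e (Multiset.mem_of_mem_filter he))) (Multiset.zero_le _)
    (Multiset.zero_le _) (by rwa [hsplit]) (by
      intro e he
      obtain ⟨h6, h7⟩ := Multiset.mem_filter.1 he
      have h8 := (Multiset.mem_filter.1 h6).2
      by_contra h9
      exact h8 ⟨not_le.1 h7, h9⟩)
  rw [zero_add] at h3
  obtain ⟨H₀, rfl⟩ := Multiset.le_iff_exists_add.1 h3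
  have hM₃v : ∀ e ∈ M₃, e.Valid W := fun e he => hH e (Multiset.mem_add.2 (Or.inl he))
  have hM₃b : IsBMatching b M₃ := h4.mono (Multiset.le_add_left _ _)
  have hle : H₀ ≤ M₃ + H₀ := Multiset.le_add_left _ _
  have hcomm : P₁ + M₃ + P₂ = P₁ + P₂ + M₃ := by rw [add_right_comm]
  obtain ⟨T, hT, hTb, hTw⟩ := exists_heavy_isBMatching hb hW (H := H₀) (N := P₁ + M₃) (O := P₂)
    (β := p.β) (fun e he => hH e (Multiset.mem_of_le hle he))
    (fun e he => (Multiset.mem_add.1 he).elim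
      (fun h => hMv e (Multiset.mem_of_mem_filter h)) fun h => hM₃v e h)
    (fun e he => hMv e (hmem e (Multiset.mem_of_mem_filter he))) hl hl1 hβ
    (fun u x hux => ((hbd.mono hle) u x hux).trans (min_le_right _ _))
    (fun e he => (load_mono hle e).trans (hA e (Multiset.mem_of_le hle he)))
    (fun e he => by
      obtain ⟨h6, h7⟩ := Multiset.mem_filter.1 he
      rw [load_add] at h7
      have h8 := load_le_of_isBMatching hb hM₃b hM₃v e
      have h9 : (1 : ℝ) ≤ e.wt := by exact_mod_cast (hMv e (hmem e h6)).2.1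
      have h10 : (1 - l) * p.β * e.wt ≤ (p.βm - 2 * W) * e.wt :=
        mul_le_mul_of_nonneg_right hβm (by linarith)
      have h11 : (0 : ℝ) ≤ W := Nat.cast_nonneg W
      nlinarith)
    (by rw [hcomm]; exact h4)
  have hTle : T ≤ M₃ + H₀ + X := by
    refine hT.trans ?_
    have : H₀ + (P₁ + M₃) = M₃ + H₀ + P₁ := by
      rw [add_comm P₁, ← add_assoc, add_comm H₀]
    rw [this]
    exact add_le_add_right ((Multiset.filter_le_filter _ hM).trans hX) _
  have h6 := (c.best_spec (M₃ + H₀ + X)).2.2 T hTle hTb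
  have h7 : weight M ≤ weight (P₁ + M₃ + P₂) := by
    rw [hcomm, ← hsplit, weight_add, weight_add (P₁ + P₂)]
    omega
  by_cases h15 : 0 ≤ 1 - 15 * l
  · have h8 : (weight M : ℝ) ≤ weight (P₁ + M₃ + P₂) := by exact_mod_cast h7
    have h9 : (weight T : ℝ) ≤ weight (c.best (M₃ + H₀ + X)) := by exact_mod_cast h6
    have h10 : 1 / (2 * (W : ℝ)) ≤ 1 := by
      have : (1 : ℝ) ≤ W := by exact_mod_cast hW
      rw [div_le_one (by positivity)]; linarith
    exact (mul_le_mul_of_nonneg_left h8 h15).trans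
      (hTw.trans (mul_le_mul_of_nonneg_left h9 (by linarith)))
  · refine (mul_nonpos_of_nonpos_of_nonneg (not_le.1 h15).le (Nat.cast_nonneg _)).trans ?_
    have h10 : 1 / (2 * (W : ℝ)) ≤ 1 := by
      have : (1 : ℝ) ≤ W := by exact_mod_cast hW
      rw [div_le_one (by positivity)]; linarith
    exact mul_nonneg (by linarith) (Nat.cast_nonneg _)

end

section

/-! ### The parameters -/

/-- The inverse of the parameter `eps`. -/
def invEps (W : ℕ) (x : ℝ) : ℝ := 100 * W * (1 + x)

/-- The degree bound, before rounding. -/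
def degreeBound (W : ℕ) (x : ℝ) : ℝ := 16 * (W : ℝ) ^ 4 * (100 * W * invEps W x) ^ 4

/-- Parameters for which the algorithm has the required quality. -/
def params (W : ℕ) (x : ℝ) : Params where
  eps := (invEps W x)⁻¹
  β := ⌈degreeBound W x⌉₊
  βm := ⌈degreeBound W x⌉₊ - 4

section Params

variable {W : ℕ} {x : ℝ}

theorem le_invEps (W : ℕ) (hx : 0 ≤ x) : 100 * (W : ℝ) ≤ invEps W x := by
  have : (0 : ℝ) ≤ W := Nat.cast_nonneg W
  unfold invEps
  nlinarith [mul_nonneg this hx]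

theorem params_eps_div :
    (params W x).eps / (100 * W) = (100 * W * invEps W x)⁻¹ := by
  rw [params, mul_inv, div_eq_mul_inv, mul_comm]

/-- The constant 18 covers the linear terms in the conditions on `β⁻ = β - 4`: `14 * W + 4 ≤ 18 *
W`. -/
theorem le_mul_params_β (hW : 1 ≤ W) (hx : 0 ≤ x) :
    18 * (W : ℝ) ≤ (params W x).eps / (100 * W) * (params W x).β := by
  have hW' : (1 : ℝ) ≤ W := by exact_mod_cast hW
  have h1 := le_invEps W hx
  rw [params_eps_div]
  set L := 100 * (W : ℝ) * invEps W x with hL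
  have hL1 : 2 ≤ L := by nlinarith
  have h2 : 16 * (W : ℝ) ^ 4 * L ^ 4 ≤ (params W x).β := Nat.le_ceil _
  rw [inv_mul_eq_div, le_div_iff₀ (by linarith)]
  refine le_trans ?_ h2
  have h3 : (W : ℝ) * L * 18 ≤ (W : ℝ) * L * (16 * ((W : ℝ) ^ 3 * L ^ 3)) := by
    refine mul_le_mul_of_nonneg_left ?_ (by positivity)
    have h4 : (1 : ℝ) ≤ (W : ℝ) ^ 3 := one_le_pow₀ hW'
    have h5 : (2 : ℝ) ^ 3 ≤ L ^ 3 := by gcongr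
    nlinarith
  nlinarith

theorem params_βm (hW : 1 ≤ W) (hx : 0 ≤ x) : (params W x).βm + 4 = (params W x).β := by
  have hW' : (1 : ℝ) ≤ W := by exact_mod_cast hW
  have h1 := le_mul_params_β hW hx
  have h2 : (params W x).eps / (100 * W) ≤ 1 := by
    have := le_invEps W hx
    rw [params_eps_div]
    exact inv_le_one_of_one_le₀ (by nlinarith)
  have h3 : (4 : ℝ) ≤ (params W x).β := by
    have : (0 : ℝ) ≤ (params W x).β := Nat.cast_nonneg _
    nlinarith
  have h4 : 4 ≤ (params W x).β := by exact_mod_cast h3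
  exact Nat.sub_add_cancel h4

theorem params_βm_cast (hW : 1 ≤ W) (hx : 0 ≤ x) :
    ((params W x).βm : ℝ) = (params W x).β - 4 := by
  rw [← params_βm hW hx]
  push_cast
  ring

theorem params_eps_pos (hW : 1 ≤ W) (hx : 0 ≤ x) : 0 < (params W x).eps := by
  have hW' : (1 : ℝ) ≤ W := by exact_mod_cast hW
  exact inv_pos.2 (by linarith [le_invEps W hx])

theorem params_eps_le (hW : 1 ≤ W) (hx : 0 ≤ x) : (params W x).eps ≤ 1 / 100 := by
  have hW' : (1 : ℝ) ≤ W := by exact_mod_cast hW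
  rw [one_div]
  exact inv_anti₀ (by norm_num) (by linarith [le_invEps W hx])

theorem params_eps_mul (hW : 1 ≤ W) (hx : 0 ≤ x) : (params W x).eps * invEps W x = 1 := by
  have hW' : (1 : ℝ) ≤ W := by exact_mod_cast hW
  exact inv_mul_cancel₀ (by linarith [le_invEps W hx])

theorem params_β_le (hW : 1 ≤ W) (hx : 0 ≤ x) : ((params W x).β : ℝ) ≤ degreeBound W x + 1 := by
  refine (Nat.ceil_lt_add_one ?_).le
  have := le_invEps W hx
  unfold degreeBound
  positivity

theorem le_pow_mul_params_β (hW : 1 ≤ W) (hx : 0 ≤ x) :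
    16 * (W : ℝ) ^ 4 ≤ ((params W x).eps / (100 * W)) ^ 4 * (params W x).β := by
  have hW' : (1 : ℝ) ≤ W := by exact_mod_cast hW
  have h1 := le_invEps W hx
  rw [params_eps_div]
  have h2 : degreeBound W x ≤ (params W x).β := Nat.le_ceil _
  unfold degreeBound at h2
  set L := 100 * (W : ℝ) * invEps W x with hL
  have hL1 : 0 < L := by nlinarith
  rw [inv_pow, inv_mul_eq_div, le_div_iff₀ (by positivity)]
  exact h2

theorem params_βm_ge (hW : 1 ≤ W) (hx : 0 ≤ x) :
    (1 - (params W x).eps / (100 * W)) * (params W x).β ≤ (params W x).βm - 2 * W := by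
  have hW' : (1 : ℝ) ≤ W := by exact_mod_cast hW
  have h1 := le_mul_params_β hW hx
  rw [params_βm_cast hW hx]
  linarith

/-- For the logarithmic condition put `y = β + 8 * W`. The size of `β` gives `√y ≥ 4 * W ^ 2 * λ⁻²`,
and `Real.log y ≤ 2 * √y`. -/
theorem params_admissible (hW : 1 ≤ W) (hx : 0 ≤ x) : (params W x).Admissible W := by
  have hW' : (1 : ℝ) ≤ W := by exact_mod_cast hW
  have h0 := params_eps_le hW hx
  have h1 := params_eps_pos hW hx
  have h2 := le_mul_params_β hW hx
  have h3 := params_βm hW hx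
  refine ⟨h1, by linarith, by omega, ?_, ?_⟩
  · have h4 := le_pow_mul_params_β hW hx
    set l := (params W x).eps / (100 * W)
    have hl : 0 < l := div_pos h1 (by linarith)
    have h5 : (4 * (W : ℝ) ^ 2 * (l ^ 2)⁻¹) ^ 2 ≤ (params W x).β + 8 * W := by
      have h6 : (4 * (W : ℝ) ^ 2 * (l ^ 2)⁻¹) ^ 2 = 16 * (W : ℝ) ^ 4 / l ^ 4 := by
        field_simp
        norm_num
      rw [h6, div_le_iff₀ (by positivity)]
      have h7 : 0 ≤ 8 * (W : ℝ) * l ^ 4 := by positivity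
      nlinarith
    set y : ℝ := (params W x).β + 8 * W with hy
    have hy1 : 8 ≤ y := by
      have : (0 : ℝ) ≤ (params W x).β := Nat.cast_nonneg _
      linarith
    have h6 : 4 * (W : ℝ) ^ 2 * (l ^ 2)⁻¹ ≤ √y := Real.le_sqrt_of_sq_le h5
    have h7 : Real.log y ≤ 2 * √y := by
      have h8 := Real.log_le_sub_one_of_pos (Real.sqrt_pos.2 (by linarith : 0 < y))
      rw [Real.log_sqrt (by linarith)] at h8
      linarith
    rw [le_div_iff₀ (Real.log_pos (by linarith))]
    have h8 : 0 ≤ Real.log y := Real.log_nonneg (by linarith)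
    calc 2 * (W : ℝ) ^ 2 * (l ^ 2)⁻¹ * Real.log y ≤ √y / 2 * (2 * √y) :=
          mul_le_mul (by linarith) h7 h8 (by positivity)
      _ = y := by
        rw [show √y / 2 * (2 * √y) = √y * √y by ring]
        exact Real.mul_self_sqrt (by linarith)
  · rw [params_βm_cast hW hx]
    have h4 : 0 < (params W x).eps / (100 * W) := div_pos h1 (by linarith)
    nlinarith

/-- The losses add up to less than `ε`. -/
theorem ratio_le {ε : ℝ} (hε : 0 < ε) (hW : 1 ≤ W) {w w' : ℝ} (hw : 0 ≤ w) (hw' : 0 ≤ w')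
    (h : (1 - 15 * ((params W (1 / ε)).eps / (100 * W))) *
        ((1 - 16 * W * (params W (1 / ε)).eps) * w) ≤
      (2 - 1 / (2 * W) + (params W (1 / ε)).eps / (100 * W)) * w') :
    w ≤ (2 - 1 / (2 * W) + ε) * w' := by
  have hW' : (1 : ℝ) ≤ W := by exact_mod_cast hW
  have hx : (0 : ℝ) ≤ 1 / ε := by positivity
  have h1 := params_eps_pos hW hx
  have h2 := params_eps_mul hW hx
  set z := (params W (1 / ε)).eps
  obtain ⟨y, hy⟩ : ∃ y, y = W * z := ⟨_, rfl⟩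
  have hy0 : 0 < y := by rw [hy]; positivity
  have h3 : y * (100 * (1 + ε)) = ε := by
    have h4 : z * (100 * W * (1 + 1 / ε)) = 1 := h2
    field_simp at h4
    rw [hy]
    linarith
  have hl : z / (100 * W) ≤ y := by
    rw [hy, div_le_iff₀ (by positivity)]
    nlinarith [mul_pos (show (0:ℝ) < W by linarith) h1]
  have hl0 : 0 < z / (100 * W) := by positivity
  set l := z / (100 * W)
  have hr : 1 / (2 * (W : ℝ)) ≤ 1 / 2 := by
    rw [div_le_div_iff₀ (by positivity) (by norm_num)]
    linarith
  have hr0 : 0 < 1 / (2 * (W : ℝ)) := by positivity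
  set r := 2 - 1 / (2 * (W : ℝ)) with hrdef
  have hy1 : y < 1 / 100 := by nlinarith
  -- The loss `31 * y` combines `15 * l ≤ 15 * y` from duality and `16 * W * z = 16 * y` from the
  -- early edges.
  have h5 : (1 - 31 * y) * w ≤ (r + y) * w' := by
    have h6 : (1 - 31 * y) * w ≤ (1 - 15 * l) * ((1 - 16 * W * z) * w) := by
      rw [← mul_assoc]
      refine mul_le_mul_of_nonneg_right ?_ hw
      rw [show 16 * (W : ℝ) * z = 16 * y by rw [hy]; ring]
      nlinarith [mul_pos hl0 hy0]
    exact h6.trans (h.trans (mul_le_mul_of_nonneg_right (by linarith) hw'))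
  -- As `r ≤ 2`, this needs `y * (63 + 31 * ε) ≤ ε`, and `ε = y * (100 * (1 + ε))` by the choice of
  -- `invEps`.
  have h7 : r + y ≤ (1 - 31 * y) * (r + ε) := by
    have h8 : y * (63 + 31 * ε) ≤ y * (100 * (1 + ε)) :=
      mul_le_mul_of_nonneg_left (by linarith) hy0.le
    nlinarith
  have h9 : (1 - 31 * y) * w ≤ (1 - 31 * y) * ((r + ε) * w') := by
    rw [← mul_assoc]
    exact h5.trans (mul_le_mul_of_nonneg_right h7 hw')
  exact le_of_mul_le_mul_left h9 (by linarith)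

end Params

end

section

variable {V : Type*} {b : V → ℕ} {p : Params}

/-! ### The length of the first phase -/

theorem logb_pos {m : ℕ} (hm : 2 ≤ m) : 1 ≤ Real.logb 2 m := by
  have : (2 : ℝ) ≤ m := by exact_mod_cast hm
  rw [Real.le_logb_iff_rpow_le (by norm_num) (by linarith)]
  simpa using this

theorem epochLength_eq (p : Params) (W m i : ℕ) : epochLength p W m i =
    ⌊p.eps * m / (Real.logb 2 m * (epochCount p W i : ℝ))⌋₊ := by
  unfold epochLength epochCount
  push_cast
  rfl

/-- Each level reads at most `eps * m / log₂ m` edges, and there are `Nat.log 2 m + 1 ≤ 2 * log₂ m`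
levels. -/
theorem elapsed_le (hp : 0 < p.eps) (W : ℕ) {m : ℕ} (hm : 2 ≤ m) :
    (elapsed p W m (Nat.log 2 m + 1) : ℝ) ≤ 2 * p.eps * m := by
  have h1 := logb_pos hm
  have h2 : (Nat.log 2 m : ℝ) ≤ Real.logb 2 m := by exact_mod_cast Real.natLog_le_logb m 2
  have h3 : ∀ i ∈ Finset.range (Nat.log 2 m + 1),
      ((epochCount p W i * epochLength p W m i : ℕ) : ℝ) ≤ p.eps * m / Real.logb 2 m := by
    intro i _
    have h4 : (0 : ℝ) < epochCount p W i := by exact_mod_cast epochCount_pos p W i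
    have h5 : (epochLength p W m i : ℝ) ≤
        p.eps * m / (Real.logb 2 m * (epochCount p W i : ℝ)) := by
      rw [epochLength_eq]
      exact Nat.floor_le (by positivity)
    push_cast
    calc (epochCount p W i : ℝ) * epochLength p W m i
        ≤ epochCount p W i * (p.eps * m / (Real.logb 2 m * (epochCount p W i : ℝ))) := by gcongr
      _ = _ := by field_simp
  unfold elapsed
  push_cast
  push_cast at h3
  refine (Finset.sum_le_sum h3).trans ?_
  rw [Finset.sum_const, Finset.card_range, nsmul_eq_mul, mul_div_assoc', div_le_iff₀ (by linarith)]
  have h6 : 0 ≤ p.eps * m := by positivity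
  push_cast
  nlinarith

/-! ### The approximation -/

variable [Fintype V]

/-- If the relevant edges are too many to be kept, then all `b`-matchings of maximum weight are
large. -/
theorem log_le_mul_card [Nonempty V] (hp : 0 < p.eps) (hp1 : p.eps ≤ 1) {W : ℕ} (hW : 1 ≤ W)
    {m : ℕ} {G R M : Multiset (Edge V)} (hG : ∀ e ∈ G, e.Valid W) (hR : R ≤ G)
    (hbd : Bounded b R) (hcard : auxLimit p W (Fintype.card V) m ≤ R.card)
    (hM : IsMaxWeightBMatching b G M) : Real.log m ≤ p.eps * M.card := by
  obtain ⟨T, hT, hTb, hTc⟩ :=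
    exists_isBMatching_of_bounded (fun e he => hG e (Multiset.mem_of_le hR he)) hbd
  have h1 := card_le_weight fun e he => hG e (Multiset.mem_of_le (hT.trans hR) he)
  have h2 := hM.2.2 T (hT.trans hR) hTb
  have h3 := weight_le_mul_card fun e he => hG e (Multiset.mem_of_le hM.1 he)
  have h4 : T.card ≤ W * M.card := h1.trans (h2.trans h3)
  have hn : 1 ≤ Fintype.card V := Fintype.card_pos
  have h5 : R.card ≤ 3 * Fintype.card V * (W * M.card) :=
    hTc.trans (Nat.mul_le_mul (by omega) h4)
  have h6 : (R.card : ℝ) ≤ 3 * Fintype.card V * (W * M.card) := by exact_mod_cast h5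
  have hn' : (1 : ℝ) ≤ Fintype.card V := by exact_mod_cast hn
  have hW' : (1 : ℝ) ≤ W := by exact_mod_cast hW
  have h7 := hcard.trans h6
  have hlog : 0 ≤ Real.log m := Real.log_natCast_nonneg m
  unfold auxLimit at h7
  have h8 : 3 * (Fintype.card V : ℝ) * W * (W * Real.log m / p.eps ^ 2) ≤
      3 * Fintype.card V * W * M.card := by
    refine le_trans (le_of_eq ?_) (h7.trans (le_of_eq ?_))
    · field_simp
    · ring
  have h9 := le_of_mul_le_mul_left h8 (by positivity)
  rw [div_le_iff₀ (by positivity)] at h9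
  have h10 : (M.card : ℝ) * p.eps ^ 2 ≤ p.eps * M.card := by
    have : (0 : ℝ) ≤ M.card := Nat.cast_nonneg _
    nlinarith [mul_nonneg hp.le this]
  nlinarith

/-- The first phase is over when the stream ends. -/
theorem exists_endedAt (c : Choices b p) (W : ℕ) {n m : ℕ} (hb : ∀ v, 1 ≤ b v)
    (hp : p.βm + 4 = p.β) {q : List (Edge V)} (hq : ∀ e ∈ q, e.Valid W)
    (hlen : elapsed p W m (Nat.log 2 m + 1) < q.length) : ∃ t, EndedAt c W n m q t := by
  have h := phaseInv_run c W n m hb hp q hq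
  rcases hph : (run c W n m q).phase with ⟨i, j, k, found⟩ | _
  · rw [hph] at h
    obtain ⟨h1, h2, h3, h4, -⟩ := h
    have h5 := elapsed_add_le p W m h1 (Nat.succ_le_of_lt h3)
    rw [Nat.succ_mul] at h5
    omega
  · rwa [hph] at h

/-- If few edges of the `b`-matching `M` come early, then `H` and `X` contain a `b`-matching of
large weight. -/
theorem weight_le_best_of_hits (c : Choices b p) (hb : ∀ v, 1 ≤ b v) {W : ℕ} (hW : 1 ≤ W)
    {n m : ℕ} (hm : 2 ≤ m) (hp : p.βm + 4 = p.β) (hp0 : 0 < p.eps) (hp1 : p.eps < 1 / 2)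
    (e : Fin m → Edge V) (he : ∀ i, (e i).Valid W) (π : Equiv.Perm (Fin m)) (S : Finset (Fin m))
    (hMb : IsBMatching b (S.val.map e))
    (hS : (hits S ⌊2 * p.eps * m⌋₊ π : ℝ) ≤ 16 * p.eps * S.card)
    {l : ℝ} (hl : 0 < l) (hl1 : 15 * l ≤ 1) (hβ : 16 * (W : ℝ) ^ 4 ≤ l ^ 4 * p.β)
    (hβm : (1 - l) * p.β ≤ p.βm - 2 * W) :
    (1 - 15 * l) * ((1 - 16 * W * p.eps) * weight (S.val.map e)) ≤
      (2 - 1 / (2 * W) + l) *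
        weight (c.best ((run c W n m (stream e π)).H + (run c W n m (stream e π)).X)) := by
  have hq : ∀ f ∈ stream e π, f.Valid W := by
    intro f hf
    obtain ⟨i, rfl⟩ := (List.mem_ofFn' _ _).1 hf
    exact he _
  have hm' : (2 : ℝ) ≤ m := by exact_mod_cast hm
  have h1 := elapsed_le hp0 W hm
  have h2 : elapsed p W m (Nat.log 2 m + 1) < (stream e π).length := by
    rw [stream, List.length_ofFn]
    have : 2 * p.eps * m < m := by nlinarith
    exact_mod_cast h1.trans_lt this
  obtain ⟨t, ht⟩ := exists_endedAt c W (n := n) hb hp hq h2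
  have htL : t ≤ ⌊2 * p.eps * m⌋₊ := ht.le_elapsed.trans (Nat.le_floor h1)
  obtain ⟨-, hA, hbd⟩ := run_stored c W n m hb (stream e π)
  -- Only edges after the first phase are compared with `H` and `X`. The early ones are given up at
  -- a cost of at most `W` each, and `S.card` is at most the total weight.
  set M₁ := (S.filter fun x => t ≤ (π.symm x).1).val.map e with hM₁
  set M₀ := (S.filter fun x => ¬ t ≤ (π.symm x).1).val.map e with hM₀
  have hadd : M₁ + M₀ = S.val.map e := by
    rw [hM₁, hM₀, ← Multiset.map_add, Finset.filter_val, Finset.filter_val,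
      Multiset.filter_add_not]
  have hmv : ∀ f ∈ S.val.map e, f.Valid W := by
    intro f hf
    obtain ⟨i, -, rfl⟩ := Multiset.mem_map.1 hf
    exact he i
  have h3 := weight_le_best_of_underfull c hb hW (L := ((stream e π).drop t : List (Edge V)))
    (M := M₁) (valid_H c W n m hb hq) hbd hA
    (fun f hf => hq f (List.mem_of_mem_drop (Multiset.mem_coe.1 hf)))
    (X := (run c W n m (stream e π)).X)
    (by rw [ht.X_eq, Multiset.filter_coe]) (late_le_drop e π S t)
    (hMb.mono (hadd ▸ Multiset.le_add_right _ _)) hl (by linarith) hβ hβm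
  refine le_trans (mul_le_mul_of_nonneg_left ?_ (by linarith)) h3
  have h4 : M₀.card ≤ hits S ⌊2 * p.eps * m⌋₊ π := by
    rw [hM₀, Multiset.card_map]
    exact card_early_le π S htL
  have h5 : weight M₀ ≤ W * M₀.card :=
    weight_le_mul_card fun f hf => hmv f (hadd ▸ Multiset.mem_add.2 (Or.inr hf))
  have h6 : S.card ≤ weight (S.val.map e) := by
    have := card_le_weight hmv
    rwa [Multiset.card_map] at this
  have h7 : weight M₁ + weight M₀ = weight (S.val.map e) := by rw [← hadd, weight_add]
  have h4' : (M₀.card : ℝ) ≤ 16 * p.eps * S.card := le_trans (by exact_mod_cast h4) hS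
  have h5' : (weight M₀ : ℝ) ≤ W * M₀.card := by exact_mod_cast h5
  have h6' : (S.card : ℝ) ≤ weight (S.val.map e) := by exact_mod_cast h6
  have h7' : (weight M₁ : ℝ) + weight M₀ = weight (S.val.map e) := by exact_mod_cast h7
  have h8 : (W : ℝ) * M₀.card ≤ W * (16 * p.eps * weight (S.val.map e)) := by gcongr; nlinarith
  linarith

/-- Few edges of a large set come early, with high probability. -/
theorem card_hits_le (hp0 : 0 < p.eps) (hp1 : p.eps < 1 / 4) {m : ℕ} (hm : 2 ≤ m)
    (S : Finset (Fin m)) (hS : Real.log m ≤ p.eps * S.card) :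
    ((Finset.univ.filter fun π =>
      16 * p.eps * S.card ≤ hits S ⌊2 * p.eps * m⌋₊ π).card : ℝ) ≤
      1 / (m : ℝ) ^ 3 * (m.factorial : ℝ) := by
  have hm' : (2 : ℝ) ≤ m := by exact_mod_cast hm
  have hL : (⌊2 * p.eps * m⌋₊ : ℝ) ≤ 2 * p.eps * m := Nat.floor_le (by positivity)
  set L := ⌊2 * p.eps * m⌋₊
  have hL2 : (L : ℝ) ≤ m / 2 := by nlinarith
  have hL3 : L < m := by
    have : (L : ℝ) < m := by linarith
    exact_mod_cast this
  refine (card_hits_ge_le S hL3 _).trans ?_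
  refine mul_le_mul_of_nonneg_right ?_ (Nat.cast_nonneg _)
  -- `L ≤ m / 2` makes this term at most half of the threshold `16 * eps * S.card`. An exponent of
  -- at most `-8 * Real.log m` remains, more than needed.
  have h1 : 2 * (S.card : ℝ) * L / (m - L) ≤ 8 * p.eps * S.card := by
    rw [div_le_iff₀ (by linarith)]
    have h2 : (S.card : ℝ) * L ≤ S.card * (2 * p.eps * m) := by gcongr
    have h3 : 8 * p.eps * S.card * (m / 2) ≤ 8 * p.eps * S.card * (m - L) := by gcongr; linarith
    linarith
  have h4 : 1 / (m : ℝ) ^ 3 = Real.exp (-(3 * Real.log m)) := by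
    rw [Real.exp_neg, one_div, ← Real.exp_log (by positivity : (0 : ℝ) < m)]
    rw [← Real.exp_nat_mul, Real.log_exp]
    norm_num
  rw [h4]
  refine Real.exp_le_exp.2 ?_
  have h5 : 0 ≤ Real.log m := Real.log_natCast_nonneg m
  linarith

end

section

variable {V : Type*} {b : V → ℕ} {p : Params}

/-! ### The memory -/

section Window

variable {m : ℕ} (e : Fin m → Edge V) (π : Equiv.Perm (Fin m))

theorem length_stream : (stream e π).length = m := by rw [stream, List.length_ofFn]

theorem mem_window {s t : ℕ} {i : Fin m} (hs : s ≤ i.1) (ht : i.1 < t) :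
    e (π i) ∈ ((stream e π).take t).drop s := by
  have hi := i.2
  rw [List.mem_drop_iff_getElem]
  refine ⟨i.1 - s, ?_, ?_⟩
  · rw [List.length_take, length_stream]
    omega
  · have h : s + (i.1 - s) = i.1 := by omega
    simp [stream, h]

/-- `s` will be the start of the last epoch and `t` its end: `missing` counts from the start of the
window, `X` only from its end. -/
theorem card_filter_drop_le (B : Edge V → Prop) (s t T : ℕ) (hs : s ≤ t) :
    ((((stream e π).take T).drop t).filter fun f => B f).length ≤
      (Finset.univ.filter fun i : Fin m => s ≤ i.1 ∧ B (e (π i))).card := by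
  have h1 : ((((stream e π).take T).drop t).filter fun f => B f).length ≤
      (((stream e π).drop t).filter fun f => B f).length :=
    (((List.take_sublist T _).drop t).filter _).length_le
  refine h1.trans ?_
  rw [stream_eq, List.map_map, ← List.map_drop, List.filter_map, List.length_map]
  have h2 : ((((List.finRange m).drop t).filter
      ((fun f => decide (B f)) ∘ (e ∘ π))) : List (Fin m)).Nodup :=
    ((List.nodup_finRange m).sublist (List.drop_sublist _ _)).filter _
  rw [← List.toFinset_card_of_nodup h2]
  refine Finset.card_le_card fun i hi => ?_
  obtain ⟨h3, h4⟩ := List.mem_filter.1 (List.mem_toFinset.1 hi)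
  rw [List.mem_drop_iff_getElem] at h3
  obtain ⟨k, hk, rfl⟩ := h3
  refine Finset.mem_filter.2 ⟨Finset.mem_univ _, ?_, by simpa using h4⟩
  simp only [List.getElem_finRange]
  simp
  omega

end Window

/-- In the order `π`, the edge with index `x` is accepted by the subgraph `H` present after `s`
edges. -/
def AcceptedAfter (c : Choices b p) (W n : ℕ) {m : ℕ} (e : Fin m → Edge V) (s : ℕ)
    (π : Equiv.Perm (Fin m)) (x : Fin m) : Prop :=
  Accepts b p (run c W n m ((stream e π).take s)).H (e x)

/-- More edges than this, if accepted by `H`, will not be missed by an epoch of level `i`. -/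
def threshold (p : Params) (W m i : ℕ) : ℝ := 5 * m * Real.log m / epochLength p W m i

/-- No epoch misses many edges that would be accepted. -/
def Representative (c : Choices b p) (W n : ℕ) {m : ℕ} (e : Fin m → Edge V)
    (π : Equiv.Perm (Fin m)) : Prop :=
  ∀ s i, i ≤ Nat.log 2 m → 0 < epochLength p W m i → s + epochLength p W m i ≤ m →
    π ∉ missing (AcceptedAfter c W n e s) s (threshold p W m i) (epochLength p W m i)

theorem logb_le (m : ℕ) : Real.logb 2 m ≤ 2 * Real.log m := by
  have h1 : 0 ≤ Real.log m := Real.log_natCast_nonneg m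
  have h2 := Real.log_two_gt_d9
  rw [Real.logb, div_le_iff₀ (by linarith)]
  nlinarith

/-- As the epoch length `α` is at least 1, rounding loses at most a factor 2: `α + 1 ≤ 2 * α`. A
second factor 2 comes from `log₂ m ≤ 2 * Real.log m`. -/
theorem threshold_le {m W i : ℕ} (hm : 2 ≤ m) {E : ℝ} (hE : p.eps * E = 1) (hp : 0 < p.eps)
    (h : 0 < epochLength p W m i) :
    threshold p W m i ≤ epochCount p W i * (20 * E * Real.log m ^ 2) := by
  have hm' : (2 : ℝ) ≤ m := by exact_mod_cast hm
  have h1 := logb_pos hm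
  have h2 := logb_le m
  have hN : (0 : ℝ) < epochCount p W i := by exact_mod_cast epochCount_pos p W i
  have hlog : 0 ≤ Real.log m := Real.log_natCast_nonneg m
  have hα : (1 : ℝ) ≤ epochLength p W m i := by exact_mod_cast h
  have h3 : p.eps * m / (Real.logb 2 m * (epochCount p W i : ℝ)) < epochLength p W m i + 1 := by
    rw [epochLength_eq]
    exact Nat.lt_floor_add_one _
  rw [div_lt_iff₀ (by positivity)] at h3
  have hE0 : 0 < E := by
    by_contra h
    nlinarith
  unfold threshold
  rw [div_le_iff₀ (by linarith)]
  set α : ℝ := (epochLength p W m i : ℝ)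
  set N : ℝ := (epochCount p W i : ℝ)
  have h4 : p.eps * m ≤ 2 * α * (2 * Real.log m * N) := by
    refine h3.le.trans ?_
    gcongr
    linarith
  have h5 : (m : ℝ) ≤ E * (2 * α * (2 * Real.log m * N)) := by
    have := mul_le_mul_of_nonneg_left h4 hE0.le
    have h6 : E * (p.eps * m) = m := by rw [← mul_assoc, mul_comm E, hE, one_mul]
    linarith
  calc 5 * (m : ℝ) * Real.log m
      ≤ 5 * (E * (2 * α * (2 * Real.log m * N))) * Real.log m := by gcongr
    _ = _ := by ring

/-- An epoch length of 0 means that the whole stream is short compared with the number of epochs, so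
all remaining edges may be stored. -/
theorem le_of_epochLength_eq_zero {m W i : ℕ} (hm : 2 ≤ m) {E : ℝ} (hE : p.eps * E = 1)
    (hp : 0 < p.eps) (h : epochLength p W m i = 0) :
    (m : ℝ) ≤ epochCount p W i * (2 * E * Real.log m) := by
  have h1 := logb_pos hm
  have h2 := logb_le m
  have hN : (0 : ℝ) < epochCount p W i := by exact_mod_cast epochCount_pos p W i
  rw [epochLength_eq, Nat.floor_eq_zero, div_lt_one (by positivity)] at h
  have hE0 : 0 < E := by
    by_contra h
    nlinarith
  have h3 : p.eps * m ≤ 2 * Real.log m * epochCount p W i := h.le.trans (by gcongr)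
  have h4 := mul_le_mul_of_nonneg_left h3 hE0.le
  have h6 : E * (p.eps * m) = m := by rw [← mul_assoc, mul_comm E, hE, one_mul]
  linarith

theorem lt_epochCount {m W i : ℕ} (hβ : 1 ≤ p.β) (hW : 1 ≤ W) (h : Nat.log 2 m < i) :
    m < epochCount p W i := by
  have h1 : m < 2 ^ i :=
    (Nat.lt_pow_succ_log_self (by norm_num) m).trans_le (Nat.pow_le_pow_right (by norm_num) h)
  have h2 : 0 < p.β ^ 2 * W ^ 2 := by positivity
  unfold epochCount
  rw [mul_assoc, pow_add]
  nlinarith [Nat.mul_le_mul_left (2 ^ i * 2 ^ 2) h2]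

/-- The number of edges in `H`. -/
theorem card_le_of_load_le [Fintype V] (hb : ∀ v, 1 ≤ b v) {W : ℕ} (hW : 1 ≤ W) (hβ : 1 ≤ p.β)
    {G H M : Multiset (Edge V)} (hG : ∀ e ∈ G, e.Valid W) (hH : H ≤ G)
    (hA : ∀ e ∈ H, load b H e ≤ p.β * e.wt) (hM : IsMaxWeightBMatching b G M) :
    H.card ≤ 3 * p.β * W ^ 2 * M.card := by
  obtain ⟨T, hT, hTb, hTc⟩ :=
    exists_isBMatching_of_load_le hb (fun e he => hG e (Multiset.mem_of_le hH he)) hA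
  have h1 := card_le_weight fun e he => hG e (Multiset.mem_of_le (hT.trans hH) he)
  have h2 := hM.2.2 T (hT.trans hH) hTb
  have h3 := weight_le_mul_card fun e he => hG e (Multiset.mem_of_le hM.1 he)
  have h4 : T.card ≤ W * M.card := h1.trans (h2.trans h3)
  have h5 : 1 ≤ p.β * W := Nat.mul_pos hβ hW
  calc H.card ≤ (2 * (p.β * W) + 1) * T.card := hTc
    _ ≤ (3 * (p.β * W)) * (W * M.card) := Nat.mul_le_mul (by omega) h4
    _ = _ := by ring

/-- The number of epochs of the last level. -/
theorem epochCount_le [Fintype V] (hb : ∀ v, 1 ≤ b v) {W : ℕ} (hW : 1 ≤ W)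
    (hp : p.βm + 4 = p.β) (c : Choices b p) {n m : ℕ} {q : List (Edge V)}
    (hq : ∀ e ∈ q, e.Valid W) {G M : Multiset (Edge V)} (hG : ∀ e ∈ G, e.Valid W)
    (hqG : (q : Multiset (Edge V)) ≤ G) (hM : IsMaxWeightBMatching b G M) {K : ℝ} (hK : 1 ≤ K)
    (hMK : M.card ≤ K) {i : ℕ} (hi : i = 0 ∨ 2 * (epochCount p W (i - 1) : ℝ) ≤ phi c W n m q) :
    (epochCount p W i : ℝ) ≤ 11 * (p.β : ℝ) ^ 2 * W ^ 4 * K := by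
  have hβ : (4 : ℝ) ≤ p.β := by exact_mod_cast (show 4 ≤ p.β by omega)
  have hW' : (1 : ℝ) ≤ W := by exact_mod_cast hW
  have h0 : (W : ℝ) ^ 2 ≤ W ^ 4 := pow_le_pow_right₀ hW' (by norm_num)
  have h1 : 1 ≤ (p.β : ℝ) ^ 2 * W ^ 4 := one_le_mul_of_one_le_of_one_le
    (one_le_pow₀ (by linarith)) (one_le_pow₀ hW')
  have h6 : (epochCount p W 0 : ℝ) ≤ 5 * (p.β : ℝ) ^ 2 * W ^ 4 * K := by
    have h2 : (epochCount p W 0 : ℝ) = 4 * (p.β : ℝ) ^ 2 * W ^ 2 + 1 := by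
      unfold epochCount
      push_cast
      norm_num
    have h3 : (p.β : ℝ) ^ 2 * W ^ 2 ≤ (p.β : ℝ) ^ 2 * W ^ 4 := by gcongr
    rw [h2]
    nlinarith
  rcases hi with rfl | hi
  · nlinarith
  · have h2 : (epochCount p W i : ℝ) ≤ 2 * epochCount p W (i - 1) + epochCount p W 0 := by
      have : epochCount p W i ≤ 2 * epochCount p W (i - 1) + epochCount p W 0 := by
        rcases i with _ | i
        · exact Nat.le_add_left _ _
        · have : epochCount p W (i + 1) + 1 = 2 * epochCount p W i := by
            simp only [epochCount]; ring
          simp only [Nat.add_sub_cancel]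
          omega
      exact_mod_cast this
    obtain ⟨hle, hA, -⟩ := run_stored c W n m hb q
    have h3 := card_le_of_load_le hb hW (p := p) (by omega) hG
      ((Multiset.le_add_right _ _).trans (hle.trans hqG)) hA hM
    have h3' : ((run c W n m q).H.card : ℝ) ≤ 3 * p.β * W ^ 2 * M.card := by exact_mod_cast h3
    have h4 : phi c W n m q ≤ _ :=
      potential_le (by linarith : (0 : ℝ) ≤ p.β - 2) (valid_H c W n m hb hq)
    -- Hence the previous count is at most `3 β² W⁴ K`; doubling it and adding the `5 β² W⁴ K` for
    -- level 0 gives the constant 11.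
    have h5 : phi c W n m q ≤ 6 * (p.β : ℝ) ^ 2 * W ^ 4 * K := by
      refine h4.trans ?_
      calc 2 * ((p.β : ℝ) - 2) * W ^ 2 * ((run c W n m q).H.card : ℝ)
          ≤ 2 * p.β * W ^ 2 * (3 * p.β * W ^ 2 * K) := by
            refine mul_le_mul (by gcongr; linarith) (h3'.trans (by gcongr)) (Nat.cast_nonneg _)
              (by positivity)
        _ = _ := by ring
    linarith

end

section

variable {V : Type*} {b : V → ℕ} {p : Params}

section Memory

variable {W n m : ℕ} (e : Fin m → Edge V) (π : Equiv.Perm (Fin m))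

theorem valid_take (he : ∀ i, (e i).Valid W) (T : ℕ) : ∀ f ∈ (stream e π).take T, f.Valid W := by
  intro f hf
  obtain ⟨i, rfl⟩ := (List.mem_ofFn' _ _).1 (List.mem_of_mem_take hf)
  exact he _

theorem take_le_graph (T : ℕ) : ((stream e π).take T : Multiset (Edge V)) ≤ graph e := by
  rw [← coe_stream e π]
  exact Multiset.coe_le.2 (List.take_sublist _ _).subperm

theorem valid_graph (he : ∀ i, (e i).Valid W) : ∀ f ∈ graph e, f.Valid W := by
  intro f hf
  obtain ⟨i, rfl⟩ := (List.mem_ofFn' _ _).1 (Multiset.mem_coe.1 hf)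
  exact he i

variable [Fintype V] (c : Choices b p)

/-- The number of edges in `X`. -/
theorem card_X_le (hb : ∀ v, 1 ≤ b v) (hW : 1 ≤ W) (hm : 2 ≤ m) (hp : p.βm + 4 = p.β)
    (hp0 : 0 < p.eps) {E : ℝ} (hE : p.eps * E = 1) (he : ∀ i, (e i).Valid W)
    {M : Multiset (Edge V)} (hM : IsMaxWeightBMatching b (graph e) M) {K : ℝ} (hK : 1 ≤ K)
    (hMK : M.card ≤ K) (hπ : Representative c W n e π) {T : ℕ} (hT : T ≤ m) :
    ((run c W n m ((stream e π).take T)).X.card : ℝ) ≤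
      11 * (p.β : ℝ) ^ 2 * W ^ 4 * K * (1 + 2 * E * Real.log m + 20 * E * Real.log m ^ 2) := by
  have hq := valid_take e π he T
  have hE0 : 0 < E := by
    by_contra h
    nlinarith
  have hlog : 0 ≤ Real.log m := Real.log_natCast_nonneg m
  have h := phaseInv_run c W n m hb hp _ hq
  rcases hph : (run c W n m ((stream e π).take T)).phase with ⟨i, j, k, found⟩ | _
  · rw [hph] at h
    obtain ⟨-, -, -, -, -, -, h7, -⟩ := h
    rw [h7, Multiset.card_zero, Nat.cast_zero]
    positivity
  rw [hph] at h
  obtain ⟨t, ht⟩ := h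
  obtain ⟨i, hi, hcases⟩ := ht.reason
  have hN := epochCount_le hb hW hp c hq (valid_graph e he) (take_le_graph e π T) hM hK hMK hi
  have hX := card_filter_drop_le e π
    (fun f => Accepts b p (run c W n m ((stream e π).take T)).H f)
  have htT : t ≤ T := by
    have := ht.le_length
    rw [List.length_take] at this
    omega
  have hXm : ((run c W n m ((stream e π).take T)).X.card : ℝ) ≤ m := by
    rw [ht.X_eq, Multiset.coe_card]
    refine Nat.cast_le.2 ((hX t t T le_rfl).trans ((Finset.card_le_univ _).trans ?_))
    rw [Fintype.card_fin]
  have hN0 : (0 : ℝ) ≤ epochCount p W i := Nat.cast_nonneg _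
  suffices hs : ((run c W n m ((stream e π).take T)).X.card : ℝ) ≤
      epochCount p W i * (1 + 2 * E * Real.log m + 20 * E * Real.log m ^ 2) from
    hs.trans (mul_le_mul_of_nonneg_right hN (by positivity))
  have h1 : 0 ≤ (epochCount p W i : ℝ) * (2 * E * Real.log m) := by positivity
  have h2 : 0 ≤ (epochCount p W i : ℝ) * (20 * E * Real.log m ^ 2) := by positivity
  -- If an epoch without acceptances ended the phase, `H` has not changed since its start, so a long
  -- `X` would make `π` an order missed by that epoch. In the other two cases the whole stream is
  -- short compared with the number of epochs.
  rcases hcases with ⟨h3, h4, h5, h6, h7⟩ | ⟨-, h3⟩ | h3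
  · have h8 := threshold_le hm hE hp0 h4
    set α := epochLength p W m i with hα
    have h9 : (((stream e π).take T).take (t - α)) = (stream e π).take (t - α) := by
      rw [List.take_take, min_eq_left (by omega)]
    have h10 : (((stream e π).take T).take t) = (stream e π).take t := by
      rw [List.take_take, min_eq_left htT]
    rw [h9] at h6
    rw [h10] at h7
    have h11 := hπ (t - α) i h3 h4 (by omega)
    rw [missing, Finset.mem_filter] at h11
    have h12 : ∀ x : Fin m, t - α ≤ x.1 → x.1 < t - α + epochLength p W m i →
        ¬ AcceptedAfter c W n e (t - α) π (π x) := by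
      intro x hx1 hx2
      rw [AcceptedAfter, h6]
      exact h7 _ (mem_window e π hx1 (by omega))
    have h13 : ¬ threshold p W m i ≤ _ := fun h13 => h11 ⟨Finset.mem_univ _, h13, h12⟩
    have h14 := hX (t - α) t T (Nat.sub_le _ _)
    rw [← h6] at h14
    have h15 : ((run c W n m ((stream e π).take T)).X.card : ℝ) ≤ threshold p W m i := by
      rw [ht.X_eq, Multiset.coe_card, ← h6]
      exact le_trans (Nat.cast_le.2 h14) (not_le.1 h13).le
    nlinarith
  · have := le_of_epochLength_eq_zero hm hE hp0 h3
    nlinarith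
  · have : (m : ℝ) ≤ epochCount p W i := by
      exact_mod_cast (lt_epochCount (p := p) (by omega) hW h3).le
    nlinarith

/-- The memory needed for each vertex and for each edge of `M`. -/
def memoryFactor (B E w x : ℝ) : ℝ :=
  3 * (3 * B * w ^ 2 + 11 * B ^ 2 * w ^ 4 * (1 + 2 * E * x + 20 * E * x ^ 2) +
    3 * w ^ 2 * E ^ 2 * x) + 21

/-- The bounds for `H`, `X` and `R` are added, with `K = max |M| n ≥ 1`. The final 21 in
`memoryFactor` is `3 + 2 + 16`: the edge being read, the vertices, and the fixed words. -/
theorem words_le [Nonempty V] (hb : ∀ v, 1 ≤ b v) (hW : 1 ≤ W) (hm : 2 ≤ m)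
    (hp : p.βm + 4 = p.β) (hp0 : 0 < p.eps) {E : ℝ} (hE : p.eps * E = 1)
    (he : ∀ i, (e i).Valid W) {M : Multiset (Edge V)}
    (hM : IsMaxWeightBMatching b (graph e) M)
    (hπ : Representative c W (Fintype.card V) e π) {T : ℕ} (hT : T ≤ m) {B : ℝ}
    (hB : p.β ≤ B) :
    ((run c W (Fintype.card V) m ((stream e π).take T)).words (Fintype.card V) : ℝ) ≤
      max (M.card : ℝ) (Fintype.card V : ℝ) * memoryFactor B E W (Real.log m) := by
  have hn : (1 : ℝ) ≤ Fintype.card V := by exact_mod_cast (Fintype.card_pos : 0 < Fintype.card V)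
  obtain ⟨K, hK⟩ : ∃ K, K = max (M.card : ℝ) (Fintype.card V : ℝ) := ⟨_, rfl⟩
  have hMK : (M.card : ℝ) ≤ K := hK ▸ le_max_left _ _
  have hnK : (Fintype.card V : ℝ) ≤ K := hK ▸ le_max_right _ _
  have hK1 : 1 ≤ K := hn.trans hnK
  have hE0 : 0 < E := by
    by_contra h
    nlinarith
  have hB0 : (0 : ℝ) ≤ B := (Nat.cast_nonneg _).trans hB
  have hlog : 0 ≤ Real.log m := Real.log_natCast_nonneg m
  have hX := card_X_le e π c hb hW hm hp hp0 hE he hM hK1 hMK hπ hT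
  have hq := valid_take e π he T
  obtain ⟨hle, hA, -⟩ := run_stored c W (Fintype.card V) m hb ((stream e π).take T)
  have hH := card_le_of_load_le hb hW (p := p) (by omega) (valid_graph e he)
    ((Multiset.le_add_right _ _).trans (hle.trans (take_le_graph e π T))) hA hM
  have hR : ((((run c W (Fintype.card V) m ((stream e π).take T)).R.getD 0).card : ℕ) : ℝ) ≤
      3 * Fintype.card V * W ^ 2 * E ^ 2 * Real.log m := by
    obtain ⟨h1, -⟩ := run_relevant c W (Fintype.card V) m hb _ fun f hf => (hq f hf).1
    rcases hR : (run c W (Fintype.card V) m ((stream e π).take T)).R with _ | R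
    · simp only [Option.getD_none, Multiset.card_zero, Nat.cast_zero]
      positivity
    · obtain ⟨-, h2, -⟩ := h1 R hR
      rw [Option.getD_some]
      rcases h2 with rfl | h2
      · rw [Multiset.card_zero, Nat.cast_zero]
        positivity
      · refine h2.le.trans (le_of_eq ?_)
        have h3 : E = 1 / p.eps := by field_simp; linarith
        rw [auxLimit, h3]
        field_simp
  rw [← hK]
  unfold State.words
  set s := run c W (Fintype.card V) m ((stream e π).take T)
  have hH' : (s.H.card : ℝ) ≤ 3 * p.β * W ^ 2 * M.card := by exact_mod_cast hH
  have hH2 : (s.H.card : ℝ) ≤ K * (3 * B * W ^ 2) := by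
    refine hH'.trans ?_
    calc 3 * (p.β : ℝ) * W ^ 2 * M.card ≤ 3 * B * W ^ 2 * K := by gcongr
      _ = _ := by ring
  have hX2 : (s.X.card : ℝ) ≤
      K * (11 * B ^ 2 * W ^ 4 * (1 + 2 * E * Real.log m + 20 * E * Real.log m ^ 2)) := by
    refine hX.trans ?_
    calc 11 * (p.β : ℝ) ^ 2 * W ^ 4 * K * (1 + 2 * E * Real.log m + 20 * E * Real.log m ^ 2)
        ≤ 11 * B ^ 2 * W ^ 4 * K * (1 + 2 * E * Real.log m + 20 * E * Real.log m ^ 2) := by gcongr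
      _ = _ := by ring
  have hR2 : (((s.R.getD 0).card : ℕ) : ℝ) ≤ K * (3 * W ^ 2 * E ^ 2 * Real.log m) := by
    refine hR.trans ?_
    calc 3 * (Fintype.card V : ℝ) * W ^ 2 * E ^ 2 * Real.log m
        ≤ 3 * K * W ^ 2 * E ^ 2 * Real.log m := by gcongr
      _ = _ := by ring
  unfold memoryFactor
  push_cast
  nlinarith

end Memory

/-- The edges of the stream are representative with high probability. -/
theorem card_not_representative_le (c : Choices b p) (W n : ℕ) {m : ℕ} (hm : 2 ≤ m)
    (e : Fin m → Edge V) :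
    ((Finset.univ.filter fun π => ¬ Representative c W n e π).card : ℝ) ≤
      1 / (m : ℝ) ^ 3 * (m.factorial : ℝ) := by
  have hm' : (2 : ℝ) ≤ m := by exact_mod_cast hm
  -- Start and level of the epoch that ends the first phase depend on the order, so the union bound
  -- runs over all pairs of a start and a level.
  set I := ((Finset.range m) ×ˢ (Finset.range (Nat.log 2 m + 1))).filter fun x =>
    0 < epochLength p W m x.2 ∧ x.1 + epochLength p W m x.2 ≤ m with hI
  have h1 : (Finset.univ.filter fun π => ¬ Representative c W n e π) ⊆ I.biUnion fun x =>
      missing (AcceptedAfter c W n e x.1) x.1 (threshold p W m x.2) (epochLength p W m x.2) := by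
    intro π hπ
    have h2 := (Finset.mem_filter.1 hπ).2
    unfold Representative at h2
    push Not at h2
    obtain ⟨s, i, h3, h4, h5, h6⟩ := h2
    refine Finset.mem_biUnion.2 ⟨(s, i), Finset.mem_filter.2 ⟨Finset.mem_product.2
      ⟨Finset.mem_range.2 ?_, Finset.mem_range.2 ?_⟩, h4, h5⟩, h6⟩ <;> dsimp only <;> omega
  have h2 : ∀ x ∈ I, ((missing (AcceptedAfter c W n e x.1) x.1 (threshold p W m x.2)
      (epochLength p W m x.2)).card : ℝ) ≤ 1 / (m : ℝ) ^ 5 * (m.factorial : ℝ) := by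
    intro x hx
    obtain ⟨-, h3, h4⟩ := Finset.mem_filter.1 hx
    have h5 : (0 : ℝ) < epochLength p W m x.2 := by exact_mod_cast h3
    have hlog : 0 ≤ Real.log m := Real.log_natCast_nonneg m
    refine (card_missing_le (fun π t j ht hj => ?_) (by unfold threshold; positivity) h4).trans
      (mul_le_mul_of_nonneg_right (le_of_eq ?_) (Nat.cast_nonneg _))
    · funext y
      rw [AcceptedAfter, AcceptedAfter, take_stream_mul_swap e π ht hj]
    -- The factor 5 in `threshold` makes each window fail with probability at most `m⁻⁵`, and at
    -- most `m ^ 2` pairs are counted.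
    · have h6 : threshold p W m x.2 * epochLength p W m x.2 / m = 5 * Real.log m := by
        unfold threshold
        field_simp
      rw [h6, Real.exp_neg, one_div, ← Real.exp_log (by positivity : (0 : ℝ) < m),
        ← Real.exp_nat_mul, Real.log_exp]
      norm_num
  have h3 : I.card ≤ m ^ 2 := by
    refine (Finset.card_filter_le _ _).trans ?_
    rw [Finset.card_product, Finset.card_range, Finset.card_range, sq]
    exact Nat.mul_le_mul_left m (Nat.log_lt_self 2 (by omega))
  have h3' : (I.card : ℝ) ≤ (m : ℝ) ^ 2 := by exact_mod_cast h3
  calc ((Finset.univ.filter fun π => ¬ Representative c W n e π).card : ℝ)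
      ≤ ∑ x ∈ I, ((missing (AcceptedAfter c W n e x.1) x.1 (threshold p W m x.2)
          (epochLength p W m x.2)).card : ℝ) := by
        exact_mod_cast (Finset.card_le_card h1).trans Finset.card_biUnion_le
    _ ≤ I.card * (1 / (m : ℝ) ^ 5 * (m.factorial : ℝ)) := by
        rw [← nsmul_eq_mul]
        exact Finset.sum_le_card_nsmul _ _ _ h2
    _ ≤ (m : ℝ) ^ 2 * (1 / (m : ℝ) ^ 5 * (m.factorial : ℝ)) := by gcongr
    _ = _ := by field_simp

end

/-! ### The excluded orders and the final polynomials -/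

section

variable {V : Type*} {b : V → ℕ}

theorem le_toOuterMeasure_uniform {α : Type*} [Fintype α] [Nonempty α] {s : Set α} (F : Finset α)
    (hF : ∀ x, x ∉ F → x ∈ s) {δ : ℝ} (hδ : (F.card : ℝ) ≤ δ * Fintype.card α) :
    ENNReal.ofReal (1 - δ) ≤ (PMF.uniformOfFintype α).toOuterMeasure s := by
  have h1 : ((Fᶜ : Finset α) : Set α) ⊆ s := fun x hx => hF x (by simpa using hx)
  refine le_trans ?_ (MeasureTheory.measure_mono h1)
  have hpos : (0 : ℝ) < Fintype.card α := by exact_mod_cast (Fintype.card_pos : 0 < Fintype.card α)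
  rw [PMF.toOuterMeasure_uniformOfFintype_apply, ← ENNReal.ofReal_natCast, ← ENNReal.ofReal_natCast,
    ← ENNReal.ofReal_div_of_pos hpos]
  refine ENNReal.ofReal_le_ofReal ?_
  have h2 : Fintype.card ((Fᶜ : Finset α) : Set α) = (Fᶜ : Finset α).card := by
    rw [← Set.toFinset_card, Finset.toFinset_coe]
  rw [le_div_iff₀ hpos, h2, Finset.card_compl, Nat.cast_sub (Finset.card_le_univ F)]
  linarith

/-- The guarantees of the algorithm, for an order in which the edges are representative and those
of a given `b`-matching do not come early. -/
theorem weight_le_output [Fintype V] [Nonempty V] (hb : ∀ v, 1 ≤ b v) {W : ℕ} (hW : 1 ≤ W) {ε : ℝ}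
    (hε : 0 < ε) (c : Choices b (params W (1 / ε))) {m : ℕ} (hm : 2 ≤ m) (e : Fin m → Edge V)
    (he : ∀ i, (e i).Valid W) (S : Finset (Fin m))
    (hM : IsMaxWeightBMatching b (graph e) (S.val.map e)) (π : Equiv.Perm (Fin m))
    (hS : Real.log m ≤ (params W (1 / ε)).eps * S.card →
      (hits S ⌊2 * (params W (1 / ε)).eps * m⌋₊ π : ℝ) ≤ 16 * (params W (1 / ε)).eps * S.card) :
    (weight (S.val.map e) : ℝ) ≤ (2 - 1 / (2 * (W : ℝ)) + ε) *
      weight (output c (run c W (Fintype.card V) m (stream e π))) := by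
  have hx : (0 : ℝ) ≤ 1 / ε := by positivity
  have hW' : (1 : ℝ) ≤ W := by exact_mod_cast hW
  have hp0 := params_eps_pos hW hx
  have hp1 := params_eps_le hW hx
  have hq : ∀ f ∈ stream e π, f.Valid W := fun f hf =>
    valid_graph e he f (by rw [← coe_stream e π]; exact hf)
  have hMv : ∀ f ∈ S.val.map e, f.Valid W := fun f hf =>
    valid_graph e he f (Multiset.mem_of_le hM.1 hf)
  obtain ⟨h1, h2⟩ :=
    run_relevant c W (Fintype.card V) m hb (stream e π) fun f hf => (hq f hf).1
  unfold output
  rcases hR : (run c W (Fintype.card V) m (stream e π)).R with _ | R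
  -- A discarded `R` certifies that the optimum has at least `Real.log m / eps` edges, which is what
  -- the concentration hypothesis `hS` asks for.
  · obtain ⟨R, h3, h4, h5⟩ := h2 hR
    rw [coe_stream] at h3
    have h6 := log_le_mul_card hp0 (by linarith) hW (valid_graph e he) h3 h4 h5 hM
    rw [Multiset.card_map] at h6
    have hl : 0 < (params W (1 / ε)).eps / (100 * W) := by positivity
    have hl1 : 15 * ((params W (1 / ε)).eps / (100 * W)) ≤ 1 := by
      rw [mul_div_assoc', div_le_one (by positivity)]
      linarith
    exact ratio_le hε hW (Nat.cast_nonneg _) (Nat.cast_nonneg _)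
      (weight_le_best_of_hits c hb hW hm (params_βm hW hx) hp0 (by linarith) e he π S hM.2.1
        (hS h6) hl hl1 (le_pow_mul_params_β hW hx) (params_βm_ge hW hx))
  -- If `R` was kept, it contains an exact optimum, whatever the order.
  · obtain ⟨-, -, D, hD, h3⟩ := h1 R hR
    have h4 := weight_le_best_of_irrelevant c h3 (M := S.val.map e)
      (by rw [← hD, coe_stream]; exact hM.1) hM.2.1 hMv
    have h5 : (weight (S.val.map e) : ℝ) ≤ weight (c.best R) := by exact_mod_cast h4
    have h6 : 1 / (2 * (W : ℝ)) ≤ 1 := by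
      rw [div_le_one (by positivity)]; linarith
    refine h5.trans (le_mul_of_one_le_left (Nat.cast_nonneg _) (by linarith))

/-- The orders that are excluded in the analysis. -/
def badOrders {p : Params} (c : Choices b p) (W n : ℕ) {m : ℕ} (e : Fin m → Edge V)
    (S : Finset (Fin m)) : Finset (Equiv.Perm (Fin m)) :=
  (Finset.univ.filter fun π => ¬ Representative c W n e π) ∪
    Finset.univ.filter fun π => Real.log m ≤ p.eps * S.card ∧
      16 * p.eps * S.card ≤ hits S ⌊2 * p.eps * m⌋₊ π

theorem of_notMem_badOrders {p : Params} {c : Choices b p} {W n m : ℕ} {e : Fin m → Edge V}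
    {S : Finset (Fin m)} {π : Equiv.Perm (Fin m)} (hπ : π ∉ badOrders c W n e S) :
    Representative c W n e π ∧ (Real.log m ≤ p.eps * S.card →
      (hits S ⌊2 * p.eps * m⌋₊ π : ℝ) ≤ 16 * p.eps * S.card) := by
  rw [badOrders, Finset.mem_union, Finset.mem_filter, Finset.mem_filter] at hπ
  push Not at hπ
  exact ⟨hπ.1 (Finset.mem_univ _), fun h => (hπ.2 (Finset.mem_univ _) h).le⟩

theorem card_badOrders_le {p : Params} (c : Choices b p) (hp0 : 0 < p.eps) (hp1 : p.eps < 1 / 4)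
    (W n : ℕ) {m : ℕ} (hm : 2 ≤ m) (e : Fin m → Edge V) (S : Finset (Fin m)) :
    ((badOrders c W n e S).card : ℝ) ≤ 2 / (m : ℝ) ^ 3 * Fintype.card (Equiv.Perm (Fin m)) := by
  have h1 := card_not_representative_le c W n hm e
  have h2 : ((Finset.univ.filter fun π => Real.log m ≤ p.eps * S.card ∧
      16 * p.eps * S.card ≤ hits S ⌊2 * p.eps * m⌋₊ π).card : ℝ) ≤
      1 / (m : ℝ) ^ 3 * (m.factorial : ℝ) := by
    by_cases h : Real.log m ≤ p.eps * S.card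
    · simp only [h, true_and]
      exact card_hits_le hp0 hp1 hm S h
    · simp only [h, false_and, Finset.filter_false, Finset.card_empty, Nat.cast_zero]
      positivity
  have h3 : ((badOrders c W n e S).card : ℝ) ≤ _ :=
    le_trans (Nat.cast_le.2 (Finset.card_union_le _ _)) (le_of_eq (Nat.cast_add _ _))
  rw [Fintype.card_perm, Fintype.card_fin]
  have h4 : 2 / (m : ℝ) ^ 3 * (m.factorial : ℝ) =
      1 / (m : ℝ) ^ 3 * (m.factorial : ℝ) + 1 / (m : ℝ) ^ 3 * (m.factorial : ℝ) := by ring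
  rw [h4]
  exact h3.trans (add_le_add h1 h2)

open MvPolynomial in
/-- The bound for `β`, as a polynomial in `W` and `1 / ε`. -/
def degreePoly : MvPolynomial (Fin 2) ℝ :=
  16 * X 0 ^ 4 * (100 * X 0 * (100 * X 0 * (1 + X 1))) ^ 4 + 1

theorem eval_degreePoly (W : ℕ) (x : ℝ) :
    MvPolynomial.eval ![(W : ℝ), x] degreePoly = degreeBound W x + 1 := by
  simp [degreePoly, degreeBound, invEps]

open MvPolynomial in
/-- The memory for each vertex and for each edge of a largest `b`-matching, as a polynomial in
`ln m`, `W` and `1 / ε`. -/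
def memoryPoly : MvPolynomial (Fin 3) ℝ :=
  let B := 16 * X 1 ^ 4 * (100 * X 1 * (100 * X 1 * (1 + X 2))) ^ 4 + 1
  let E := 100 * X 1 * (1 + X 2)
  3 * (3 * B * X 1 ^ 2 + 11 * B ^ 2 * X 1 ^ 4 * (1 + 2 * E * X 0 + 20 * E * X 0 ^ 2) +
    3 * X 1 ^ 2 * E ^ 2 * X 0) + 21

theorem eval_memoryPoly (y : ℝ) (W : ℕ) (x : ℝ) :
    MvPolynomial.eval ![y, (W : ℝ), x] memoryPoly =
      memoryFactor (degreeBound W x + 1) (invEps W x) W y := by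
  simp [memoryPoly, memoryFactor, degreeBound, invEps]

end

end BMatch

end

theorem mainTheorem9 :
    ∃ (P : MvPolynomial (Fin 3) ℝ) (Q : MvPolynomial (Fin 2) ℝ),
      ∀ (ε : ℝ) (W : ℕ), 0 < ε → 1 ≤ W →
        ∃ p : BMatch.Params, p.Admissible W ∧
          (p.β : ℝ) ≤ MvPolynomial.eval ![(W : ℝ), 1 / ε] Q ∧
          ∀ (V : Type*) [Fintype V] [Nonempty V] (b : V → ℕ), (∀ v, 1 ≤ b v) →
          ∀ (c : BMatch.Choices b p) (m : ℕ) (e : Fin m → BMatch.Edge V),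
            (∀ i, (e i).Valid W) →
          ∀ M : Multiset (BMatch.Edge V),
            BMatch.IsMaxWeightBMatching b (BMatch.graph e) M →
            ENNReal.ofReal (1 - 2 / (m : ℝ) ^ 3) ≤
              (PMF.uniformOfFintype (Equiv.Perm (Fin m))).toOuterMeasure
                {π | BMatch.output c (BMatch.run c W (Fintype.card V) m (BMatch.stream e π)) ≤
                       BMatch.graph e ∧
                     BMatch.IsBMatching b
                       (BMatch.output c
                         (BMatch.run c W (Fintype.card V) m (BMatch.stream e π))) ∧
                     (BMatch.weight M : ℝ) ≤
                       (2 - 1 / (2 * (W : ℝ)) + ε) *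
                         (BMatch.weight (BMatch.output c
                           (BMatch.run c W (Fintype.card V) m (BMatch.stream e π))) : ℝ) ∧
                     ∀ t ≤ m,
                       (((BMatch.run c W (Fintype.card V) m
                          ((BMatch.stream e π).take t)).words (Fintype.card V) : ℕ) : ℝ) ≤
                         max (M.card : ℝ) (Fintype.card V : ℝ) *
                           MvPolynomial.eval ![Real.log (m : ℝ), (W : ℝ), 1 / ε] P} := by
  refine ⟨BMatch.memoryPoly, BMatch.degreePoly, fun ε W hε hW => ?_⟩
  have hx : (0 : ℝ) ≤ 1 / ε := by positivity
  refine ⟨BMatch.params W (1 / ε), BMatch.params_admissible hW hx, ?_, ?_⟩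
  · rw [BMatch.eval_degreePoly]
    exact BMatch.params_β_le hW hx
  intro V _ _ b hb c m e he M hM
  rw [BMatch.eval_memoryPoly]
  have hn : (1 : ℝ) ≤ Fintype.card V := by exact_mod_cast (Fintype.card_pos : 0 < Fintype.card V)
  have hB0 : (0 : ℝ) ≤ BMatch.degreeBound W (1 / ε) + 1 :=
    (Nat.cast_nonneg _).trans (BMatch.params_β_le hW hx)
  have hout : ∀ π, _ := fun π => BMatch.output_of_run c W (Fintype.card V) m hb (BMatch.stream e π)
    fun f hf => (BMatch.valid_graph e he f (by rw [← BMatch.coe_stream e π]; exact hf)).1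
  -- Passing to a set of indices distinguishes equal parallel edges, as counting positions in the
  -- random order requires.
  obtain ⟨S, rfl⟩ := BMatch.exists_index_set e hM.1
  rcases Nat.lt_or_ge m 2 with hm | hm
  · obtain rfl | rfl : m = 0 ∨ m = 1 := by omega
    -- For `m = 0` the quotient `2 / 0 ^ 3` is 0 and the bound reads 1, so no order may be excluded;
    -- the stream is empty.
    · refine BMatch.le_toOuterMeasure_uniform ∅ (fun π _ => ?_) (by simp)
      have h1 := hout π
      rw [BMatch.coe_stream] at h1
      have h2 : S.val.map e = 0 := by rw [Finset.eq_empty_of_isEmpty S]; rfl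
      refine ⟨h1.1, h1.2, ?_, fun t _ => ?_⟩
      · have h3 : BMatch.weight (S.val.map e) = 0 := by rw [h2]; rfl
        have h4 : 1 / (2 * (W : ℝ)) ≤ 1 := by
          have : (1 : ℝ) ≤ W := by exact_mod_cast hW
          rw [div_le_one (by positivity)]; linarith
        rw [h3, Nat.cast_zero]
        exact mul_nonneg (by linarith) (Nat.cast_nonneg _)
      · have h3 : (BMatch.stream e π).take t = [] := by simp [BMatch.stream]
        have h4 : (Fintype.card V : ℝ) ≤ max ((S.val.map e).card : ℝ) (Fintype.card V : ℝ) :=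
          le_max_right _ _
        rw [h3, BMatch.run_nil]
        simp only [BMatch.State.words, BMatch.initState, BMatch.memoryFactor, Multiset.card_zero,
          Option.getD_some, Nat.cast_zero, Real.log_zero]
        push_cast
        have h5 : 0 ≤ 9 * (BMatch.degreeBound W (1 / ε) + 1) * (W : ℝ) ^ 2 +
          33 * (BMatch.degreeBound W (1 / ε) + 1) ^ 2 * (W : ℝ) ^ 4 := by positivity
        nlinarith
    -- For `m = 1` the bound `1 - 2` is negative.
    · rw [ENNReal.ofReal_of_nonpos (by norm_num)]
      exact zero_le
  · refine BMatch.le_toOuterMeasure_uniform (BMatch.badOrders c W (Fintype.card V) e S)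
      (fun π hπ => ?_) (BMatch.card_badOrders_le c (BMatch.params_eps_pos hW hx)
        (by linarith [BMatch.params_eps_le hW hx]) W _ hm e S)
    obtain ⟨hrep, hhits⟩ := BMatch.of_notMem_badOrders hπ
    have h1 := hout π
    rw [BMatch.coe_stream] at h1
    exact ⟨h1.1, h1.2, BMatch.weight_le_output hb hW hε c hm e he S hM π hhits,
      fun t ht =>
      BMatch.words_le e π c hb hW hm (BMatch.params_βm hW hx) (BMatch.params_eps_pos hW hx)
        (BMatch.params_eps_mul hW hx) he hM hrep ht
        (BMatch.params_β_le hW hx)⟩
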